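/- Let $a_i,b_i,c_i$ ($i=1,2,\dots$), $\eta(t)$ ($t\in\mathbb Z$) and $\xi_i(t)$ ($i=1,2,\dots$, $t\in\mathbb Z$) be real random variables on a common probability space, and let $\beta>1$, $\nu>0$, $\kappa>0$, $p>1$, $r>1$ be real numbers. Assume: (G) the $a_i\in(0,1)$ are independent with a common c.d.f. $G(x)=\mathbb P(a_i\le x)$, $x\in[0,1]$, and for some $\epsilon\in(0,1)$ the function $G$ is continuously differentiable on $(1-\epsilon,1)$ with derivative $$g(x)=\kappa\beta(1-x)^{\beta-1}\bigl(1+O((1-x)^{\nu})\bigr),\qquad x\to1-;$$ (A1) $\eta(t)$, $t\in\mathbb Z$, are i.i.d. with $\mathbb E\eta(t)=0$, $\mathbb E\eta^2(t)=1$, $\mathbb E|\eta(t)|^{2p}<\infty$; (A2) $\xi_i(t)$, $t\in\mathbb Z$, $i=1,2,\dots$, are i.i.d. with $\mathbb E\xi_i(t)=0$, $\mathbb E\xi_i^2(t)=1$, $\mathbb E|\xi_i(t)|^{2p}<\infty$; (A3) $(b_i,c_i)$, $i=1,2,\dots$, are i.i.d. random vectors with possibly dependent components $b_i\ge0$, $c_i\ge0$,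 $\mathbb P(b_i+c_i=0)=0$ and $\mathbb E(b_i^2+c_i^2)<\infty$; (A4) for each $i$, the sequences $\{\eta(t)\}_{t\in\mathbb Z}$ and $\{\xi_i(t)\}_{t\in\mathbb Z}$, the variable $a_i$ and the vector $(b_i,c_i)$ are mutually independent. For each $i$ let $\{X_i(t)\}_{t\in\mathbb Z}$ be a strictly stationary solution of $$X_i(t)=a_iX_i(t-1)+\zeta_i(t),\qquad \zeta_i(t)=b_i\eta(t)+c_i\xi_i(t),\qquad t\in\mathbb Z.$$ For integers $T=T_N$ and thresholds $\delta=\delta_N>0$ put $\overline X_i=T^{-1}\sum_{t=1}^TX_i(t)$, $$\widehat a_i=\frac{\sum_{t=1}^{T-1}(X_i(t)-\overline X_i)(X_i(t+1)-\overline X_i)}{\sum_{t=1}^{T}(X_i(t)-\overline X_i)^2},\qquad \widetilde a_i=\min\{\widehat a_i,1-\delta^r\},$$ $$\widetilde\beta_N=\frac{\sum_{i=1}^N\mathbf 1(\widetilde a_i>1-\delta)}{\sum_{i=1}^N\mathbf 1(\widetilde a_i>1-\delta)\ln(\delta/(1-\widetilde a_i))}$$ (a quotient with zero denominator is given the value $0$).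 Suppose that, as $N\to\infty$, $\delta\to0$, $$N\delta^{\beta}\to\infty,\qquad N\delta^{\beta+2\min\{\nu,(r-1)\beta\}}\to0,$$ and that $T\to\infty$ so that $\gamma:=\bigl(T^{\min\{p-1,p/2\}}\delta^{p+\beta}\bigr)^{-1/(p+1)}\to0$ and $$\sqrt{N\delta^\beta}\,\gamma\ln\delta\to0\quad\text{if }1<p\le2,\qquad \sqrt{N\delta^\beta}\,\max\Bigl\{\frac1{T\delta^\beta},\gamma\Bigr\}\ln\delta\to0\quad\text{if }2<p<\infty.$$ Then $$\sqrt{N\delta^\beta}\,(\widetilde\beta_N-\beta)\to_d\mathcal N(0,\beta^2/\kappa).$$ -/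

import Mathlib

open MeasureTheory ProbabilityTheory Filter Topology Asymptotics

namespace RCAR

noncomputable section

variable {Ω : Type*} [MeasurableSpace Ω]

/-- Condition on the random autoregressive coefficients `a i` (indexed from `0`):
they are independent with values in `(0, 1)` and with a common c.d.f. `G`, which is continuously
differentiable on some interval `(1 - ε, 1)`, with derivative `g` satisfying
`g x = κ β (1 - x) ^ (β - 1) (1 + O((1 - x) ^ ν))` as `x → 1-`. -/
structure CondG (μ : Measure Ω) (a : ℕ → Ω → ℝ) (β ν κ : ℝ) : Prop where
  one_lt_beta : 1 < β
  nu_pos : 0 < ν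
  kappa_pos : 0 < κ
  measurable : ∀ i, Measurable (a i)
  mem_Ioo : ∀ i, ∀ᵐ ω ∂μ, a i ω ∈ Set.Ioo (0 : ℝ) 1
  indep : iIndepFun a μ
  tail : ∃ G : ℝ → ℝ, (∀ i, ∀ x ∈ Set.Icc (0 : ℝ) 1, G x = μ.real {ω | a i ω ≤ x}) ∧
    ∃ ε ∈ Set.Ioo (0 : ℝ) 1, ∃ g : ℝ → ℝ,
      (∀ x ∈ Set.Ioo (1 - ε) 1, HasDerivAt G (g x) x) ∧
      ContinuousOn g (Set.Ioo (1 - ε) 1) ∧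
      ∃ R : ℝ → ℝ, R =O[𝓝[<] 1] (fun x => (1 - x) ^ ν) ∧
        ∀ x ∈ Set.Ioo (1 - ε) 1, g x = κ * β * (1 - x) ^ (β - 1) * (1 + R x)

/-- The variables `Z j` are i.i.d., centred, with unit variance and a finite absolute moment
of order `2 p`. Used for the common shock and for the idiosyncratic shocks. -/
structure IIDShock {ι : Type*} (μ : Measure Ω) (Z : ι → Ω → ℝ) (p : ℝ) : Prop where
  measurable : ∀ j, Measurable (Z j)
  indep : iIndepFun Z μ
  identDistrib : ∀ j k, IdentDistrib (Z j) (Z k) μ μ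
  mean_zero : ∀ j, ∫ ω, Z j ω ∂μ = 0
  variance_one : ∀ j, ∫ ω, Z j ω ^ 2 ∂μ = 1
  moment : ∀ j, Integrable (fun ω => |Z j ω| ^ (2 * p)) μ

/-- Assumptions on the common shock `η t`, the idiosyncratic shocks `ξ i t`, the
autoregressive coefficients `a i` and the random weights `(b i, c i)`. -/
structure CondA (μ : Measure Ω) (a b c : ℕ → Ω → ℝ) (η : ℤ → Ω → ℝ) (ξ : ℕ → ℤ → Ω → ℝ)
    (p : ℝ) : Prop where
  one_lt_p : 1 < p
  common : IIDShock μ η p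
  /-- i.i.d. jointly in the unit and in time. -/
  idiosyncratic : IIDShock μ (fun (j : ℕ × ℤ) => ξ j.1 j.2) p
  measurable_b : ∀ i, Measurable (b i)
  measurable_c : ∀ i, Measurable (c i)
  weights_indep : iIndepFun (fun i ω => (b i ω, c i ω)) μ
  weights_identDistrib : ∀ i j,
    IdentDistrib (fun ω => (b i ω, c i ω)) (fun ω => (b j ω, c j ω)) μ μ
  weights_nonneg : ∀ i, ∀ᵐ ω ∂μ, 0 ≤ b i ω ∧ 0 ≤ c i ω
  weights_ne_zero : ∀ i, μ {ω | b i ω + c i ω = 0} = 0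
  weights_integrable : ∀ i, Integrable (fun ω => b i ω ^ 2 + c i ω ^ 2) μ
  /-- For each `i`, mutual independence of the sequence `η`, the sequence `ξ i`, the
  variable `a i` and the vector `(b i, c i)`. -/
  mutual_indep : ∀ i, iIndep
    (![MeasurableSpace.comap (fun ω (t : ℤ) => η t ω) inferInstance,
       MeasurableSpace.comap (fun ω (t : ℤ) => ξ i t ω) inferInstance,
       MeasurableSpace.comap (a i) inferInstance,
       MeasurableSpace.comap (fun ω => (b i ω, c i ω)) inferInstance] :
      Fin 4 → MeasurableSpace Ω) μ

/-- The innovations `ζ_i(t) = b_i η(t) + c_i ξ_i(t)`. -/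
def innovation (b c : ℕ → Ω → ℝ) (η : ℤ → Ω → ℝ) (ξ : ℕ → ℤ → Ω → ℝ)
    (i : ℕ) (t : ℤ) (ω : Ω) : ℝ :=
  b i ω * η t ω + c i ω * ξ i t ω

/-- `Y` is strictly stationary: the law of the whole path is invariant under time shifts. -/
def StrictlyStationary (μ : Measure Ω) (Y : ℤ → Ω → ℝ) : Prop :=
  (∀ t, Measurable (Y t)) ∧
    ∀ h : ℤ, μ.map (fun ω t => Y (t + h) ω) = μ.map (fun ω t => Y t ω)

/-- `Y` is a strictly stationary solution of the AR(1) equation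
`Y(t) = A Y(t-1) + Z(t)`, `t ∈ ℤ`, with random coefficient `A` and innovations `Z`. -/
def IsStationaryRCAR (μ : Measure Ω) (A : Ω → ℝ) (Z Y : ℤ → Ω → ℝ) : Prop :=
  StrictlyStationary μ Y ∧ ∀ t : ℤ, ∀ᵐ ω ∂μ, Y t ω = A ω * Y (t - 1) ω + Z t ω

/-- Sample mean of `y 1, …, y T`. -/
def sampleMean (y : ℤ → ℝ) (T : ℕ) : ℝ :=
  (∑ t ∈ Finset.Icc (1 : ℤ) T, y t) / T

/-- Sample lag-1 autocorrelation of `y 1, …, y T`. -/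
def sampleAutocorr (y : ℤ → ℝ) (T : ℕ) : ℝ :=
  (∑ t ∈ Finset.Icc (1 : ℤ) (T - 1), (y t - sampleMean y T) * (y (t + 1) - sampleMean y T)) /
    ∑ t ∈ Finset.Icc (1 : ℤ) T, (y t - sampleMean y T) ^ 2

/-- The observation `x` truncated at level `1 - δ ^ r`. -/
def truncated (δ r x : ℝ) : ℝ := min x (1 - δ ^ r)

/-- The tail index estimator computed from the truncations of the `N` observations
`x 0, …, x (N - 1)`, with threshold `δ` and truncation exponent `r`. -/
def tailEstimator (δ r : ℝ) (N : ℕ) (x : ℕ → ℝ) : ℝ :=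
  (∑ i ∈ Finset.range N, Set.indicator (Set.Ioi (1 - δ)) (fun _ => (1 : ℝ)) (truncated δ r (x i))) /
    ∑ i ∈ Finset.range N, Set.indicator (Set.Ioi (1 - δ))
      (fun u => Real.log (δ / (1 - u))) (truncated δ r (x i))

/-- The rate `γ = (T ^ min {p - 1, p / 2} δ ^ (p + β)) ^ (-1 / (p + 1))`. -/
def gammaRate (p β T δ : ℝ) : ℝ :=
  1 / (T ^ min (p - 1) (p / 2) * δ ^ (p + β)) ^ (1 / (p + 1))

end

end RCAR

/-!
The estimator is a Hill-type quotient computed from estimated coefficients. Write `y i = 1 - a i` and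
`S = N δ ^ β`. With the exact coefficients in place of the sample autocorrelations, and without
truncation, its numerator counts the `i` with `y i < δ`, and its denominator sums the log excesses
`max (log (δ / y i)) 0`. Condition `CondG` says that `P (y i < u) = κ u ^ β (1 + O(u ^ ν))`, so that
the log excesses behave like exponential variables with parameter `β` carrying the mass `κ δ ^ β`
(`TailBounds.integral_logExcess_rpow`). Hence the denominator divided by `S` converges to `κ / β`, by
Chebyshev's inequality, and the sum of the scores `1(y i < δ) - β * logExcess δ (y i)`, divided by
`√S`, converges to `N(0, κ)`, by a Lyapunov central limit theorem for triangular arrays, the bias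
being `O(√(N δ ^ (β + 2 ν)))`. Slutsky's theorem gives the limit law `N(0, κ / (κ / β) ^ 2)`, which is
`N(0, β ^ 2 / κ)`. Truncation at `1 - δ ^ r` only removes the log excess over the smaller threshold
`δ ^ r`, whose mean is `O(δ ^ (r β))`.

It remains to replace the coefficients by their estimates. A log excess is the integral of
`1(y i < u) / u` over the levels `u ∈ (δ ^ r, δ)`, so the error in `L¹` is at most `(r - 1) |log δ|`
times the largest probability, over `u ≤ δ`, that the sample autocorrelation and the coefficient lie
on different sides of `1 - u`. This probability is `O(δ ^ β / √(T δ) + 1 / T)`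
(`UnitModel.measure_mismatch_le`). Indeed, by an algebraic identity the estimation error is
essentially `(1 - a) M / T` with a martingale `M = ∑ x (t - 1) z t` of variance at most
`T / (1 - a)`, up to end point terms of mean `O(1 / T)`. Since the law of `y i` has a density of
order `δ ^ (β - 1)` on `(0, δ)`, integrating the conditional Chebyshev bound
`(1 - a) / (T (y - u) ^ 2)` over `|y - u| > √(δ / T)` gives `δ ^ β / √(T δ)`. Only second moments
of the shocks enter; the moment exponent `p` occurs just in the growth conditions on `T`, which imply
that this bound is negligible compared with `δ ^ β / (√S |log δ|)` (`tendsto_rate_mul_log`).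

The shocks are shared by all units, so the estimation errors of different units are dependent; the
`L¹` bounds do not see this dependence. For a single unit, the second moment bounds are proved with
the coefficients frozen and then integrated, by independence of coefficients and shocks. The
stationary solution is reached from finite moving averages because `A ^ m X (1 - m)` tends to `0` in
probability, the law of `X (1 - m)` being independent of `m`.
-/

open scoped ENNReal NNReal

/-! ### Algebra of the sample autocorrelation -/

namespace RCAR

lemma sum_Icc_one_eq_first_add (f : ℤ → ℝ) {T : ℕ} (hT : 2 ≤ T) :
    ∑ t ∈ Finset.Icc (1 : ℤ) T, f t = f 1 + ∑ t ∈ Finset.Icc (2 : ℤ) T, f t := by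
  have h : Finset.Icc (1 : ℤ) T = insert 1 (Finset.Icc (2 : ℤ) T) := by
    ext t; simp only [Finset.mem_insert, Finset.mem_Icc]; omega
  rw [h, Finset.sum_insert (by simp)]

lemma sum_Icc_one_pred (f : ℤ → ℝ) (T : ℕ) :
    ∑ t ∈ Finset.Icc (1 : ℤ) (T - 1), f t = ∑ t ∈ Finset.Icc (2 : ℤ) T, f (t - 1) := by
  refine Finset.sum_bij' (fun t _ => t + 1) (fun t _ => t - 1) ?_ ?_ ?_ ?_ ?_ <;>
    intros <;> simp_all only [Finset.mem_Icc, add_sub_cancel_right, sub_add_cancel] <;> omega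

lemma sum_Icc_one_eq_add_last (f : ℤ → ℝ) {T : ℕ} (hT : 2 ≤ T) :
    ∑ t ∈ Finset.Icc (1 : ℤ) T, f t = ∑ t ∈ Finset.Icc (2 : ℤ) T, f (t - 1) + f T := by
  have h : Finset.Icc (1 : ℤ) T = insert (T : ℤ) (Finset.Icc (1 : ℤ) (T - 1)) := by
    ext t; simp only [Finset.mem_insert, Finset.mem_Icc]; omega
  rw [h, Finset.sum_insert (by simp), sum_Icc_one_pred, add_comm]

/-- The sample lag-1 autocorrelation is invariant under rescaling. -/
lemma sampleAutocorr_const_mul {s : ℝ} (hs : s ≠ 0) (y : ℤ → ℝ) (T : ℕ) :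
    sampleAutocorr (fun t => s * y t) T = sampleAutocorr y T := by
  have hm : sampleMean (fun t => s * y t) T = s * sampleMean y T := by
    simp only [sampleMean, ← Finset.mul_sum, mul_div_assoc]
  simp only [sampleAutocorr, hm]
  have h1 : ∀ t : ℤ, (s * y t - s * sampleMean y T) * (s * y (t + 1) - s * sampleMean y T)
      = s ^ 2 * ((y t - sampleMean y T) * (y (t + 1) - sampleMean y T)) := fun t => by ring
  have h2 : ∀ t : ℤ, (s * y t - s * sampleMean y T) ^ 2
      = s ^ 2 * (y t - sampleMean y T) ^ 2 := fun t => by ring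
  simp only [h1, h2, ← Finset.mul_sum]
  exact mul_div_mul_left _ _ (pow_ne_zero 2 hs)

/-- The remainder `Z² / T² + (1 - a) (x₁² + x_T²) / T` collecting the contributions of the sample
mean and of the end points `x₁`, `x_T` to the error of the sample autocorrelation of an
autoregression with coefficient `a` and sum of innovations `Z`. -/
noncomputable def endpointError (a T x₁ xT Z : ℝ) : ℝ :=
  Z ^ 2 / T ^ 2 + (1 - a) * (x₁ ^ 2 + xT ^ 2) / T

/-- Numerical core of `abs_sampleAutocorr_sub_le`, with `m` the sample mean and `D` the
sample variance times `T`. -/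
lemma autoregression_error_aux {a T x₁ xT Z M V m A₂ : ℝ} (ha0 : 0 < a) (ha1 : a < 1)
    (hT : 2 ≤ T) (hTa : 1 ≤ T * (1 - a))
    (hm : (1 - a) * (T * m) = x₁ - a * xT + Z)
    (hA : (1 - a ^ 2) * A₂ = x₁ ^ 2 - xT ^ 2 + 2 * a * M + V)
    (hV : T / 8 ≤ V) (hM : |M| ≤ T / 100)
    (hH : endpointError a T x₁ xT Z ≤ (1 - a) / 1000) :
    T ≤ 25 * ((1 - a) * (A₂ + xT ^ 2 - T * m ^ 2)) ∧
    (1 - a) * |M - a * xT ^ 2 + m * xT * (1 + a) - m * Z - m ^ 2| ≤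
      (1 - a) * |M| + 10 * (T * endpointError a T x₁ xT Z) := by
  set H := endpointError a T x₁ xT Z with hHdef
  set y := 1 - a with hy
  have hy0 : 0 < y := by linarith
  have hy1 : y < 1 := by linarith
  have hTp : 0 < T := by linarith
  have hTH : T * (T * H) = Z ^ 2 + y * T * (x₁ ^ 2 + xT ^ 2) := by
    simp only [hHdef, endpointError]
    rw [← hy]
    field_simp
  have hTT : 1 ≤ y * T := by linarith
  have e1 : x₁ ^ 2 + xT ^ 2 ≤ y * T * (x₁ ^ 2 + xT ^ 2) :=
    le_mul_of_one_le_left (by positivity) hTT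
  have eZ : Z ^ 2 ≤ T * (T * H) := by
    rw [hTH]; nlinarith [sq_nonneg x₁, sq_nonneg xT]
  have eX : x₁ ^ 2 + xT ^ 2 + Z ^ 2 ≤ T * (T * H) := by rw [hTH]; linarith
  have exT : y * xT ^ 2 ≤ T * H := by
    have : T * (y * xT ^ 2) ≤ T * (T * H) := by
      rw [hTH]; nlinarith [sq_nonneg Z, mul_nonneg (mul_pos hy0 hTp).le (sq_nonneg x₁)]
    exact le_of_mul_le_mul_left this hTp
  have exx : y * (x₁ ^ 2 + xT ^ 2) ≤ T * H := by
    have : T * (y * (x₁ ^ 2 + xT ^ 2)) ≤ T * (T * H) := by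
      rw [hTH]; nlinarith [sq_nonneg Z]
    exact le_of_mul_le_mul_left this hTp
  -- `y² m² ≤ 3 H`, from the telescoped recursion
  have em : (y * m) ^ 2 ≤ 3 * H := by
    have h1 : (y * (T * m)) ^ 2 ≤ 3 * (x₁ ^ 2 + xT ^ 2 + Z ^ 2) := by
      rw [hm]
      have haa : a ^ 2 ≤ 1 := by nlinarith
      nlinarith [sq_nonneg (x₁ + a * xT), sq_nonneg (x₁ - Z), sq_nonneg (a * xT + Z),
        mul_nonneg (sub_nonneg.2 haa) (sq_nonneg xT)]
    have h2 : T * (T * (y * m) ^ 2) ≤ T * (T * (3 * H)) := by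
      calc T * (T * (y * m) ^ 2) = (y * (T * m)) ^ 2 := by ring
        _ ≤ 3 * (x₁ ^ 2 + xT ^ 2 + Z ^ 2) := h1
        _ ≤ 3 * (T * (T * H)) := by gcongr
        _ = _ := by ring
    exact le_of_mul_le_mul_left (le_of_mul_le_mul_left h2 hTp) hTp
  have hH0 : 0 ≤ H := by linarith [sq_nonneg (y * m)]
  have ym : y * m ^ 2 ≤ T * (3 * H) := by
    calc y * m ^ 2 ≤ y * T * (y * m ^ 2) := le_mul_of_one_le_left (by positivity) hTT
      _ = T * (y * m) ^ 2 := by ring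
      _ ≤ T * (3 * H) := by gcongr
  constructor
  · have h5 : y * xT ^ 2 ≤ T * (y / 1000) := exT.trans (by gcongr)
    have h6 : xT ^ 2 ≤ T / 1000 :=
      le_of_mul_le_mul_left (h5.trans_eq (by ring : _ = y * (T / 1000))) hy0
    have h7 : y * (T * m ^ 2) ≤ T * (3 / 1000) := by
      have h8 : y * (y * (T * m ^ 2)) ≤ y * (T * (3 / 1000)) := by
        calc y * (y * (T * m ^ 2)) = T * (y * m) ^ 2 := by ring
          _ ≤ T * (3 * (y / 1000)) := by gcongr; linarith
          _ = _ := by ring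
      exact le_of_mul_le_mul_left h8 hy0
    have haM : -(T / 100) ≤ a * M := by
      have h8 : |a * M| ≤ T / 100 := by
        rw [abs_mul, abs_of_pos ha0]
        exact (mul_le_of_le_one_left (abs_nonneg M) ha1.le).trans hM
      exact (abs_le.1 h8).1
    have h3 : (1 + a) * (y * (A₂ + xT ^ 2)) ≥ T / 10 := by
      have h8 : (1 + a) * (y * (A₂ + xT ^ 2)) = x₁ ^ 2 - a ^ 2 * xT ^ 2 + 2 * (a * M) + V := by
        rw [hy]; linear_combination hA
      have h9 : a ^ 2 * xT ^ 2 ≤ xT ^ 2 :=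
        mul_le_of_le_one_left (sq_nonneg _) (pow_le_one₀ ha0.le ha1.le)
      rw [h8]
      linarith [sq_nonneg x₁]
    have h10 : 0 ≤ y * (A₂ + xT ^ 2) := by
      by_contra hneg
      push Not at hneg
      linarith [mul_neg_of_pos_of_neg (show 0 < 1 + a by linarith) hneg]
    have h11 : (1 + a) * (y * (A₂ + xT ^ 2)) ≤ 2 * (y * (A₂ + xT ^ 2)) := by
      gcongr; linarith
    linarith [mul_sub y (A₂ + xT ^ 2) (T * m ^ 2)]
  · have k1 : |y * (a * xT ^ 2)| ≤ T * H := by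
      rw [abs_of_nonneg (by positivity)]
      calc y * (a * xT ^ 2) ≤ y * (1 * xT ^ 2) := by gcongr
        _ ≤ T * H := by simpa using exT
    have k2 : |y * (m * xT * (1 + a))| ≤ 4 * (T * H) := by
      rw [abs_mul, abs_mul, abs_mul, abs_of_pos hy0, abs_of_pos (show 0 < 1 + a by linarith)]
      have h1 : |m| * |xT| * (1 + a) ≤ m ^ 2 + xT ^ 2 := by
        calc |m| * |xT| * (1 + a) ≤ |m| * |xT| * 2 := by gcongr; linarith
          _ ≤ |m| ^ 2 + |xT| ^ 2 := by linarith [two_mul_le_add_sq |m| |xT|]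
          _ = m ^ 2 + xT ^ 2 := by rw [sq_abs, sq_abs]
      calc y * (|m| * |xT| * (1 + a)) ≤ y * (m ^ 2 + xT ^ 2) := by gcongr
        _ ≤ 4 * (T * H) := by linarith
    have k3 : |y * (m * Z)| ≤ 2 * (T * H) := by
      have h1 : T * |y * (m * Z)| ≤ T * (2 * (T * H)) := by
        have h2 : T * |y * (m * Z)| = |y * m * T| * |Z| := by
          simp only [abs_mul, abs_of_pos hTp]; ring
        have h3 : (y * m * T) ^ 2 ≤ 3 * (T * (T * H)) := by
          calc (y * m * T) ^ 2 = (y * m) ^ 2 * T ^ 2 := by ring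
            _ ≤ 3 * H * T ^ 2 := by gcongr
            _ = _ := by ring
        have h4 := two_mul_le_add_sq |y * m * T| |Z|
        rw [sq_abs, sq_abs] at h4
        rw [h2]
        linarith
      exact le_of_mul_le_mul_left h1 hTp
    have k4 : |y * m ^ 2| ≤ 3 * (T * H) := by
      rw [abs_of_nonneg (by positivity)]; linarith
    have k5 : y * |M - a * xT ^ 2 + m * xT * (1 + a) - m * Z - m ^ 2| =
        |y * M - y * (a * xT ^ 2) + y * (m * xT * (1 + a)) - y * (m * Z) - y * m ^ 2| := by
      rw [← abs_of_pos hy0, ← abs_mul, abs_of_pos hy0]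
      congr 1; ring
    have k6 : |y * M| = y * |M| := by rw [abs_mul, abs_of_pos hy0]
    rw [k5, ← k6]
    have t1 := abs_sub (y * M - y * (a * xT ^ 2) + y * (m * xT * (1 + a)) - y * (m * Z)) (y * m ^ 2)
    have t2 := abs_sub (y * M - y * (a * xT ^ 2) + y * (m * xT * (1 + a))) (y * (m * Z))
    have t3 := abs_add_le (y * M - y * (a * xT ^ 2)) (y * (m * xT * (1 + a)))
    have t4 := abs_sub (y * M) (y * (a * xT ^ 2))
    linarith

/-- Deterministic bound on the error of the sample autocorrelation as an estimator of the
autoregressive coefficient: outside of atypical configurations of the path, it is of the order of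
the martingale term `(1 - a) |M| / T` plus the end point error. -/
lemma abs_sampleAutocorr_sub_le {a : ℝ} (ha0 : 0 < a) (ha1 : a < 1) {x z : ℤ → ℝ} {T : ℕ}
    (hT : 2 ≤ T) (hrec : ∀ t ∈ Finset.Icc (2 : ℤ) T, x t = a * x (t - 1) + z t)
    (hTa : 1 ≤ T * (1 - a))
    (hV : (T : ℝ) / 8 ≤ ∑ t ∈ Finset.Icc (2 : ℤ) T, z t ^ 2)
    (hM : |∑ t ∈ Finset.Icc (2 : ℤ) T, x (t - 1) * z t| ≤ (T : ℝ) / 100)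
    (hH : endpointError a T (x 1) (x T) (∑ t ∈ Finset.Icc (2 : ℤ) T, z t) ≤ (1 - a) / 1000) :
    |sampleAutocorr x T - a| ≤ 25 * ((1 - a) * |∑ t ∈ Finset.Icc (2 : ℤ) T, x (t - 1) * z t| / T +
      10 * endpointError a T (x 1) (x T) (∑ t ∈ Finset.Icc (2 : ℤ) T, z t)) := by
  have hTr : (2 : ℝ) ≤ T := by exact_mod_cast hT
  have hTp : (0 : ℝ) < T := by linarith
  set I := Finset.Icc (2 : ℤ) T with hI
  set Z := ∑ t ∈ I, z t with hZ
  set M := ∑ t ∈ I, x (t - 1) * z t with hMdef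
  set V := ∑ t ∈ I, z t ^ 2 with hVdef
  set m := sampleMean x T with hmdef
  set A := ∑ t ∈ I, x (t - 1) with hAdef
  set B := ∑ t ∈ I, x t with hBdef
  set A₂ := ∑ t ∈ I, x (t - 1) ^ 2 with hA₂def
  have hTm : T * m = ∑ t ∈ Finset.Icc (1 : ℤ) T, x t := by
    simp only [hmdef, sampleMean]; field_simp
  have hTm1 : T * m = x 1 + B := by rw [hTm, sum_Icc_one_eq_first_add _ hT]
  have hTm2 : T * m = A + x T := by rw [hTm, sum_Icc_one_eq_add_last _ hT]
  have hB : B = a * A + Z := by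
    rw [hBdef, hAdef, hZ, Finset.mul_sum, ← Finset.sum_add_distrib]
    exact Finset.sum_congr rfl hrec
  have hB₂ : ∑ t ∈ I, x t ^ 2 = a ^ 2 * A₂ + 2 * a * M + V := by
    rw [hA₂def, hMdef, hVdef, Finset.mul_sum, Finset.mul_sum, ← Finset.sum_add_distrib,
      ← Finset.sum_add_distrib]
    refine Finset.sum_congr rfl fun t ht => ?_
    rw [hrec t ht]; ring
  have hP : ∑ t ∈ I, x (t - 1) * x t = a * A₂ + M := by
    rw [hA₂def, hMdef, Finset.mul_sum, ← Finset.sum_add_distrib]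
    refine Finset.sum_congr rfl fun t ht => ?_
    rw [hrec t ht]; ring
  have hsq : A₂ + x T ^ 2 = x 1 ^ 2 + ∑ t ∈ I, x t ^ 2 := by
    rw [← sum_Icc_one_eq_first_add (fun t => x t ^ 2) hT,
      sum_Icc_one_eq_add_last (fun t => x t ^ 2) hT]
  have hcard : (I.card : ℝ) = T - 1 := by
    rw [hI, Int.card_Icc]
    have : ((T : ℤ) + 1 - 2).toNat = T - 1 := by omega
    rw [this, Nat.cast_sub (by omega)]; simp
  have hm : (1 - a) * (T * m) = x 1 - a * x T + Z := by linear_combination hTm1 - a * hTm2 + hB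
  have hden : ∑ t ∈ Finset.Icc (1 : ℤ) T, (x t - m) ^ 2 = A₂ + x T ^ 2 - T * m ^ 2 := by
    rw [sum_Icc_one_eq_add_last (fun t => (x t - m) ^ 2) hT]
    have : ∀ t : ℤ, (x (t - 1) - m) ^ 2 = x (t - 1) ^ 2 - 2 * m * x (t - 1) + m ^ 2 :=
      fun t => by ring
    simp only [this, Finset.sum_add_distrib, Finset.sum_sub_distrib, ← Finset.mul_sum,
      Finset.sum_const, nsmul_eq_mul]
    rw [hcard]
    linear_combination 2 * m * hTm2
  have hnum : ∑ t ∈ Finset.Icc (1 : ℤ) (T - 1), (x t - m) * (x (t + 1) - m) =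
      a * A₂ + M - m * (A + B) + (T - 1) * m ^ 2 := by
    rw [sum_Icc_one_pred (fun t => (x t - m) * (x (t + 1) - m))]
    have : ∀ t : ℤ, (x (t - 1) - m) * (x (t - 1 + 1) - m) =
        x (t - 1) * x t - m * x (t - 1) - m * x t + m ^ 2 :=
      fun t => by rw [sub_add_cancel]; ring
    simp only [this, Finset.sum_add_distrib, Finset.sum_sub_distrib, ← Finset.mul_sum,
      Finset.sum_const, nsmul_eq_mul]
    rw [hcard, hP]
    ring
  obtain ⟨h1, h2⟩ := autoregression_error_aux (A₂ := A₂) ha0 ha1 hTr hTa hm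
    (by linear_combination hsq + hB₂) hV hM hH
  set D := A₂ + x T ^ 2 - T * m ^ 2 with hD
  set H := endpointError a T (x 1) (x T) Z
  have hy0 : 0 < 1 - a := by linarith
  have hD0 : 0 < D := by
    by_contra hneg
    push Not at hneg
    nlinarith
  have hdiff : sampleAutocorr x T - a =
      (M - a * x T ^ 2 + m * x T * (1 + a) - m * Z - m ^ 2) / D := by
    have : sampleAutocorr x T = (a * A₂ + M - m * (A + B) + (T - 1) * m ^ 2) / D := by
      rw [sampleAutocorr, ← hmdef, hnum, hden]
    rw [this, eq_div_iff hD0.ne', sub_mul, div_mul_cancel₀ _ hD0.ne', hD]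
    linear_combination m * hTm1 + m * hTm2 - m * hm
  rw [hdiff, abs_div, abs_of_pos hD0, div_le_iff₀ hD0]
  set Q := |M - a * x T ^ 2 + m * x T * (1 + a) - m * Z - m ^ 2|
  have h3 : T * ((1 - a) * Q) ≤ 25 * ((1 - a) * D) * ((1 - a) * |M| + 10 * (T * H)) := by
    have : 0 ≤ (1 - a) * Q := by positivity
    calc T * ((1 - a) * Q) ≤ 25 * ((1 - a) * D) * ((1 - a) * Q) := by gcongr
      _ ≤ _ := by gcongr
  have h4 : ((1 - a) * T) * Q ≤ ((1 - a) * T) *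
      (25 * ((1 - a) * |M| / T + 10 * H) * D) := by
    calc ((1 - a) * T) * Q = T * ((1 - a) * Q) := by ring
      _ ≤ _ := h3
      _ = _ := by field_simp
  exact le_of_mul_le_mul_left h4 (by positivity)

end RCAR

/-! ### White noise and its moving averages -/

namespace RCAR

variable {Ω : Type*} [MeasurableSpace Ω]

/-- If two independent processes `f`, `g` each have independent coordinates, then the pairs
`(f i, g i)` are independent. -/
lemma iIndepFun_prodMk {ι : Type*} {μ : Measure Ω} {f g : ι → Ω → ℝ}
    (hfm : ∀ i, Measurable (f i)) (hgm : ∀ i, Measurable (g i))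
    (hf : iIndepFun f μ) (hg : iIndepFun g μ)
    (hfg : IndepFun (fun ω i => f i ω) (fun ω i => g i ω) μ) :
    iIndepFun (fun i ω => (f i ω, g i ω)) μ := by
  have := hf.isProbabilityMeasure
  rw [iIndepFun_iff_iIndep]
  set C : Set (Set (ℝ × ℝ)) :=
    Set.image2 (· ×ˢ ·) {s : Set ℝ | MeasurableSet s} {t : Set ℝ | MeasurableSet t} with hC
  refine iIndepSets.iIndep (fun i => ((hfm i).prodMk (hgm i)).comap_le)
    (fun i => {s | ∃ t ∈ C, (fun ω => (f i ω, g i ω)) ⁻¹' t = s})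
    (fun i => isPiSystem_prod.comap _) (fun i => ?_) ?_
  · rw [← generateFrom_prod, MeasurableSpace.comap_generateFrom]
    rfl
  · rw [iIndepSets_iff]
    intro s F hF
    choose! t ht hF' using hF
    have ht' : ∀ i ∈ s, ∃ A B : Set ℝ, MeasurableSet A ∧ MeasurableSet B ∧ A ×ˢ B = t i := by
      intro i hi
      obtain ⟨A, hA, B, hB, hAB⟩ := ht i hi
      exact ⟨A, B, hA, hB, hAB⟩
    choose! A B hA hB hAB using ht'
    have hset : ∀ i ∈ s, F i = f i ⁻¹' A i ∩ g i ⁻¹' B i := by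
      intro i hi
      rw [← hF' i hi, ← hAB i hi]
      rfl
    have h1 : ⋂ i ∈ s, F i = (⋂ i ∈ s, f i ⁻¹' A i) ∩ (⋂ i ∈ s, g i ⁻¹' B i) := by
      rw [Set.iInter₂_congr hset]
      ext ω
      simp only [Set.mem_iInter, Set.mem_inter_iff]
      exact ⟨fun h => ⟨fun i hi => (h i hi).1, fun i hi => (h i hi).2⟩,
        fun h i hi => ⟨h.1 i hi, h.2 i hi⟩⟩
    have h2 : μ ((⋂ i ∈ s, f i ⁻¹' A i) ∩ (⋂ i ∈ s, g i ⁻¹' B i)) =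
        μ (⋂ i ∈ s, f i ⁻¹' A i) * μ (⋂ i ∈ s, g i ⁻¹' B i) := by
      have e1 : ⋂ i ∈ s, f i ⁻¹' A i = (fun ω i => f i ω) ⁻¹' (⋂ i ∈ s, (fun v => v i) ⁻¹' A i) := by
        ext; simp
      have e2 : ⋂ i ∈ s, g i ⁻¹' B i = (fun ω i => g i ω) ⁻¹' (⋂ i ∈ s, (fun v => v i) ⁻¹' B i) := by
        ext; simp
      rw [e1, e2]
      exact hfg.measure_inter_preimage_eq_mul _ _
        (s.measurableSet_biInter fun i hi => measurable_pi_apply i (hA i hi))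
        (s.measurableSet_biInter fun i hi => measurable_pi_apply i (hB i hi))
    have h3 : ∀ i ∈ s, μ (F i) = μ (f i ⁻¹' A i) * μ (g i ⁻¹' B i) := by
      intro i hi
      rw [hset i hi]
      have := hfg.comp (measurable_pi_apply i) (measurable_pi_apply i)
      exact this.measure_inter_preimage_eq_mul _ _ (hA i hi) (hB i hi)
    rw [h1, h2, hf.measure_inter_preimage_eq_mul s hA,
      hg.measure_inter_preimage_eq_mul s hB, ← Finset.prod_mul_distrib]
    exact (Finset.prod_congr rfl h3).symm

/-- Pythagoras for finitely many pairwise orthogonal square integrable variables. -/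
lemma integral_sum_sq_of_orthogonal {ι : Type*} {μ : Measure Ω} (s : Finset ι) (f : ι → Ω → ℝ)
    (hf : ∀ i ∈ s, MemLp (f i) 2 μ)
    (horth : ∀ i ∈ s, ∀ j ∈ s, i ≠ j → ∫ ω, f i ω * f j ω ∂μ = 0) :
    ∫ ω, (∑ i ∈ s, f i ω) ^ 2 ∂μ = ∑ i ∈ s, ∫ ω, f i ω ^ 2 ∂μ := by
  have h1 : ∀ ω, (∑ i ∈ s, f i ω) ^ 2 = ∑ i ∈ s, ∑ j ∈ s, f i ω * f j ω := fun ω => by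
    rw [sq, Finset.sum_mul_sum]
  have hint : ∀ i ∈ s, ∀ j ∈ s, Integrable (fun ω => f i ω * f j ω) μ :=
    fun i hi j hj => (hf i hi).integrable_mul (hf j hj)
  simp_rw [h1]
  rw [integral_finsetSum _ fun i hi => integrable_finsetSum _ fun j hj => hint i hi j hj]
  refine Finset.sum_congr rfl fun i hi => ?_
  rw [integral_finsetSum _ fun j hj => hint i hi j hj, Finset.sum_eq_single_of_mem i hi]
  · simp only [sq]
  · exact fun j hj hji => horth i hi j hj hji.symm

/-- A standardized white noise: measurable, independent, centred, with unit variance. -/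
structure IsNoise (μ : Measure Ω) (z : ℤ → Ω → ℝ) : Prop where
  measurable : ∀ t, Measurable (z t)
  indep : iIndepFun z μ
  memLp : ∀ t, MemLp (z t) 2 μ
  mean_zero : ∀ t, ∫ ω, z t ω ∂μ = 0
  variance_one : ∀ t, ∫ ω, z t ω ^ 2 ∂μ = 1

/-- The moving average `∑_{k < n} a ^ k z (t - k)` of the recent innovations, which approximates the
stationary solution of `x t = a x (t - 1) + z t`. -/
noncomputable def partialAR (a : ℝ) (z : ℤ → ℝ) (n : ℕ) (t : ℤ) : ℝ :=
  ∑ k ∈ Finset.range n, a ^ k * z (t - k)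

namespace IsNoise

variable {μ : Measure Ω} {z : ℤ → Ω → ℝ}

lemma integral_mul_eq_zero (hz : IsNoise μ z) {s t : ℤ} (h : s ≠ t) :
    ∫ ω, z s ω * z t ω ∂μ = 0 := by
  rw [(hz.indep.indepFun h).integral_fun_mul_eq_mul_integral
    (hz.measurable s).aestronglyMeasurable (hz.measurable t).aestronglyMeasurable,
    hz.mean_zero, zero_mul]

lemma integral_sum_sq (hz : IsNoise μ z) (s : Finset ℤ) :
    ∫ ω, (∑ t ∈ s, z t ω) ^ 2 ∂μ = s.card := by
  rw [integral_sum_sq_of_orthogonal s z (fun t _ => hz.memLp t)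
    fun i _ j _ hij => hz.integral_mul_eq_zero hij]
  simp [hz.variance_one]

lemma memLp_partialAR (hz : IsNoise μ z) (a : ℝ) (n : ℕ) (t : ℤ) :
    MemLp (fun ω => partialAR a (fun s => z s ω) n t) 2 μ :=
  memLp_finsetSum _ fun k _ => (hz.memLp (t - k)).const_mul (a ^ k)

lemma integral_partialAR_sq_le (hz : IsNoise μ z) {a : ℝ} (ha0 : 0 < a) (ha1 : a < 1)
    (n : ℕ) (t : ℤ) :
    ∫ ω, partialAR a (fun s => z s ω) n t ^ 2 ∂μ ≤ 1 / (1 - a) := by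
  have h := integral_sum_sq_of_orthogonal (μ := μ) (Finset.range n)
    (fun k ω => a ^ k * z (t - k) ω) (fun k _ => (hz.memLp (t - k)).const_mul (a ^ k)) ?_
  · simp only [partialAR]
    rw [h]
    have h1 : ∀ k : ℕ, ∫ ω, (a ^ k * z (t - k) ω) ^ 2 ∂μ = (a ^ k) ^ 2 := fun k => by
      simp_rw [mul_pow]
      rw [integral_const_mul, hz.variance_one, mul_one]
    simp_rw [h1]
    calc ∑ k ∈ Finset.range n, (a ^ k) ^ 2 ≤ ∑ k ∈ Finset.range n, a ^ k := by
          refine Finset.sum_le_sum fun k _ => ?_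
          rw [sq]
          exact mul_le_of_le_one_left (by positivity) (pow_le_one₀ ha0.le ha1.le)
      _ ≤ ∑' k, a ^ k :=
          (summable_geometric_of_lt_one ha0.le ha1).sum_le_tsum _ fun k _ => by positivity
      _ = 1 / (1 - a) := by rw [tsum_geometric_of_lt_one ha0.le ha1, one_div]
  · intro i _ j _ hij
    have h1 : ∀ ω, a ^ i * z (t - i) ω * (a ^ j * z (t - j) ω) =
        (a ^ i * a ^ j) * (z (t - i) ω * z (t - j) ω) := fun ω => by ring
    simp_rw [h1]
    rw [integral_const_mul, hz.integral_mul_eq_zero (by simpa using hij), mul_zero]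

/-- Any function of the innovations before time `t` is independent of `z t`. -/
lemma indepFun_past (hz : IsNoise μ z) (t : ℤ) {f : Ω → ℝ}
    (hf : Measurable[⨆ r ∈ Set.Iio t, MeasurableSpace.comap (z r) inferInstance] f) :
    IndepFun f (z t) μ := by
  rw [IndepFun_iff_Indep]
  have h := indep_iSup_of_disjoint (S := Set.Iio t) (T := {t})
    (fun r => (hz.measurable r).comap_le) hz.indep.iIndep (by simp)
  refine indep_of_indep_of_le h hf.comap_le ?_
  simp

lemma measurable_past {Ω : Type*} (z : ℤ → Ω → ℝ) {r t : ℤ} (h : r < t) :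
    Measurable[⨆ r ∈ Set.Iio t, MeasurableSpace.comap (z r) inferInstance] (z r) := by
  rw [measurable_iff_comap_le]
  exact le_iSup₂_of_le r h le_rfl

lemma measurable_past_partialAR {Ω : Type*} (z : ℤ → Ω → ℝ) (a : ℝ) (n : ℕ) {r t : ℤ} (h : r < t) :
    Measurable[⨆ r ∈ Set.Iio t, MeasurableSpace.comap (z r) inferInstance]
      (fun ω => partialAR a (fun s => z s ω) n r) := by
  unfold partialAR
  refine Finset.measurable_sum _ fun k _ => ?_
  exact (measurable_past z (by omega : r - k < t)).const_mul _

lemma memLp_partialAR_mul (hz : IsNoise μ z) (a : ℝ) (n : ℕ) (t : ℤ) :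
    MemLp (fun ω => partialAR a (fun s => z s ω) n (t - 1) * z t ω) 2 μ := by
  have hX := hz.memLp_partialAR a n (t - 1)
  have hind := hz.indepFun_past t (measurable_past_partialAR z a n (sub_one_lt t))
  have hm : AEStronglyMeasurable
      (fun ω => partialAR a (fun s => z s ω) n (t - 1) * z t ω) μ :=
    hX.aestronglyMeasurable.mul (hz.measurable t).aestronglyMeasurable
  rw [memLp_two_iff_integrable_sq hm]
  have h2 := (hind.comp (φ := fun x => x ^ 2) (ψ := fun x => x ^ 2) (by fun_prop)
    (by fun_prop)).integrable_mul hX.integrable_sq (hz.memLp t).integrable_sq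
  refine h2.congr (ae_of_all _ fun ω => ?_)
  simp [mul_pow]

lemma integral_martingale_sq_le (hz : IsNoise μ z) {a : ℝ} (ha0 : 0 < a) (ha1 : a < 1)
    (n : ℤ → ℕ) (T : ℕ) :
    ∫ ω, (∑ t ∈ Finset.Icc (2 : ℤ) T,
      partialAR a (fun s => z s ω) (n (t - 1)) (t - 1) * z t ω) ^ 2 ∂μ ≤ T / (1 - a) := by
  have key : ∀ s t : ℤ, s < t → ∫ ω, partialAR a (fun s => z s ω) (n (s - 1)) (s - 1) * z s ω *
      (partialAR a (fun s => z s ω) (n (t - 1)) (t - 1) * z t ω) ∂μ = 0 := by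
    intro s t hst
    have hm : Measurable[⨆ r ∈ Set.Iio t, MeasurableSpace.comap (z r) inferInstance]
        (fun ω => partialAR a (fun s => z s ω) (n (s - 1)) (s - 1) * z s ω *
          partialAR a (fun s => z s ω) (n (t - 1)) (t - 1)) :=
      ((measurable_past_partialAR z a (n _) (by omega)).mul (measurable_past z hst)).mul
        (measurable_past_partialAR z a (n _) (by omega))
    have h1 := (hz.indepFun_past t hm).integral_fun_mul_eq_mul_integral
      ((((hz.memLp_partialAR a (n (s - 1)) (s - 1)).aestronglyMeasurable.mul
        (hz.measurable s).aestronglyMeasurable).mul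
        (hz.memLp_partialAR a (n (t - 1)) (t - 1)).aestronglyMeasurable))
      (hz.measurable t).aestronglyMeasurable
    rw [hz.mean_zero, mul_zero] at h1
    rw [← h1]
    refine integral_congr_ae (ae_of_all _ fun ω => ?_)
    simp only
    ring
  rw [integral_sum_sq_of_orthogonal _
    (fun t ω => partialAR a (fun s => z s ω) (n (t - 1)) (t - 1) * z t ω)
    (fun t _ => hz.memLp_partialAR_mul a (n (t - 1)) t)]
  · have h1 : ∀ t ∈ Finset.Icc (2 : ℤ) T,
        ∫ ω, (partialAR a (fun s => z s ω) (n (t - 1)) (t - 1) * z t ω) ^ 2 ∂μ ≤ 1 / (1 - a) := by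
      intro t _
      have hind := hz.indepFun_past t
        (measurable_past_partialAR z a (n (t - 1)) (sub_one_lt t))
      have h2 := (hind.comp (φ := fun x => x ^ 2) (ψ := fun x => x ^ 2) (by fun_prop)
        (by fun_prop)).integral_fun_mul_eq_mul_integral
        (hz.memLp_partialAR a (n (t - 1)) (t - 1)).integrable_sq.aestronglyMeasurable
        (hz.memLp t).integrable_sq.aestronglyMeasurable
      simp only [Function.comp_def] at h2
      rw [hz.variance_one, mul_one] at h2
      simp_rw [mul_pow]
      rw [h2]
      exact hz.integral_partialAR_sq_le ha0 ha1 (n (t - 1)) (t - 1)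
    have hpos : 0 < 1 - a := by linarith
    calc _ ≤ ∑ t ∈ Finset.Icc (2 : ℤ) T, 1 / (1 - a) := Finset.sum_le_sum h1
      _ = ((Finset.Icc (2 : ℤ) T).card : ℝ) * (1 / (1 - a)) := by simp
      _ ≤ (T : ℝ) * (1 / (1 - a)) := by
          gcongr
          rw [Int.card_Icc]; omega
      _ = T / (1 - a) := by ring
  · intro s _ t _ hst
    rcases lt_or_gt_of_ne hst with h | h
    · exact key s t h
    · rw [← key t s h]
      exact integral_congr_ae (ae_of_all _ fun ω => mul_comm _ _)

/-- The empirical second moment of the innovations is rarely below `1 / 8`. Truncating `z ^ 2` at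
`K` makes Chebyshev's inequality available without a fourth moment. -/
lemma measure_sum_sq_lt_le [IsProbabilityMeasure μ] (hz : IsNoise μ z) {K : ℝ} (hK : 0 < K)
    (htr : ∀ t, 1 / 2 ≤ ∫ ω, min (z t ω ^ 2) K ∂μ) {T : ℕ} (hT : 2 ≤ T) :
    μ {ω | ∑ t ∈ Finset.Icc (2 : ℤ) T, z t ω ^ 2 < (T : ℝ) / 8} ≤
      ENNReal.ofReal (64 * K ^ 2 / T) := by
  have hTr : (2 : ℝ) ≤ T := by exact_mod_cast hT
  set I := Finset.Icc (2 : ℤ) T with hI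
  have hcard : (I.card : ℝ) = T - 1 := by
    rw [hI, Int.card_Icc]
    have : ((T : ℤ) + 1 - 2).toNat = T - 1 := by omega
    rw [this, Nat.cast_sub (by omega)]; simp
  set W : ℤ → Ω → ℝ := fun t ω => min (z t ω ^ 2) K with hW
  have hWm : ∀ t, Measurable (W t) := fun t => ((hz.measurable t).pow_const 2).min measurable_const
  have hW0 : ∀ t ω, 0 ≤ W t ω := fun t ω => le_min (sq_nonneg _) hK.le
  have hWK : ∀ t ω, W t ω ≤ K := fun t ω => min_le_right _ _
  have hWL : ∀ t, MemLp (W t) 2 μ := fun t =>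
    MemLp.of_bound (hWm t).aestronglyMeasurable K
      (ae_of_all _ fun ω => by rw [Real.norm_of_nonneg (hW0 t ω)]; exact hWK t ω)
  have hWind : iIndepFun W μ :=
    hz.indep.comp (fun _ x => min (x ^ 2) K) fun _ => by fun_prop
  have hvar : Var[∑ t ∈ I, W t; μ] ≤ T * K ^ 2 := by
    rw [IndepFun.variance_sum (fun t _ => hWL t) fun s _ t _ hst => hWind.indepFun hst]
    calc ∑ t ∈ I, Var[W t; μ] ≤ ∑ t ∈ I, K ^ 2 := by
          refine Finset.sum_le_sum fun t _ => ?_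
          refine (variance_le_expectation_sq (hWm t).aestronglyMeasurable).trans ?_
          calc ∫ ω, (W t ^ 2) ω ∂μ ≤ ∫ ω, K ^ 2 ∂μ := by
                refine integral_mono (hWL t).integrable_sq (integrable_const _) fun ω => ?_
                exact pow_le_pow_left₀ (hW0 t ω) (hWK t ω) 2
            _ = K ^ 2 := by simp
      _ = (T - 1) * K ^ 2 := by rw [Finset.sum_const, nsmul_eq_mul, hcard]
      _ ≤ T * K ^ 2 := by gcongr; linarith
  have hmean : (T : ℝ) / 4 ≤ ∫ ω, (∑ t ∈ I, W t) ω ∂μ := by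
    simp only [Finset.sum_apply]
    rw [integral_finsetSum _ fun t _ => (hWL t).integrable (by norm_num)]
    calc (T : ℝ) / 4 ≤ ∑ t ∈ I, (1 / 2 : ℝ) := by
          rw [Finset.sum_const, nsmul_eq_mul, hcard]; linarith
      _ ≤ _ := Finset.sum_le_sum fun t _ => htr t
  have hc : (0 : ℝ) < T / 8 := by linarith
  have hsumL : MemLp (∑ t ∈ I, W t) 2 μ := memLp_finsetSum' _ fun t _ => hWL t
  refine (measure_mono ?_).trans ((meas_ge_le_variance_div_sq hsumL hc).trans ?_)
  · intro ω hω
    have h1 : (∑ t ∈ I, W t) ω ≤ ∑ t ∈ I, z t ω ^ 2 := by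
      rw [Finset.sum_apply]
      exact Finset.sum_le_sum fun t _ => min_le_left _ _
    have h2 : ∑ t ∈ I, z t ω ^ 2 < (T : ℝ) / 8 := hω
    simp only [Set.mem_ofPred_eq]
    rw [abs_sub_comm]
    exact (by linarith : (T : ℝ) / 8 ≤ _).trans (le_abs_self _)
  · apply ENNReal.ofReal_le_ofReal
    calc Var[∑ t ∈ I, W t; μ] / (T / 8) ^ 2 ≤ T * K ^ 2 / (T / 8) ^ 2 := by gcongr
      _ = 64 * K ^ 2 / T := by field_simp; norm_num

end IsNoise

end RCAR

/-! ### One unit with random coefficients -/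

namespace RCAR

variable {Ω : Type*} [MeasurableSpace Ω] {μ : Measure Ω}

/-- A bound on `E Ψ(u, W)` for frozen `u` integrates to a bound on `E Ψ(U, W)` when `U` and `W` are
independent. -/
lemma lintegral_le_of_indepFun [IsProbabilityMeasure μ] {E F : Type*} [MeasurableSpace E]
    [MeasurableSpace F] {U : Ω → E} {W : Ω → F} (hU : Measurable U) (hW : Measurable W)
    (hind : IndepFun U W μ) {Ψ : E × F → ℝ≥0∞} (hΨ : Measurable Ψ) {Φ : E → ℝ≥0∞}
    (hle : ∀ᵐ ω ∂μ, ∫⁻ ω', Ψ (U ω, W ω') ∂μ ≤ Φ (U ω)) :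
    ∫⁻ ω, Ψ (U ω, W ω) ∂μ ≤ ∫⁻ ω, Φ (U ω) ∂μ := by
  have := Measure.isProbabilityMeasure_map (μ := μ) hW.aemeasurable
  rw [← lintegral_map hΨ (hU.prodMk hW),
    (indepFun_iff_map_prod_eq_prod_map_map hU.aemeasurable hW.aemeasurable).1 hind,
    lintegral_prod _ hΨ.aemeasurable, lintegral_map hΨ.lintegral_prod_right' hU]
  refine lintegral_mono_ae ?_
  filter_upwards [hle] with ω hω
  rw [lintegral_map (f := fun y => Ψ (U ω, y)) (hΨ.comp measurable_prodMk_left) hW]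
  exact hω

/-- Fatou's lemma along an almost surely convergent sequence. -/
lemma lintegral_le_of_tendsto_ae {f : ℕ → Ω → ℝ≥0∞} {g : Ω → ℝ≥0∞} {c : ℝ≥0∞}
    (hf : ∀ n, Measurable (f n)) (hlim : ∀ᵐ ω ∂μ, Tendsto (fun n => f n ω) atTop (𝓝 (g ω)))
    (hle : ∀ n, ∫⁻ ω, f n ω ∂μ ≤ c) : ∫⁻ ω, g ω ∂μ ≤ c := by
  calc ∫⁻ ω, g ω ∂μ = ∫⁻ ω, liminf (fun n => f n ω) atTop ∂μ := by
        refine lintegral_congr_ae ?_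
        filter_upwards [hlim] with ω hω using hω.liminf_eq.symm
    _ ≤ liminf (fun n => ∫⁻ ω, f n ω ∂μ) atTop := lintegral_liminf_le hf
    _ ≤ c := liminf_le_of_le (by isBoundedDefault) fun b hb => by
        obtain ⟨n, hn⟩ := hb.exists
        exact hn.trans (hle n)

/-- A single unit of the panel: an autoregression `X` with random coefficient `A`, random weights
`B`, `C` and shocks `η`, `ξ`, the shocks being independent of the coefficients. -/
structure UnitModel (μ : Measure Ω) (A B C : Ω → ℝ) (η ξ X : ℤ → Ω → ℝ) : Prop where
  measurable_A : Measurable A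
  measurable_B : Measurable B
  measurable_C : Measurable C
  noise_η : IsNoise μ η
  noise_ξ : IsNoise μ ξ
  indep_shocks : IndepFun (fun ω t => η t ω) (fun ω t => ξ t ω) μ
  indep_coeff : IndepFun (fun ω => (A ω, B ω, C ω))
    (fun ω => ((fun t => η t ω), (fun t => ξ t ω))) μ
  mem_Ioo : ∀ᵐ ω ∂μ, A ω ∈ Set.Ioo (0 : ℝ) 1
  weights_pos : ∀ᵐ ω ∂μ, 0 < B ω ^ 2 + C ω ^ 2
  stationary : StrictlyStationary μ X
  recursion : ∀ t : ℤ, ∀ᵐ ω ∂μ, X t ω = A ω * X (t - 1) ω + (B ω * η t ω + C ω * ξ t ω)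

/-- The innovation at time `t` with weights `b, c`, standardized to unit variance. -/
noncomputable def stdInnovation (b c : ℝ) (e x : ℤ → ℝ) (t : ℤ) : ℝ :=
  (b * e t + c * x t) / √(b ^ 2 + c ^ 2)

lemma isNoise_stdInnovation [IsProbabilityMeasure μ] {η ξ : ℤ → Ω → ℝ} (hη : IsNoise μ η)
    (hξ : IsNoise μ ξ) (hind : IndepFun (fun ω t => η t ω) (fun ω t => ξ t ω) μ) {b c : ℝ}
    (hbc : 0 < b ^ 2 + c ^ 2) :
    IsNoise μ (fun t ω => stdInnovation b c (fun t => η t ω) (fun t => ξ t ω) t) where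
  measurable t := (((hη.measurable t).const_mul b).add ((hξ.measurable t).const_mul c)).div_const _
  indep := (iIndepFun_prodMk hη.measurable hξ.measurable hη.indep hξ.indep hind).comp
    (fun _ v => (b * v.1 + c * v.2) / √(b ^ 2 + c ^ 2)) fun _ => by fun_prop
  memLp t := by
    have := (((hη.memLp t).const_mul b).add ((hξ.memLp t).const_mul c)).const_mul
      (√(b ^ 2 + c ^ 2))⁻¹
    refine this.ae_eq (ae_of_all _ fun ω => ?_)
    simp [stdInnovation, div_eq_inv_mul]
  mean_zero t := by
    simp only [stdInnovation]
    rw [integral_div, integral_add (((hη.memLp t).integrable (by norm_num)).const_mul b)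
      (((hξ.memLp t).integrable (by norm_num)).const_mul c), integral_const_mul,
      integral_const_mul, hη.mean_zero, hξ.mean_zero]
    simp
  variance_one t := by
    have hcross : ∫ ω, η t ω * ξ t ω ∂μ = 0 := by
      have h := hind.comp (measurable_pi_apply t) (measurable_pi_apply t)
      have h1 := h.integral_fun_mul_eq_mul_integral (hη.measurable t).aestronglyMeasurable
        (hξ.measurable t).aestronglyMeasurable
      simp only [Function.comp_def] at h1
      rw [h1, hη.mean_zero, zero_mul]
    have hexp : ∀ ω, stdInnovation b c (fun t => η t ω) (fun t => ξ t ω) t ^ 2 =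
        (b ^ 2 * η t ω ^ 2 + c ^ 2 * ξ t ω ^ 2 + 2 * b * c * (η t ω * ξ t ω)) /
          (b ^ 2 + c ^ 2) := fun ω => by
      rw [stdInnovation, div_pow, Real.sq_sqrt hbc.le]
      congr 1; ring
    have i1 := (hη.memLp t).integrable_sq.const_mul (b ^ 2)
    have i2 := (hξ.memLp t).integrable_sq.const_mul (c ^ 2)
    have i3 : Integrable (fun ω => 2 * b * c * (η t ω * ξ t ω)) μ :=
      ((hη.memLp t).integrable_mul (hξ.memLp t)).const_mul (2 * b * c)
    have i12 : Integrable (fun ω => b ^ 2 * η t ω ^ 2 + c ^ 2 * ξ t ω ^ 2) μ := i1.add i2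
    simp_rw [hexp]
    rw [integral_div, integral_add i12 i3, integral_add i1 i2, integral_const_mul,
      integral_const_mul, integral_const_mul, hcross, hη.variance_one, hξ.variance_one]
    field_simp
    simp

/-- The square of a standardized innovation is dominated by the sum of the squared shocks. -/
lemma stdInnovation_sq_le (b c : ℝ) (e x : ℤ → ℝ) (t : ℤ) :
    stdInnovation b c e x t ^ 2 ≤ e t ^ 2 + x t ^ 2 := by
  rcases (add_nonneg (sq_nonneg b) (sq_nonneg c)).eq_or_lt with h | h
  · simp only [stdInnovation, ← h, Real.sqrt_zero, div_zero]
    linarith [sq_nonneg (e t), sq_nonneg (x t)]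
  · rw [stdInnovation, div_pow, Real.sq_sqrt h.le, div_le_iff₀ h]
    nlinarith [sq_nonneg (b * x t - c * e t)]

/-- Truncation at a level `K` at which the squared shocks have a small excess keeps half of the
variance of every standardized innovation, whatever the weights. -/
lemma half_le_integral_min [IsProbabilityMeasure μ] {η ξ : ℤ → Ω → ℝ} (hη : IsNoise μ η)
    (hξ : IsNoise μ ξ) (hind : IndepFun (fun ω t => η t ω) (fun ω t => ξ t ω) μ) {b c : ℝ}
    (hbc : 0 < b ^ 2 + c ^ 2) {K : ℝ} {t : ℤ}
    (h1 : ∫ ω, max (η t ω ^ 2 - K / 2) 0 ∂μ ≤ 1 / 4)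
    (h2 : ∫ ω, max (ξ t ω ^ 2 - K / 2) 0 ∂μ ≤ 1 / 4) :
    1 / 2 ≤ ∫ ω, min (stdInnovation b c (fun t => η t ω) (fun t => ξ t ω) t ^ 2) K ∂μ := by
  have hz := isNoise_stdInnovation hη hξ hind hbc
  set z := fun t ω => stdInnovation b c (fun t => η t ω) (fun t => ξ t ω) t with hzdef
  have i1 : Integrable (fun ω => max (η t ω ^ 2 - K / 2) 0) μ :=
    ((hη.memLp t).integrable_sq.sub (integrable_const _)).sup (integrable_const _)
  have i2 : Integrable (fun ω => max (ξ t ω ^ 2 - K / 2) 0) μ :=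
    ((hξ.memLp t).integrable_sq.sub (integrable_const _)).sup (integrable_const _)
  have i3 : Integrable (fun ω => min (z t ω ^ 2) K) μ :=
    (hz.memLp t).integrable_sq.inf (integrable_const _)
  have h3 : ∫ ω, z t ω ^ 2 ∂μ ≤ ∫ ω, (min (z t ω ^ 2) K +
      (max (η t ω ^ 2 - K / 2) 0 + max (ξ t ω ^ 2 - K / 2) 0)) ∂μ := by
    refine integral_mono (hz.memLp t).integrable_sq (i3.add (i1.add i2)) fun ω => ?_
    have h4 : z t ω ^ 2 ≤ η t ω ^ 2 + ξ t ω ^ 2 := stdInnovation_sq_le b c _ _ t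
    have h5 := le_max_left (η t ω ^ 2 - K / 2) 0
    have h6 := le_max_left (ξ t ω ^ 2 - K / 2) 0
    have h7 := le_max_right (η t ω ^ 2 - K / 2) 0
    have h8 := le_max_right (ξ t ω ^ 2 - K / 2) 0
    simp only
    rcases le_total (z t ω ^ 2) K with h | h
    · rw [min_eq_left h]; linarith
    · rw [min_eq_right h]; linarith
  have i12 : Integrable (fun ω => max (η t ω ^ 2 - K / 2) 0 + max (ξ t ω ^ 2 - K / 2) 0) μ :=
    i1.add i2
  rw [hz.variance_one, integral_add i3 i12, integral_add i1 i2] at h3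
  linarith

/-- The truncated excess of an integrable variable has a small mean for large truncation levels. -/
lemma exists_integral_max_sub_le {f : Ω → ℝ} (hf : Integrable f μ) [IsProbabilityMeasure μ] :
    ∃ K₀ : ℝ, ∀ K ≥ K₀, ∫ ω, max (f ω - K) 0 ∂μ ≤ 1 / 4 := by
  have h : Tendsto (fun K : ℝ => ∫ ω, max (f ω - K) 0 ∂μ) atTop (𝓝 (∫ _, (0 : ℝ) ∂μ)) := by
    refine tendsto_integral_filter_of_dominated_convergence (fun ω => |f ω|) ?_ ?_ hf.abs ?_
    · exact Eventually.of_forall fun K =>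
        ((hf.sub (integrable_const K)).sup (integrable_const 0)).aestronglyMeasurable
    · filter_upwards [eventually_ge_atTop 0] with K hK
      refine ae_of_all _ fun ω => ?_
      rw [Real.norm_of_nonneg (le_max_right _ _)]
      exact max_le (by linarith [le_abs_self (f ω)]) (abs_nonneg _)
    · refine ae_of_all _ fun ω => ?_
      refine tendsto_const_nhds.congr' ?_
      filter_upwards [eventually_ge_atTop (f ω)] with K hK
      rw [max_eq_right (by linarith)]
  rw [integral_zero] at h
  obtain ⟨K₀, hK₀⟩ := eventually_atTop.1 (h.eventually (gt_mem_nhds (by norm_num : (0 : ℝ) < 1 / 4)))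
  exact ⟨K₀, fun K hK => (hK₀ K hK).le⟩

namespace UnitModel

variable {A B C : Ω → ℝ} {η ξ X : ℤ → Ω → ℝ}

/-- The standardized innovations of a unit. -/
noncomputable def innov (B C : Ω → ℝ) (η ξ : ℤ → Ω → ℝ) (t : ℤ) (ω : Ω) : ℝ :=
  stdInnovation (B ω) (C ω) (fun t => η t ω) (fun t => ξ t ω) t

/-- The path of a unit, rescaled so that its innovations have unit variance. -/
noncomputable def path (B C : Ω → ℝ) (X : ℤ → Ω → ℝ) (t : ℤ) (ω : Ω) : ℝ :=
  X t ω / √(B ω ^ 2 + C ω ^ 2)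

/-- Approximation of `path` at time `t ≥ 1` by the moving average started at time `1 - m`. -/
noncomputable def approx (A B C : Ω → ℝ) (η ξ : ℤ → Ω → ℝ) (m : ℕ) (t : ℤ) (ω : Ω) : ℝ :=
  partialAR (A ω) (fun s => innov B C η ξ s ω) (m + (t - 1).toNat) t

lemma measurable_innov (h : UnitModel μ A B C η ξ X) (t : ℤ) : Measurable (innov B C η ξ t) := by
  have := h.measurable_B
  have := h.measurable_C
  have := h.noise_η.measurable t
  have := h.noise_ξ.measurable t
  unfold innov stdInnovation
  fun_prop

lemma measurable_path (h : UnitModel μ A B C η ξ X) (t : ℤ) : Measurable (path B C X t) := by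
  have := h.measurable_B
  have := h.measurable_C
  have := h.stationary.1 t
  unfold path
  fun_prop

lemma measurable_approx (h : UnitModel μ A B C η ξ X) (m : ℕ) (t : ℤ) :
    Measurable (approx A B C η ξ m t) := by
  unfold approx partialAR
  exact Finset.measurable_sum _ fun k _ => (h.measurable_A.pow_const k).mul (h.measurable_innov _)

lemma ae_path_recursion (h : UnitModel μ A B C η ξ X) :
    ∀ᵐ ω ∂μ, ∀ t : ℤ, path B C X t ω = A ω * path B C X (t - 1) ω + innov B C η ξ t ω := by
  filter_upwards [ae_all_iff.2 h.recursion] with ω hω t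
  simp only [path, innov, stdInnovation, hω t]
  ring

lemma measure_abs_ge_eq (h : UnitModel μ A B C η ξ X) (t : ℤ) (K : ℝ) :
    μ {ω | K ≤ |X t ω|} = μ {ω | K ≤ |X 0 ω|} := by
  have hm : MeasurableSet {v : ℤ → ℝ | K ≤ |v 0|} :=
    measurableSet_le measurable_const (measurable_pi_apply 0).abs
  have hX : ∀ t, Measurable (X t) := h.stationary.1
  have h1 := congrArg (fun ν => ν {v : ℤ → ℝ | K ≤ |v 0|}) (h.stationary.2 t)
  rw [Measure.map_apply (by fun_prop) hm, Measure.map_apply (by fun_prop) hm] at h1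
  simpa using h1

/-- The initial condition is forgotten: `A ^ m X(1 - m) → 0` in probability, because the law of
`X(1 - m)` does not depend on `m`. -/
lemma tendstoInMeasure_pow_mul [IsProbabilityMeasure μ] (h : UnitModel μ A B C η ξ X) :
    TendstoInMeasure μ (fun (m : ℕ) ω => A ω ^ m * X (1 - m) ω) atTop 0 := by
  rw [tendstoInMeasure_iff_norm]
  intro ε hε
  rw [ENNReal.tendsto_atTop_zero]
  intro e he
  have htail : Tendsto (fun n : ℕ => μ {ω | (n : ℝ) ≤ |X 0 ω|}) atTop (𝓝 0) := by
    have h1 := tendsto_measure_iInter_atTop (μ := μ) (s := fun n : ℕ => {ω | (n : ℝ) ≤ |X 0 ω|})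
      (fun n => (measurableSet_le measurable_const
        (h.stationary.1 0).abs).nullMeasurableSet)
      (fun m n hmn ω (hω : (n : ℝ) ≤ |X 0 ω|) => (Nat.cast_le.2 hmn : (m : ℝ) ≤ n).trans hω) ⟨0, measure_ne_top _ _⟩
    have h2 : ⋂ n : ℕ, {ω | (n : ℝ) ≤ |X 0 ω|} = ∅ := by
      ext ω
      simp only [Set.mem_iInter, Set.mem_ofPred_eq, Set.mem_empty_iff_false, iff_false, not_forall,
        not_le]
      exact exists_nat_gt _
    rwa [h2, measure_empty] at h1
  have he2 : (0 : ℝ≥0∞) < e / 2 := ENNReal.half_pos he.ne'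
  obtain ⟨K, hK1, hK⟩ := ((eventually_ge_atTop 1).and
    (htail.eventually (ge_mem_nhds he2))).exists
  have hKp : (0 : ℝ) < K := by exact_mod_cast hK1
  have hpow : TendstoInMeasure μ (fun (m : ℕ) ω => A ω ^ m) atTop (fun _ => 0) := by
    refine tendstoInMeasure_of_tendsto_ae
      (fun m => (h.measurable_A.pow_const m).aestronglyMeasurable) ?_
    filter_upwards [h.mem_Ioo] with ω hω
    exact tendsto_pow_atTop_nhds_zero_of_lt_one hω.1.le hω.2
  rw [tendstoInMeasure_iff_norm] at hpow
  obtain ⟨N, hN⟩ := ENNReal.tendsto_atTop_zero.1 (hpow (ε / K) (by positivity)) (e / 2) he2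
  refine ⟨N, fun m hm => ?_⟩
  calc μ {ω | ε ≤ ‖A ω ^ m * X (1 - m) ω - (0 : Ω → ℝ) ω‖}
      ≤ μ ({ω | ε / K ≤ ‖A ω ^ m - 0‖} ∪ {ω | (K : ℝ) ≤ |X (1 - m) ω|}) := by
        refine measure_mono fun ω hω => ?_
        by_contra hcon
        simp only [Set.mem_union, Set.mem_ofPred_eq, not_or, not_le, sub_zero, Pi.zero_apply,
          Real.norm_eq_abs, abs_mul] at hcon hω
        have : |A ω ^ m| * |X (1 - m) ω| < ε / K * K :=
          mul_lt_mul'' hcon.1 hcon.2 (abs_nonneg _) (abs_nonneg _)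
        rw [div_mul_cancel₀ _ hKp.ne'] at this
        linarith
    _ ≤ e / 2 + e / 2 := by
        refine (measure_union_le _ _).trans (add_le_add (hN m hm) ?_)
        rw [h.measure_abs_ge_eq]
        exact hK
    _ = e := ENNReal.add_halves e

lemma path_eq_partialAR_add {a : ℝ} {x z : ℤ → ℝ} (hrec : ∀ t, x t = a * x (t - 1) + z t)
    (n : ℕ) (t : ℤ) : x t = partialAR a z n t + a ^ n * x (t - n) := by
  induction n with
  | zero => simp [partialAR]
  | succ n ih =>
    rw [ih, hrec (t - n), partialAR, partialAR, Finset.sum_range_succ]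
    have : t - ((n + 1 : ℕ) : ℤ) = t - n - 1 := by push_cast; ring
    rw [this]
    ring

/-- Along a subsequence, the approximations converge almost surely to the path at all times
`t ≥ 1` simultaneously. -/
lemma exists_tendsto_approx [IsProbabilityMeasure μ] (h : UnitModel μ A B C η ξ X) :
    ∃ ns : ℕ → ℕ, ∀ᵐ ω ∂μ, ∀ t : ℤ, 1 ≤ t →
      Tendsto (fun k => approx A B C η ξ (ns k) t ω) atTop (𝓝 (path B C X t ω)) := by
  obtain ⟨ns, -, hns⟩ := h.tendstoInMeasure_pow_mul.exists_seq_tendsto_ae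
  refine ⟨ns, ?_⟩
  filter_upwards [hns, h.ae_path_recursion, h.mem_Ioo] with ω h1 h2 h3 t ht
  have hdiff : ∀ k, approx A B C η ξ (ns k) t ω = path B C X t ω -
      A ω ^ (t - 1).toNat * (A ω ^ ns k * X (1 - ns k) ω) / √(B ω ^ 2 + C ω ^ 2) := by
    intro k
    have h4 := path_eq_partialAR_add (x := fun t => path B C X t ω)
      (z := fun t => innov B C η ξ t ω) h2 (ns k + (t - 1).toNat) t
    have h5 : t - ((ns k + (t - 1).toNat : ℕ) : ℤ) = 1 - ns k := by
      push_cast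
      rw [Int.toNat_of_nonneg (by omega)]
      ring
    simp only [h5] at h4
    rw [approx, h4, path, pow_add]
    ring
  simp_rw [hdiff]
  have h6 := ((h1.const_mul (A ω ^ (t - 1).toNat)).div_const
    (√(B ω ^ 2 + C ω ^ 2))).const_sub (path B C X t ω)
  simpa using h6

/-- Transfer to random coefficients of a second moment bound valid for frozen coefficients. -/
lemma lintegral_weight_mul_le [IsProbabilityMeasure μ] (h : UnitModel μ A B C η ξ X) {w : ℝ → ℝ≥0∞}
    (hw : Measurable w) {f : ℝ → (ℤ → ℝ) → ℝ}
    (hf : Measurable (fun q : ℝ × (ℤ → ℝ) => f q.1 q.2)) {φ : ℝ → ℝ}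
    (hle : ∀ a ∈ Set.Ioo (0 : ℝ) 1, ∀ z : ℤ → Ω → ℝ, IsNoise μ z →
      Integrable (fun ω => f a (fun t => z t ω) ^ 2) μ ∧
        ∫ ω, f a (fun t => z t ω) ^ 2 ∂μ ≤ φ a) :
    ∫⁻ ω, w (A ω) * ENNReal.ofReal (f (A ω) (fun t => innov B C η ξ t ω) ^ 2) ∂μ ≤
      ∫⁻ ω, w (A ω) * ENNReal.ofReal (φ (A ω)) ∂μ := by
  have hηm := h.noise_η.measurable
  have hξm := h.noise_ξ.measurable
  have hstd : Measurable (fun q : (ℝ × ℝ × ℝ) × ((ℤ → ℝ) × (ℤ → ℝ)) =>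
      ((q.1.1, stdInnovation q.1.2.1 q.1.2.2 q.2.1 q.2.2) : ℝ × (ℤ → ℝ))) := by
    refine Measurable.prodMk (by fun_prop) (measurable_pi_lambda _ fun t => ?_)
    unfold stdInnovation
    fun_prop
  refine lintegral_le_of_indepFun
    (Ψ := fun q => w q.1.1 * ENNReal.ofReal
      (f q.1.1 (stdInnovation q.1.2.1 q.1.2.2 q.2.1 q.2.2) ^ 2))
    (Φ := fun e => w e.1 * ENNReal.ofReal (φ e.1))
    (h.measurable_A.prodMk (h.measurable_B.prodMk h.measurable_C)) (by fun_prop) h.indep_coeff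
    ((hw.comp (by fun_prop)).mul (((hf.comp hstd).pow_const 2).ennreal_ofReal)) ?_
  filter_upwards [h.mem_Ioo, h.weights_pos] with ω hA hBC
  obtain ⟨hint, hbd⟩ := hle (A ω) hA _
    (isNoise_stdInnovation h.noise_η h.noise_ξ h.indep_shocks hBC)
  have hmeas : Measurable (fun ω' => ENNReal.ofReal (f (A ω) (stdInnovation (B ω) (C ω)
      (fun t => η t ω') (fun t => ξ t ω')) ^ 2)) := by
    have := hstd.comp (measurable_const (a := (A ω, B ω, C ω)).prodMk
      ((measurable_pi_lambda (fun ω' t => η t ω') hηm).prodMk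
        (measurable_pi_lambda (fun ω' t => ξ t ω') hξm)))
    exact ((hf.comp this).pow_const 2).ennreal_ofReal
  rw [lintegral_const_mul _ hmeas]
  gcongr
  rw [← ofReal_integral_eq_lintegral_ofReal hint (ae_of_all _ fun _ => sq_nonneg _)]
  exact ENNReal.ofReal_le_ofReal hbd

lemma measurable_partialAR_uncurry (n : ℕ) (t : ℤ) :
    Measurable (fun q : ℝ × (ℤ → ℝ) => partialAR q.1 q.2 n t) := by
  unfold partialAR
  fun_prop

lemma lintegral_sum_innov_sq_le [IsProbabilityMeasure μ] (h : UnitModel μ A B C η ξ X)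
    {w : ℝ → ℝ≥0∞} (hw : Measurable w) (T : ℕ) :
    ∫⁻ ω, w (A ω) * ENNReal.ofReal ((∑ t ∈ Finset.Icc (2 : ℤ) T, innov B C η ξ t ω) ^ 2) ∂μ ≤
      ∫⁻ ω, w (A ω) * ENNReal.ofReal T ∂μ := by
  refine h.lintegral_weight_mul_le hw (f := fun _ z => ∑ t ∈ Finset.Icc (2 : ℤ) T, z t)
    (φ := fun _ => (T : ℝ)) (by fun_prop) fun a ha z hz => ⟨?_, ?_⟩
  · exact (memLp_finsetSum _ fun t _ => hz.memLp t).integrable_sq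
  · rw [hz.integral_sum_sq, Int.card_Icc]
    have : ((T : ℤ) + 1 - 2).toNat ≤ T := by omega
    exact_mod_cast this

lemma lintegral_path_sq_le [IsProbabilityMeasure μ] (h : UnitModel μ A B C η ξ X)
    {w : ℝ → ℝ≥0∞} (hw : Measurable w) {t : ℤ} (ht : 1 ≤ t) (hw' : ∀ x, w x ≠ ∞) :
    ∫⁻ ω, w (A ω) * ENNReal.ofReal (path B C X t ω ^ 2) ∂μ ≤
      ∫⁻ ω, w (A ω) * ENNReal.ofReal (1 / (1 - A ω)) ∂μ := by
  obtain ⟨ns, hns⟩ := h.exists_tendsto_approx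
  refine lintegral_le_of_tendsto_ae
    (f := fun k ω => w (A ω) * ENNReal.ofReal (approx A B C η ξ (ns k) t ω ^ 2))
    (fun k => (hw.comp h.measurable_A).mul
      ((h.measurable_approx _ t).pow_const 2).ennreal_ofReal) ?_ fun k => ?_
  · filter_upwards [hns] with ω hω
    exact ENNReal.Tendsto.const_mul (ENNReal.tendsto_ofReal ((hω t ht).pow 2)) (Or.inr (hw' _))
  · exact h.lintegral_weight_mul_le hw
      (f := fun a z => partialAR a z (ns k + (t - 1).toNat) t) (φ := fun a => 1 / (1 - a))
      (measurable_partialAR_uncurry _ _) fun a ha z hz =>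
        ⟨(hz.memLp_partialAR _ _ _).integrable_sq, hz.integral_partialAR_sq_le ha.1 ha.2 _ _⟩

lemma lintegral_martingale_sq_le [IsProbabilityMeasure μ] (h : UnitModel μ A B C η ξ X)
    {w : ℝ → ℝ≥0∞} (hw : Measurable w) (hw' : ∀ x, w x ≠ ∞) (T : ℕ) :
    ∫⁻ ω, w (A ω) * ENNReal.ofReal ((∑ t ∈ Finset.Icc (2 : ℤ) T,
      path B C X (t - 1) ω * innov B C η ξ t ω) ^ 2) ∂μ ≤
      ∫⁻ ω, w (A ω) * ENNReal.ofReal (T / (1 - A ω)) ∂μ := by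
  obtain ⟨ns, hns⟩ := h.exists_tendsto_approx
  refine lintegral_le_of_tendsto_ae
    (f := fun k ω => w (A ω) * ENNReal.ofReal ((∑ t ∈ Finset.Icc (2 : ℤ) T,
      approx A B C η ξ (ns k) (t - 1) ω * innov B C η ξ t ω) ^ 2))
    (fun k => (hw.comp h.measurable_A).mul
      ((Finset.measurable_sum _ fun t _ => (h.measurable_approx _ (t - 1)).mul
        (h.measurable_innov t)).pow_const 2).ennreal_ofReal) ?_ fun k => ?_
  · filter_upwards [hns] with ω hω
    refine ENNReal.Tendsto.const_mul (ENNReal.tendsto_ofReal (Tendsto.pow ?_ 2)) (Or.inr (hw' _))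
    refine tendsto_finsetSum _ fun t ht => ?_
    exact (hω (t - 1) (by have := (Finset.mem_Icc.1 ht).1; omega)).mul_const _
  · exact h.lintegral_weight_mul_le hw
      (f := fun a z => ∑ t ∈ Finset.Icc (2 : ℤ) T,
        partialAR a z (ns k + (t - 1 - 1).toNat) (t - 1) * z t) (φ := fun a => T / (1 - a))
      (Finset.measurable_sum _ fun t _ =>
        (measurable_partialAR_uncurry (ns k + (t - 1 - 1).toNat) (t - 1)).mul
          ((measurable_pi_apply t).comp measurable_snd))
      fun a ha z hz =>
        ⟨(memLp_finsetSum _ fun t _ => hz.memLp_partialAR_mul _ _ t).integrable_sq,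
        hz.integral_martingale_sq_le ha.1 ha.2 (fun s => ns k + (s - 1).toNat) T⟩

lemma measure_sum_innov_sq_lt_le [IsProbabilityMeasure μ] (h : UnitModel μ A B C η ξ X) {K : ℝ}
    (hK : 0 < K) (h1 : ∀ t, ∫ ω, max (η t ω ^ 2 - K / 2) 0 ∂μ ≤ 1 / 4)
    (h2 : ∀ t, ∫ ω, max (ξ t ω ^ 2 - K / 2) 0 ∂μ ≤ 1 / 4) {T : ℕ} (hT : 2 ≤ T) :
    μ {ω | ∑ t ∈ Finset.Icc (2 : ℤ) T, innov B C η ξ t ω ^ 2 < (T : ℝ) / 8} ≤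
      ENNReal.ofReal (64 * K ^ 2 / T) := by
  have hηm := h.noise_η.measurable
  have hξm := h.noise_ξ.measurable
  set S : Set ((ℝ × ℝ × ℝ) × ((ℤ → ℝ) × (ℤ → ℝ))) :=
    {q | ∑ t ∈ Finset.Icc (2 : ℤ) T, stdInnovation q.1.2.1 q.1.2.2 q.2.1 q.2.2 t ^ 2 <
      (T : ℝ) / 8} with hS
  have hSm : MeasurableSet S := by
    refine measurableSet_lt ?_ measurable_const
    unfold stdInnovation
    fun_prop
  set g : Ω → (ℝ × ℝ × ℝ) × ((ℤ → ℝ) × (ℤ → ℝ)) :=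
    fun ω => ((A ω, B ω, C ω), ((fun t => η t ω), (fun t => ξ t ω))) with hg
  have hU : Measurable fun ω => (A ω, B ω, C ω) :=
    h.measurable_A.prodMk (h.measurable_B.prodMk h.measurable_C)
  have hW : Measurable fun ω => ((fun t => η t ω), (fun t => ξ t ω)) := by fun_prop
  have hmain : ∫⁻ ω, S.indicator (fun _ => 1) (g ω) ∂μ ≤
      ∫⁻ _, ENNReal.ofReal (64 * K ^ 2 / T) ∂μ := by
    refine lintegral_le_of_indepFun (Ψ := S.indicator fun _ => (1 : ℝ≥0∞))
      (Φ := fun _ => ENNReal.ofReal (64 * K ^ 2 / T)) hU hW h.indep_coeff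
      (measurable_const.indicator hSm) ?_
    filter_upwards [h.weights_pos] with ω hBC
    have hz := isNoise_stdInnovation h.noise_η h.noise_ξ h.indep_shocks hBC
    set g' : Ω → (ℝ × ℝ × ℝ) × ((ℤ → ℝ) × (ℤ → ℝ)) :=
      fun ω' => ((A ω, B ω, C ω), ((fun t => η t ω'), (fun t => ξ t ω'))) with hg'
    have e1 : ∫⁻ ω', S.indicator (fun _ => (1 : ℝ≥0∞)) (g' ω') ∂μ = μ (g' ⁻¹' S) := by
      rw [← lintegral_indicator_one ((measurable_const.prodMk hW) hSm)]
      rfl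
    refine e1.trans_le ?_
    exact hz.measure_sum_sq_lt_le hK (fun t => half_le_integral_min h.noise_η h.noise_ξ
        h.indep_shocks hBC (h1 t) (h2 t)) hT
  have e1 : ∫⁻ ω, S.indicator (fun _ => (1 : ℝ≥0∞)) (g ω) ∂μ = μ (g ⁻¹' S) := by
    rw [← lintegral_indicator_one ((hU.prodMk hW) hSm)]
    rfl
  rw [e1, lintegral_const, measure_univ, mul_one] at hmain
  exact hmain

end UnitModel

end RCAR

/-! ### Regular variation of the law of `1 - a` -/

namespace RCAR

/-- Regular variation at `0` of a probability measure `ν` on `(0, ∞)`, with the quantitative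
consequences of having a density `κ β y ^ (β - 1) (1 + O(y ^ θ))` near `0`. In the application `ν`
is the law of `1 - a` for an autoregressive coefficient `a`. -/
structure TailBounds (ν : Measure ℝ) (β θ κ C u₀ : ℝ) : Prop where
  one_lt_beta : 1 < β
  theta_pos : 0 < θ
  kappa_pos : 0 < κ
  C_pos : 0 < C
  u₀_pos : 0 < u₀
  u₀_lt_one : u₀ < 1
  ae_mem : ∀ᵐ y ∂ν, y ∈ Set.Ioo (0 : ℝ) 1
  expansion : ∀ u, 0 < u → u ≤ u₀ → |ν.real (Set.Iio u) - κ * u ^ β| ≤ C * u ^ (β + θ)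
  density : ∀ s t u, s ≤ t → t ≤ u → 0 < u → u ≤ u₀ →
    ν.real (Set.Ico s t) ≤ C * u ^ (β - 1) * (t - s)
  lintegral_inv : ∫⁻ y, ENNReal.ofReal (1 / y) ∂ν ≤ ENNReal.ofReal C

lemma lintegral_inv_lt_top {ν : Measure ℝ} [IsProbabilityMeasure ν] {β C u₀ : ℝ} (hβ : 1 < β)
    (hu₀ : 0 < u₀) (hpos : ∀ᵐ y ∂ν, 0 < y)
    (hF : ∀ u, 0 < u → u ≤ u₀ → ν.real (Set.Iio u) ≤ C * u ^ β) :
    ∫⁻ y, ENNReal.ofReal (1 / y) ∂ν < ∞ := by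
  have h0 : 0 ≤ᵐ[ν] fun y : ℝ => 1 / y := by
    filter_upwards [hpos] with y hy using by positivity
  rw [lintegral_eq_lintegral_meas_lt ν h0 (by fun_prop)]
  have hsub : Set.Ioi (0 : ℝ) ⊆ Set.Ioc 0 (1 / u₀) ∪ Set.Ioi (1 / u₀) := fun s hs => by
    rcases le_or_gt s (1 / u₀) with h | h
    · exact Or.inl ⟨hs, h⟩
    · exact Or.inr h
  refine (lintegral_mono_set hsub).trans_lt ((lintegral_union_le _ _ _).trans_lt ?_)
  refine ENNReal.add_lt_top.2 ⟨?_, ?_⟩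
  · calc ∫⁻ s in Set.Ioc 0 (1 / u₀), ν {y | s < 1 / y} ≤ ∫⁻ _ in Set.Ioc 0 (1 / u₀), 1 :=
          lintegral_mono fun s => prob_le_one
      _ < ∞ := by simp
  · have hint : IntegrableOn (fun s : ℝ => C * s ^ (-β)) (Set.Ioi (1 / u₀)) :=
      (integrableOn_Ioi_rpow_of_lt (by linarith) (by positivity)).const_mul C
    refine lt_of_le_of_lt ?_ hint.lintegral_lt_top
    refine setLIntegral_mono_ae' measurableSet_Ioi (ae_of_all _ fun s hs => ?_)
    have hs : 1 / u₀ < s := hs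
    have hs0 : 0 < s := lt_trans (by positivity) hs
    have h1 : ν {y | s < 1 / y} ≤ ν (Set.Iio (1 / s)) := by
      refine measure_mono_ae ?_
      filter_upwards [hpos] with y hy (h : s < 1 / y)
      exact (lt_one_div hs0 hy).1 h
    refine h1.trans ?_
    rw [← ofReal_measureReal]
    refine ENNReal.ofReal_le_ofReal ((hF (1 / s) (by positivity) ?_).trans_eq ?_)
    · rw [one_div_le hs0 hu₀]; exact hs.le
    · rw [one_div, Real.inv_rpow hs0.le, Real.rpow_neg hs0.le]

/-- If the distribution function of a measure on `(0, ∞)` has derivative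
`κ β u ^ (β - 1) + O(u ^ (β - 1 + θ))` near `0`, then `TailBounds` holds. -/
lemma exists_tailBounds {ν : Measure ℝ} [IsProbabilityMeasure ν] {β θ κ C₁ u₁ : ℝ}
    (hβ : 1 < β) (hθ : 0 < θ) (hκ : 0 < κ) (hC₁ : 0 ≤ C₁) (hu₁ : 0 < u₁)
    (hpos : ∀ᵐ y ∂ν, y ∈ Set.Ioo (0 : ℝ) 1) {F' : ℝ → ℝ}
    (hderiv : ∀ u ∈ Set.Ioo 0 u₁, HasDerivAt (fun u => ν.real (Set.Iio u)) (F' u) u)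
    (hF' : ∀ u ∈ Set.Ioo 0 u₁, |F' u - κ * β * u ^ (β - 1)| ≤ C₁ * u ^ (β - 1 + θ)) :
    ∃ C u₀, TailBounds ν β θ κ C u₀ := by
  set F : ℝ → ℝ := fun u => ν.real (Set.Iio u) with hFdef
  set u₀ := min (u₁ / 2) (1 / 2) with hu₀def
  have hu₀ : 0 < u₀ := by positivity
  have hu₀1 : u₀ < 1 := (min_le_right _ _).trans_lt (by norm_num)
  have hu₀₁ : u₀ < u₁ := (min_le_left _ _).trans_lt (by linarith)
  have hF0 : Tendsto F (𝓝[>] 0) (𝓝 0) := by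
    have h1 := tendsto_measure_biInter_gt (μ := ν) (s := fun r : ℝ => Set.Iio r) (a := 0)
      (fun r _ => measurableSet_Iio.nullMeasurableSet)
      (fun i j _ hij => Set.Iio_subset_Iio hij) ⟨1, one_pos, measure_ne_top _ _⟩
    have h2 : ν (⋂ r > (0 : ℝ), Set.Iio r) = 0 := by
      refine measure_mono_null (t := {y | ¬ y ∈ Set.Ioo (0 : ℝ) 1}) (fun y hy hy' => ?_) hpos
      simp only [Set.mem_iInter, Set.mem_Iio] at hy
      exact lt_irrefl _ (hy y hy'.1)
    rw [h2] at h1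
    have h3 := (ENNReal.tendsto_toReal ENNReal.zero_ne_top).comp h1
    rw [ENNReal.toReal_zero] at h3
    exact h3
  have hexp : ∀ u, 0 < u → u ≤ u₀ → |F u - κ * u ^ β| ≤ C₁ * u ^ (β + θ) := by
    intro u hu huu
    have hlim : Tendsto (fun s => |(F u - κ * u ^ β) - (F s - κ * s ^ β)|) (𝓝[>] 0)
        (𝓝 |(F u - κ * u ^ β) - (0 - κ * 0 ^ β)|) := by
      refine (Tendsto.sub tendsto_const_nhds (hF0.sub (Tendsto.const_mul κ ?_))).abs
      exact ((Real.continuousAt_rpow_const 0 β (Or.inr (by linarith))).tendsto).mono_left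
        nhdsWithin_le_nhds
    rw [Real.zero_rpow (by linarith), mul_zero, sub_zero, sub_zero] at hlim
    refine le_of_tendsto hlim ?_
    filter_upwards [Ioo_mem_nhdsGT hu] with s hs
    have hder : ∀ x ∈ Set.Icc s u, HasDerivWithinAt (fun x => F x - κ * x ^ β)
        (F' x - κ * (β * x ^ (β - 1))) (Set.Icc s u) x := fun x hx =>
      ((hderiv x ⟨hs.1.trans_le hx.1, by linarith [hx.2]⟩).sub
        ((Real.hasDerivAt_rpow_const (Or.inl (hs.1.trans_le hx.1).ne')).const_mul κ)).hasDerivWithinAt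
    have h := (convex_Icc s u).norm_image_sub_le_of_norm_hasDerivWithin_le hder
      (C := C₁ * u ^ (β - 1 + θ)) (fun x hx => ?_) (Set.left_mem_Icc.2 hs.2.le)
      (Set.right_mem_Icc.2 hs.2.le)
    · rw [Real.norm_eq_abs, Real.norm_of_nonneg (by linarith [hs.2])] at h
      refine h.trans ?_
      have e1 : u ^ (β + θ) = u ^ (β - 1 + θ) * u := by
        rw [← Real.rpow_add_one hu.ne']; congr 1; ring
      rw [e1, ← mul_assoc]
      have : 0 ≤ C₁ * u ^ (β - 1 + θ) := by positivity
      gcongr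
      linarith [hs.1]
    · have hx0 : 0 < x := hs.1.trans_le hx.1
      rw [Real.norm_eq_abs, ← mul_assoc]
      refine (hF' x ⟨hx0, by linarith [hx.2]⟩).trans ?_
      have hβθ : 0 ≤ β - 1 + θ := by linarith
      gcongr
      exact hx.2
  set C₂ := κ * β + C₁ + κ with hC₂
  have hC₂0 : 0 < C₂ := by positivity
  have hFle : ∀ u, 0 < u → u ≤ u₀ → F u ≤ C₂ * u ^ β := by
    intro u hu huu
    have h1 := (abs_le.1 (hexp u hu huu)).2
    have h2 : u ^ (β + θ) ≤ u ^ β :=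
      Real.rpow_le_rpow_of_exponent_ge hu (by linarith) (by linarith)
    have h3 : C₁ * u ^ (β + θ) ≤ C₁ * u ^ β := by gcongr
    have h4 : 0 ≤ κ * β * u ^ β := by positivity
    rw [hC₂]
    linarith [add_mul (κ * β + C₁) κ (u ^ β), add_mul (κ * β) C₁ (u ^ β)]
  have hinc : ∀ s t u, 0 < s → s ≤ t → t ≤ u → u ≤ u₀ →
      F t - F s ≤ C₂ * u ^ (β - 1) * (t - s) := by
    intro s t u hs hst htu huu
    have hder : ∀ x ∈ Set.Icc s t, HasDerivWithinAt F (F' x) (Set.Icc s t) x := fun x hx =>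
      (hderiv x ⟨hs.trans_le hx.1, by linarith [hx.2]⟩).hasDerivWithinAt
    have h := (convex_Icc s t).norm_image_sub_le_of_norm_hasDerivWithin_le hder
      (C := C₂ * u ^ (β - 1)) (fun x hx => ?_) (Set.left_mem_Icc.2 hst) (Set.right_mem_Icc.2 hst)
    · rw [Real.norm_eq_abs, Real.norm_of_nonneg (by linarith)] at h
      exact (le_abs_self _).trans h
    · have hx0 : 0 < x := hs.trans_le hx.1
      have hx1 : x ≤ u := hx.2.trans htu
      have h1 := hF' x ⟨hx0, by linarith⟩
      have h2 : x ^ (β - 1 + θ) ≤ x ^ (β - 1) :=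
        Real.rpow_le_rpow_of_exponent_ge hx0 (by linarith) (by linarith)
      have h3 : x ^ (β - 1) ≤ u ^ (β - 1) := Real.rpow_le_rpow hx0.le hx1 (by linarith)
      have h4 : |κ * β * x ^ (β - 1)| = κ * β * x ^ (β - 1) := abs_of_nonneg (by positivity)
      have h5 := abs_sub_abs_le_abs_sub (F' x) (κ * β * x ^ (β - 1))
      rw [Real.norm_eq_abs]
      calc |F' x| ≤ κ * β * x ^ (β - 1) + C₁ * x ^ (β - 1 + θ) := by linarith
        _ ≤ κ * β * u ^ (β - 1) + C₁ * u ^ (β - 1) := by gcongr; exact h2.trans h3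
        _ ≤ C₂ * u ^ (β - 1) := by
            have : 0 ≤ κ * u ^ (β - 1) := by have := hx0.trans_le hx1; positivity
            rw [hC₂]
            linarith [add_mul (κ * β + C₁) κ (u ^ (β - 1)), add_mul (κ * β) C₁ (u ^ (β - 1))]
  have hdens : ∀ s t u, s ≤ t → t ≤ u → 0 < u → u ≤ u₀ →
      ν.real (Set.Ico s t) ≤ C₂ * u ^ (β - 1) * (t - s) := by
    intro s t u hst htu hu huu
    rcases lt_or_ge 0 s with hs | hs
    · have h1 : Set.Ico s t = Set.Iio t \ Set.Iio s := by
        ext y; simp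
      rw [h1, measureReal_sdiff (Set.Iio_subset_Iio hst) measurableSet_Iio]
      exact hinc s t u hs hst htu huu
    · rcases le_or_gt t 0 with ht | ht
      · have h1 : ν (Set.Ico s t) = 0 := by
          refine measure_mono_null (t := {y | ¬ y ∈ Set.Ioo (0 : ℝ) 1}) (fun y hy hy' => ?_) hpos
          exact absurd hy'.1 (not_lt.2 (hy.2.le.trans ht))
        rw [measureReal_def, h1, ENNReal.toReal_zero]
        have := sub_nonneg.2 hst
        positivity
      · have h1 : Tendsto (fun s' => F t - F s') (𝓝[>] 0) (𝓝 (F t - 0)) := hF0.const_sub _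
        have h2 : F t ≤ C₂ * u ^ (β - 1) * t := by
          rw [sub_zero] at h1
          refine le_of_tendsto h1 ?_
          filter_upwards [Ioo_mem_nhdsGT ht] with s' hs'
          refine (hinc s' t u hs'.1 hs'.2.le htu huu).trans ?_
          have := hs'.1
          gcongr
          linarith
        calc ν.real (Set.Ico s t) ≤ F t := measureReal_mono fun y hy => hy.2
          _ ≤ C₂ * u ^ (β - 1) * t := h2
          _ ≤ C₂ * u ^ (β - 1) * (t - s) := by gcongr; linarith
  have hinv := lintegral_inv_lt_top hβ hu₀ (hpos.mono fun y hy => hy.1) hFle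
  set J := ∫⁻ y, ENNReal.ofReal (1 / y) ∂ν with hJ
  refine ⟨C₂ + J.toReal, u₀, hβ, hθ, hκ, by positivity, hu₀, hu₀1, hpos, ?_, ?_, ?_⟩
  · intro u hu huu
    refine (hexp u hu huu).trans ?_
    gcongr
    have : 0 ≤ κ * β := by positivity
    linarith [ENNReal.toReal_nonneg (a := J)]
  · intro s t u hst htu hu huu
    refine (hdens s t u hst htu hu huu).trans ?_
    have := sub_nonneg.2 hst
    gcongr
    linarith [ENNReal.toReal_nonneg (a := J)]
  · exact (ENNReal.ofReal_toReal hinv.ne).symm.trans_le (ENNReal.ofReal_le_ofReal (by linarith))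

namespace CondG

variable {Ω : Type*} [MeasurableSpace Ω] {μ : Measure Ω} {a : ℕ → Ω → ℝ} {β θ κ : ℝ}

/-- The coefficients have a common law, since they share their c.d.f. on `[0, 1]`. -/
lemma map_eq [IsProbabilityMeasure μ] (h : CondG μ a β θ κ) (i : ℕ) :
    μ.map (a i) = μ.map (a 0) := by
  obtain ⟨G, hG, -⟩ := h.tail
  have hp : ∀ i, IsProbabilityMeasure (μ.map (a i)) := fun i =>
    Measure.isProbabilityMeasure_map (h.measurable i).aemeasurable
  refine Measure.ext_of_Iic _ _ fun x => ?_
  rw [Measure.map_apply (h.measurable i) measurableSet_Iic,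
    Measure.map_apply (h.measurable 0) measurableSet_Iic]
  rcases lt_or_ge x 0 with hx | hx
  · have h0 : ∀ i, μ (a i ⁻¹' Set.Iic x) = 0 := fun i => by
      refine measure_mono_null (t := {ω | ¬ a i ω ∈ Set.Ioo (0 : ℝ) 1}) (fun ω hω hω' => ?_)
        (h.mem_Ioo i)
      have : a i ω ≤ x := hω
      linarith [hω'.1]
    rw [h0, h0]
  · rcases le_or_gt x 1 with hx1 | hx1
    · have := (hG i x ⟨hx, hx1⟩).symm.trans (hG 0 x ⟨hx, hx1⟩)
      rwa [measureReal_def, measureReal_def,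
        ENNReal.toReal_eq_toReal_iff' (measure_ne_top _ _) (measure_ne_top _ _)] at this
    · have h1 : ∀ i, μ (a i ⁻¹' Set.Iic x) = 1 := fun i => by
        rw [← measure_univ (μ := μ)]
        refine measure_congr (eventuallyEq_univ.2 ?_)
        filter_upwards [h.mem_Ioo i] with ω hω
        exact (hω.2.trans hx1).le
      rw [h1, h1]

/-- The law of `1 - a i`. -/
lemma map_one_sub_eq [IsProbabilityMeasure μ] (h : CondG μ a β θ κ) (i : ℕ) :
    μ.map (fun ω => 1 - a i ω) = μ.map (fun ω => 1 - a 0 ω) := by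
  have h1 : ∀ i, μ.map (fun ω => 1 - a i ω) = (μ.map (a i)).map (fun x => 1 - x) := fun i => by
    rw [Measure.map_map (by fun_prop) (h.measurable i)]
    rfl
  rw [h1, h1, h.map_eq i]

lemma exists_tailBounds [IsProbabilityMeasure μ] (h : CondG μ a β θ κ) :
    ∃ C u₀, TailBounds (μ.map (fun ω => 1 - a 0 ω)) β θ κ C u₀ := by
  obtain ⟨G, hG, ε, hε, g, hg, -, R, hR, hgR⟩ := h.tail
  have hm : Measurable (fun ω => 1 - a 0 ω) := measurable_const.sub (h.measurable 0)
  have := Measure.isProbabilityMeasure_map (μ := μ) hm.aemeasurable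
  obtain ⟨c, hc0, hc⟩ := hR.exists_pos
  have hc := hc.bound
  obtain ⟨l, hl, hlc⟩ := mem_nhdsLT_iff_exists_Ioo_subset.1 hc
  have hl : l < 1 := hl
  set ν := μ.map (fun ω => 1 - a 0 ω) with hν
  have hβ := h.one_lt_beta
  have hκ := h.kappa_pos
  have hu₁ : 0 < min ε (1 - l) := lt_min hε.1 (by linarith)
  have hmem : ∀ u ∈ Set.Ioo 0 (min ε (1 - l)), 1 - u ∈ Set.Ioo (1 - ε) 1 ∧ 1 - u ∈ Set.Ioo l 1 :=
    fun u hu => by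
      have h1 := hu.2.trans_le (min_le_left _ _)
      have h2 := hu.2.trans_le (min_le_right _ _)
      have h3 := hu.1
      exact ⟨⟨by linarith, by linarith⟩, by linarith, by linarith⟩
  refine RCAR.exists_tailBounds (u₁ := min ε (1 - l)) (C₁ := κ * β * c) (F' := fun u => g (1 - u))
    hβ h.nu_pos hκ (by positivity) hu₁ ?_ ?_ ?_
  · refine (ae_map_iff hm.aemeasurable measurableSet_Ioo).2 ?_
    filter_upwards [h.mem_Ioo 0] with ω hω
    exact ⟨by linarith [hω.2], by linarith [hω.1]⟩
  · intro u hu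
    have hF : ∀ v ∈ Set.Ioo (0 : ℝ) 1, ν.real (Set.Iio v) = 1 - G (1 - v) := by
      intro v hv
      rw [hG 0 (1 - v) ⟨by linarith [hv.2], by linarith [hv.1]⟩, measureReal_def, hν,
        Measure.map_apply hm measurableSet_Iio, ← measureReal_def,
        ← probReal_compl_eq_one_sub (measurableSet_le (h.measurable 0) measurable_const)]
      congr 1
      ext ω
      simp only [Set.mem_preimage, Set.mem_Iio, Set.mem_compl_iff, Set.mem_ofPred_eq, not_le]
      constructor <;> intro h <;> linarith
    have hder : HasDerivAt (fun v => 1 - G (1 - v)) (g (1 - u)) u := by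
      have h1 := (hg (1 - u) (hmem u hu).1).comp u ((hasDerivAt_id u).const_sub 1)
      have h2 := h1.const_sub 1
      simpa [Function.comp_def] using h2
    refine hder.congr_of_eventuallyEq ?_
    filter_upwards [Ioo_mem_nhds hu.1 (hu.2.trans_le ((min_le_left _ _).trans hε.2.le))] with v hv
    exact hF v hv
  · intro u hu
    have h1 := hlc (hmem u hu).2
    have h2 := hgR (1 - u) (hmem u hu).1
    have hu0 := hu.1
    simp only [Set.mem_ofPred_eq, sub_sub_cancel, Real.norm_eq_abs] at h1 h2
    rw [abs_of_nonneg (by positivity : (0 : ℝ) ≤ u ^ θ)] at h1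
    have h3 : g (1 - u) - κ * β * u ^ (β - 1) = κ * β * u ^ (β - 1) * R (1 - u) := by
      rw [h2]; ring
    rw [h3, abs_mul, abs_of_nonneg (by positivity), Real.rpow_add hu0]
    calc κ * β * u ^ (β - 1) * |R (1 - u)| ≤ κ * β * u ^ (β - 1) * (c * u ^ θ) := by gcongr
      _ = _ := by ring

end CondG

namespace TailBounds

variable {ν : Measure ℝ} [IsProbabilityMeasure ν] {β θ κ C u₀ : ℝ}

/-- The singular integral `∫ (y - u)⁻²` over `|y - u| > ρ`, computed by the layer cake formula from
the bound on the density. -/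
lemma lintegral_inv_sq_le (h : TailBounds ν β θ κ C u₀) {u d ρ : ℝ} (hd : 0 < d)
    (hdu : d ≤ u₀) (hρ : 0 < ρ) :
    ∫⁻ y in {y | ρ < |y - u| ∧ y < d}, ENNReal.ofReal (1 / (y - u) ^ 2) ∂ν ≤
      ENNReal.ofReal (4 * C * d ^ (β - 1) / ρ) := by
  set S : Set ℝ := {y | ρ < |y - u| ∧ y < d} with hS
  have hC := h.C_pos
  rw [lintegral_eq_lintegral_meas_lt _ (ae_of_all _ fun y => by positivity) (by fun_prop)]
  have hb : (0 : ℝ) ≤ 1 / ρ ^ 2 := by positivity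
  have hint : IntervalIntegrable (fun s : ℝ => 2 * C * d ^ (β - 1) * s ^ (-(1 / 2) : ℝ)) volume 0
      (1 / ρ ^ 2) := (intervalIntegral.intervalIntegrable_rpow' (by norm_num)).const_mul _
  have hval : ∫ s in (0 : ℝ)..(1 / ρ ^ 2), 2 * C * d ^ (β - 1) * s ^ (-(1 / 2) : ℝ) =
      4 * C * d ^ (β - 1) / ρ := by
    rw [intervalIntegral.integral_const_mul, integral_rpow (Or.inl (by norm_num))]
    have e1 : (-(1 / 2) + 1 : ℝ) = 1 / 2 := by norm_num
    rw [e1, Real.zero_rpow (by norm_num), ← Real.sqrt_eq_rpow, Real.sqrt_div zero_le_one,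
      Real.sqrt_one, Real.sqrt_sq hρ.le]
    ring
  rw [← hval, intervalIntegral.integral_of_le hb,
    ofReal_integral_eq_lintegral_ofReal ((intervalIntegrable_iff_integrableOn_Ioc_of_le hb).1 hint)]
  · have hsplit : Set.Ioi (0 : ℝ) = Set.Ioc 0 (1 / ρ ^ 2) ∪ Set.Ioi (1 / ρ ^ 2) :=
      (Set.Ioc_union_Ioi_eq_Ioi hb).symm
    rw [hsplit]
    refine (lintegral_union_le _ _ _).trans ?_
    have hzero : ∫⁻ s in Set.Ioi (1 / ρ ^ 2), ν.restrict S {y | s < 1 / (y - u) ^ 2} = 0 := by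
      rw [setLIntegral_congr_fun (g := fun _ => 0) measurableSet_Ioi fun s hs => ?_, lintegral_zero]
      rw [Measure.restrict_apply (measurableSet_lt measurable_const (by fun_prop))]
      convert! measure_empty (μ := ν)
      ext y
      simp only [Set.mem_inter_iff, Set.mem_ofPred_eq, Set.mem_empty_iff_false, iff_false, hS,
        not_and]
      intro h1 h2
      exfalso
      have h3 : ρ ^ 2 < (y - u) ^ 2 := by
        rw [← sq_abs (y - u)]
        exact pow_lt_pow_left₀ h2 hρ.le two_ne_zero
      have h4 : 1 / (y - u) ^ 2 < 1 / ρ ^ 2 := one_div_lt_one_div_of_lt (by positivity) h3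
      have h5 : 1 / ρ ^ 2 < s := hs
      linarith
    rw [hzero, add_zero]
    refine setLIntegral_mono_ae' measurableSet_Ioc (ae_of_all _ fun s hs => ?_)
    have hs0 : 0 < s := hs.1
    set r := s ^ (-(1 / 2) : ℝ) with hr
    have hr0 : 0 < r := by positivity
    have hr2 : r ^ 2 = 1 / s := by
      rw [hr, ← Real.rpow_natCast, ← Real.rpow_mul hs0.le]
      norm_num
      rw [Real.rpow_neg_one]
    have hsub : {y | s < 1 / (y - u) ^ 2} ∩ S ⊆ Set.Ico (u - r) (min (u + r) d) := by
      rintro y ⟨h1, h2⟩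
      have h1 : s < 1 / (y - u) ^ 2 := h1
      have h3 : 0 < (y - u) ^ 2 := by
        have := hρ.trans h2.1
        have := abs_pos.1 this
        positivity
      have h4 : (y - u) ^ 2 < r ^ 2 := by
        rw [hr2]; exact (lt_one_div hs0 h3).1 h1
      have h5 := abs_lt_of_sq_lt_sq h4 hr0.le
      rw [abs_lt] at h5
      exact ⟨by linarith [h5.1], lt_min (by linarith [h5.2]) h2.2⟩
    rw [Measure.restrict_apply (measurableSet_lt measurable_const (by fun_prop))]
    rcases le_or_gt (u - r) (min (u + r) d) with hle | hlt
    · refine (measure_mono hsub).trans ?_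
      rw [← ofReal_measureReal]
      refine ENNReal.ofReal_le_ofReal ((h.density _ _ d hle (min_le_right _ _) hd hdu).trans ?_)
      calc C * d ^ (β - 1) * (min (u + r) d - (u - r)) ≤ C * d ^ (β - 1) * (2 * r) := by
            gcongr
            linarith [min_le_left (u + r) d]
        _ = _ := by ring
    · refine (measure_mono hsub).trans ?_
      rw [Set.Ico_eq_empty (not_lt.2 hlt.le), measure_empty]
      exact zero_le
  · filter_upwards [ae_restrict_mem measurableSet_Ioc] with s hs
    have := hs.1
    simp only [Pi.zero_apply]
    positivity

end TailBounds

end RCAR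

/-! ### Level crossings between a coefficient and its estimate -/

namespace RCAR

variable {Ω : Type*} [MeasurableSpace Ω] {μ : Measure Ω}

namespace UnitModel

variable {A B C : Ω → ℝ} {η ξ X : ℤ → Ω → ℝ}

/-- The martingale term `∑ x (t - 1) z t` of a unit. -/
noncomputable def mart (B C : Ω → ℝ) (η ξ X : ℤ → Ω → ℝ) (T : ℕ) (ω : Ω) : ℝ :=
  ∑ t ∈ Finset.Icc (2 : ℤ) T, path B C X (t - 1) ω * innov B C η ξ t ω

/-- The end point error of a unit, see `endpointError`. -/
noncomputable def endErr (A B C : Ω → ℝ) (η ξ X : ℤ → Ω → ℝ) (T : ℕ) (ω : Ω) : ℝ :=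
  endpointError (A ω) T (path B C X 1 ω) (path B C X T ω)
    (∑ t ∈ Finset.Icc (2 : ℤ) T, innov B C η ξ t ω)

lemma measurable_mart (h : UnitModel μ A B C η ξ X) (T : ℕ) : Measurable (mart B C η ξ X T) := by
  unfold mart
  exact Finset.measurable_sum _ fun t _ => (h.measurable_path _).mul (h.measurable_innov t)

lemma measurable_endErr (h : UnitModel μ A B C η ξ X) (T : ℕ) :
    Measurable (endErr A B C η ξ X T) := by
  have h1 := h.measurable_path 1
  have h2 := h.measurable_path T
  have h3 : Measurable fun ω => ∑ t ∈ Finset.Icc (2 : ℤ) T, innov B C η ξ t ω :=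
    Finset.measurable_sum _ fun t _ => h.measurable_innov t
  have h4 := h.measurable_A
  unfold endErr endpointError
  fun_prop

lemma lintegral_mul_mart_sq_le [IsProbabilityMeasure μ] (h : UnitModel μ A B C η ξ X)
    {w : ℝ → ℝ} (hw : Measurable w) (hw0 : ∀ y, 0 ≤ w y) (T : ℕ) :
    ∫⁻ ω, ENNReal.ofReal (w (1 - A ω) * mart B C η ξ X T ω ^ 2) ∂μ ≤
      ∫⁻ ω, ENNReal.ofReal (w (1 - A ω) * (T / (1 - A ω))) ∂μ := by
  have h1 := h.lintegral_martingale_sq_le (w := fun a => ENNReal.ofReal (w (1 - a)))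
    (by fun_prop) (fun _ => ENNReal.ofReal_ne_top) T
  simp_rw [ENNReal.ofReal_mul (hw0 _)]
  exact h1

lemma lintegral_mul_endErr_le [IsProbabilityMeasure μ] (h : UnitModel μ A B C η ξ X)
    {w : ℝ → ℝ} (hw : Measurable w) (hw0 : ∀ y, 0 ≤ w y) {T : ℕ} (hT : 2 ≤ T) :
    ∫⁻ ω, ENNReal.ofReal (w (1 - A ω) * endErr A B C η ξ X T ω) ∂μ ≤
      ∫⁻ ω, ENNReal.ofReal (3 / T * w (1 - A ω)) ∂μ := by
  have hTp : (0 : ℝ) < T := by positivity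
  have hA := h.measurable_A
  set Z : Ω → ℝ := fun ω => ∑ t ∈ Finset.Icc (2 : ℤ) T, innov B C η ξ t ω with hZ
  have hZm : Measurable Z := Finset.measurable_sum _ fun t _ => h.measurable_innov t
  have hp1 := h.measurable_path 1
  have hpT := h.measurable_path T
  have b1 : ∫⁻ ω, ENNReal.ofReal (w (1 - A ω) / T ^ 2) * ENNReal.ofReal (Z ω ^ 2) ∂μ ≤
      ∫⁻ ω, ENNReal.ofReal (1 / T * w (1 - A ω)) ∂μ := by
    refine (h.lintegral_sum_innov_sq_le (w := fun a => ENNReal.ofReal (w (1 - a) / T ^ 2))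
      (by fun_prop) T).trans_eq ?_
    refine lintegral_congr fun ω => ?_
    have := hw0 (1 - A ω)
    rw [← ENNReal.ofReal_mul (by positivity)]
    congr 1
    field_simp
  have b2 : ∀ t : ℤ, 1 ≤ t → ∫⁻ ω, ENNReal.ofReal (w (1 - A ω) * (1 - A ω) / T) *
      ENNReal.ofReal (path B C X t ω ^ 2) ∂μ ≤ ∫⁻ ω, ENNReal.ofReal (1 / T * w (1 - A ω)) ∂μ := by
    intro t ht
    refine (h.lintegral_path_sq_le (w := fun a => ENNReal.ofReal (w (1 - a) * (1 - a) / T))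
      (by fun_prop) ht (fun _ => ENNReal.ofReal_ne_top)).trans_eq ?_
    refine lintegral_congr_ae ?_
    filter_upwards [h.mem_Ioo] with ω hω
    have h0 := hw0 (1 - A ω)
    have h1 : 0 < 1 - A ω := by linarith [hω.2]
    rw [← ENNReal.ofReal_mul (by positivity)]
    congr 1
    field_simp
  have e1 : ∀ᵐ ω ∂μ, ENNReal.ofReal (w (1 - A ω) * endErr A B C η ξ X T ω) =
      ENNReal.ofReal (w (1 - A ω) / T ^ 2) * ENNReal.ofReal (Z ω ^ 2) +
      (ENNReal.ofReal (w (1 - A ω) * (1 - A ω) / T) * ENNReal.ofReal (path B C X 1 ω ^ 2) +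
      ENNReal.ofReal (w (1 - A ω) * (1 - A ω) / T) * ENNReal.ofReal (path B C X T ω ^ 2)) := by
    filter_upwards [h.mem_Ioo] with ω hω
    have h0 := hw0 (1 - A ω)
    have h1 : 0 < 1 - A ω := by linarith [hω.2]
    rw [← ENNReal.ofReal_mul (by positivity), ← ENNReal.ofReal_mul (by positivity),
      ← ENNReal.ofReal_mul (by positivity), ← ENNReal.ofReal_add (by positivity) (by positivity),
      ← ENNReal.ofReal_add (by positivity) (by positivity)]
    congr 1
    simp only [endErr, endpointError, hZ]
    ring
  rw [lintegral_congr_ae e1, lintegral_add_left (by fun_prop), lintegral_add_left (by fun_prop)]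
  have e2 : ∫⁻ ω, ENNReal.ofReal (3 / T * w (1 - A ω)) ∂μ =
      ∫⁻ ω, ENNReal.ofReal (1 / T * w (1 - A ω)) ∂μ +
      (∫⁻ ω, ENNReal.ofReal (1 / T * w (1 - A ω)) ∂μ +
      ∫⁻ ω, ENNReal.ofReal (1 / T * w (1 - A ω)) ∂μ) := by
    rw [← lintegral_add_left (by fun_prop), ← lintegral_add_left (by fun_prop)]
    refine lintegral_congr fun ω => ?_
    have h0 := hw0 (1 - A ω)
    rw [← ENNReal.ofReal_add (by positivity) (by positivity),
      ← ENNReal.ofReal_add (by positivity) (by positivity)]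
    congr 1
    ring
  rw [e2]
  exact add_le_add b1 (add_le_add (b2 1 le_rfl) (b2 T (by omega)))

/-- Outside of three atypical events, the error of the sample autocorrelation of a unit is
controlled by its martingale term and its end point error. -/
lemma ae_abs_sampleAutocorr_sub_le (h : UnitModel μ A B C η ξ X) {T : ℕ} (hT : 2 ≤ T) :
    ∀ᵐ ω ∂μ, 1 ≤ T * (1 - A ω) →
      (T : ℝ) / 8 ≤ ∑ t ∈ Finset.Icc (2 : ℤ) T, innov B C η ξ t ω ^ 2 →
      |mart B C η ξ X T ω| ≤ T / 100 → endErr A B C η ξ X T ω ≤ (1 - A ω) / 1000 →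
      |sampleAutocorr (fun t => X t ω) T - A ω| ≤
        25 * ((1 - A ω) * |mart B C η ξ X T ω| / T + 10 * endErr A B C η ξ X T ω) := by
  filter_upwards [h.mem_Ioo, h.weights_pos, h.ae_path_recursion] with ω hA hBC hrec h1 h2 h3 h4
  have hs : (√(B ω ^ 2 + C ω ^ 2))⁻¹ ≠ 0 := inv_ne_zero (Real.sqrt_pos.2 hBC).ne'
  have h5 := abs_sampleAutocorr_sub_le (x := fun t => path B C X t ω)
    (z := fun t => innov B C η ξ t ω) hA.1 hA.2 hT (fun t _ => hrec t) h1 h2 h3 h4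
  rw [← sampleAutocorr_const_mul hs]
  have e : (fun t => (√(B ω ^ 2 + C ω ^ 2))⁻¹ * X t ω) = fun t => path B C X t ω := by
    ext t; rw [path, div_eq_inv_mul]
  rw [e]
  exact h5

end UnitModel

/-- Markov's inequality in the form used for the union bound below. -/
lemma measure_le_lintegral_ofReal {S : Set Ω} {f : Ω → ℝ} (hf : Measurable f)
    (hS : ∀ᵐ ω ∂μ, ω ∈ S → 1 ≤ f ω) : μ S ≤ ∫⁻ ω, ENNReal.ofReal (f ω) ∂μ := by
  calc μ S ≤ μ {ω | 1 ≤ ENNReal.ofReal (f ω)} := by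
        refine measure_mono_ae ?_
        filter_upwards [hS] with ω hω hωS
        exact ENNReal.one_le_ofReal.2 (hω hωS)
    _ ≤ _ := by
        have := mul_meas_ge_le_lintegral (μ := μ) hf.ennreal_ofReal 1
        simpa using this

lemma measure_union_le_of_le {S S' : Set Ω} {c c' : ℝ≥0∞} (h : μ S ≤ c) (h' : μ S' ≤ c') :
    μ (S ∪ S') ≤ c + c' :=
  (measure_union_le S S').trans (add_le_add h h')

namespace TailBounds

variable {ν : Measure ℝ} {β θ κ K u₀ : ℝ}

lemma lintegral_const_div_le (h : TailBounds ν β θ κ K u₀) {c : ℝ} (hc : 0 ≤ c) :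
    ∫⁻ y, ENNReal.ofReal (c / y) ∂ν ≤ ENNReal.ofReal (c * K) := by
  have e : ∀ y : ℝ, ENNReal.ofReal (c / y) = ENNReal.ofReal c * ENNReal.ofReal (1 / y) := fun y => by
    rw [← ENNReal.ofReal_mul hc]; congr 1; ring
  simp_rw [e]
  rw [lintegral_const_mul _ (by fun_prop), ENNReal.ofReal_mul hc]
  gcongr
  exact h.lintegral_inv

variable [IsProbabilityMeasure ν]

/-- `ρ = δ / q` is the width of the window around `u` inside which an error of the sample
autocorrelation may change the position relative to `1 - u`. -/
lemma measure_window_le (h : TailBounds ν β θ κ K u₀) {u δ q : ℝ} (hu : u ≤ δ)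
    (hδ : 0 < δ) (hδ' : 4 * δ ≤ u₀) (hq : 1 ≤ q) :
    ν {y | |y - u| ≤ δ / q} ≤ ENNReal.ofReal (3 * K * 4 ^ β * (δ ^ β / q)) := by
  have hK := h.C_pos
  have hρ : 0 < δ / q := by positivity
  have hρδ : δ / q ≤ δ := div_le_self hδ.le hq
  have hsub : {y | |y - u| ≤ δ / q} ⊆ Set.Ico (u - δ / q) (u + 2 * (δ / q)) := fun y hy => by
    have := abs_le.1 (show |y - u| ≤ δ / q from hy)
    exact ⟨by linarith [this.1], by linarith [this.2]⟩
  refine (measure_mono hsub).trans ?_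
  rw [← ofReal_measureReal]
  refine ENNReal.ofReal_le_ofReal ((h.density _ _ (4 * δ) (by linarith) (by linarith)
    (by positivity) hδ').trans ?_)
  have e1 : (4 * δ) ^ (β - 1) = 4 ^ β * δ ^ β / (4 * δ) := by
    rw [Real.rpow_sub_one (by positivity), Real.mul_rpow (by norm_num) hδ.le]
  have hpos : 0 ≤ K * 4 ^ β * (δ ^ β / q) := by positivity
  calc K * (4 * δ) ^ (β - 1) * (u + 2 * (δ / q) - (u - δ / q)) =
      3 / 4 * (K * 4 ^ β * (δ ^ β / q)) := by rw [e1]; field_simp; ring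
    _ ≤ 3 * K * 4 ^ β * (δ ^ β / q) := by linarith

lemma lintegral_window_sq_le (h : TailBounds ν β θ κ K u₀) {u δ q T : ℝ} (hu : u ≤ δ)
    (hδ : 0 < δ) (hδ' : 4 * δ ≤ u₀) (hq : 1 ≤ q) (hT : 0 < T) (hqT : q ^ 2 = T * δ) :
    ∫⁻ y, ENNReal.ofReal ({y | δ / q < |y - u|}.indicator
      (fun y => 2500 * y / (T * (y - u) ^ 2)) y) ∂ν ≤
      ENNReal.ofReal (20000 * K * 4 ^ β * (δ ^ β / q) + 10000 * K * (1 / T)) := by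
  have hK := h.C_pos
  have hρ : 0 < δ / q := by positivity
  have hq0 : 0 < q := by linarith
  set S : Set ℝ := {y | δ / q < |y - u| ∧ y < 2 * δ} with hS
  have hS1 : MeasurableSet {y : ℝ | δ / q < |y - u|} := measurableSet_lt measurable_const (by fun_prop)
  have hSm : MeasurableSet S := hS1.inter measurableSet_Iio
  have hle : ∀ᵐ y ∂ν, ENNReal.ofReal ({y | δ / q < |y - u|}.indicator
      (fun y => 2500 * y / (T * (y - u) ^ 2)) y) ≤
      S.indicator (fun y => ENNReal.ofReal (5000 * δ / T) * ENNReal.ofReal (1 / (y - u) ^ 2)) y +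
        ENNReal.ofReal (10000 / T / y) := by
    filter_upwards [h.ae_mem] with y hy
    have hy0 := hy.1
    by_cases h1 : δ / q < |y - u|
    · have hne : 0 < (y - u) ^ 2 := by
        have := abs_pos.1 (hρ.trans h1)
        positivity
      rw [Set.indicator_of_mem (by exact h1)]
      by_cases h2 : y < 2 * δ
      · rw [Set.indicator_of_mem (show y ∈ S from ⟨h1, h2⟩)]
        refine le_trans ?_ le_self_add
        rw [← ENNReal.ofReal_mul (by positivity)]
        refine ENNReal.ofReal_le_ofReal ?_
        rw [div_mul_div_comm, mul_one]
        exact div_le_div_of_nonneg_right (by linarith) (by positivity)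
      · rw [Set.indicator_of_notMem (fun hm : y ∈ S => h2 hm.2), zero_add]
        refine ENNReal.ofReal_le_ofReal ?_
        push Not at h2
        rw [div_div, div_le_div_iff₀ (by positivity) (by positivity)]
        have h3 : y ≤ 2 * (y - u) := by linarith
        have h4 : y ^ 2 ≤ (2 * (y - u)) ^ 2 := pow_le_pow_left₀ hy0.le h3 2
        calc 2500 * y * (T * y) = 2500 * T * y ^ 2 := by ring
          _ ≤ 2500 * T * (2 * (y - u)) ^ 2 := by gcongr
          _ = 10000 * (T * (y - u) ^ 2) := by ring
    · rw [Set.indicator_of_notMem (by exact h1), ENNReal.ofReal_zero]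
      exact zero_le
  refine (lintegral_mono_ae hle).trans ?_
  rw [lintegral_add_right _ (by fun_prop), lintegral_indicator hSm,
    lintegral_const_mul _ (by fun_prop), ENNReal.ofReal_add (by positivity) (by positivity)]
  refine add_le_add ?_ ?_
  · calc _ ≤ ENNReal.ofReal (5000 * δ / T) *
          ENNReal.ofReal (4 * K * (2 * δ) ^ (β - 1) / (δ / q)) := by
          gcongr
          exact h.lintegral_inv_sq_le (by positivity) (by linarith) hρ
      _ ≤ _ := by
          rw [← ENNReal.ofReal_mul (by positivity)]
          refine ENNReal.ofReal_le_ofReal ?_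
          have e1 : (2 * δ) ^ (β - 1) = 2 ^ β * δ ^ β / (2 * δ) := by
            rw [Real.rpow_sub_one (by positivity), Real.mul_rpow (by norm_num) hδ.le]
          have e2 : (2 : ℝ) ^ β ≤ 4 ^ β :=
            Real.rpow_le_rpow (by norm_num) (by norm_num) (by linarith [h.one_lt_beta])
          have e3 : T = q ^ 2 / δ := by rw [hqT]; field_simp
          calc 5000 * δ / T * (4 * K * (2 * δ) ^ (β - 1) / (δ / q)) =
              10000 * K * 2 ^ β * (δ ^ β / q) := by rw [e1, e3]; field_simp; ring
            _ ≤ 10000 * K * 4 ^ β * (δ ^ β / q) := by gcongr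
            _ ≤ 20000 * K * 4 ^ β * (δ ^ β / q) := by gcongr; norm_num
  · refine (h.lintegral_const_div_le (by positivity)).trans_eq ?_
    congr 1; ring

lemma lintegral_window_le (h : TailBounds ν β θ κ K u₀) {u δ q T : ℝ} (hu : u ≤ δ)
    (hδ : 0 < δ) (hδ' : 4 * δ ≤ u₀) (hq : 1 ≤ q) (hT : 0 < T) (hqT : q ^ 2 = T * δ) :
    ∫⁻ y, ENNReal.ofReal (3 / T * {y | δ / q < |y - u|}.indicator
      (fun y => 500 / |y - u|) y) ∂ν ≤
      ENNReal.ofReal (1500 * K * 4 ^ β * (δ ^ β / q) + 3000 * K * (1 / T)) := by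
  have hK := h.C_pos
  have hρ : 0 < δ / q := by positivity
  have hq0 : 0 < q := by linarith
  have hle : ∀ᵐ y ∂ν, ENNReal.ofReal (3 / T * {y | δ / q < |y - u|}.indicator
      (fun y => 500 / |y - u|) y) ≤
      (Set.Ico 0 (2 * δ)).indicator (fun _ => ENNReal.ofReal (1500 / (T * (δ / q)))) y +
        ENNReal.ofReal (3000 / T / y) := by
    filter_upwards [h.ae_mem] with y hy
    have hy0 := hy.1
    by_cases h1 : δ / q < |y - u|
    · rw [Set.indicator_of_mem (by exact h1)]
      by_cases h2 : y < 2 * δ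
      · rw [Set.indicator_of_mem (show y ∈ Set.Ico 0 (2 * δ) from ⟨hy0.le, h2⟩)]
        refine le_trans ?_ le_self_add
        refine ENNReal.ofReal_le_ofReal ?_
        rw [div_mul_div_comm]
        have : (3 : ℝ) * 500 = 1500 := by norm_num
        rw [this]
        gcongr
      · rw [Set.indicator_of_notMem (fun hm => h2 hm.2), zero_add]
        refine ENNReal.ofReal_le_ofReal ?_
        push Not at h2
        have h3 : y ≤ 2 * |y - u| := by linarith [le_abs_self (y - u)]
        have h4 : 0 < |y - u| := hρ.trans h1
        rw [div_mul_div_comm, div_div, div_le_div_iff₀ (by positivity) (by positivity)]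
        calc 3 * 500 * (T * y) ≤ 3 * 500 * (T * (2 * |y - u|)) := by gcongr
          _ = 3000 * (T * |y - u|) := by ring
    · rw [Set.indicator_of_notMem (by exact h1), mul_zero, ENNReal.ofReal_zero]
      exact zero_le
  refine (lintegral_mono_ae hle).trans ?_
  rw [lintegral_add_right _ (by fun_prop), lintegral_indicator_const measurableSet_Ico,
    ENNReal.ofReal_add (by positivity) (by positivity)]
  refine add_le_add ?_ ?_
  · rw [← ofReal_measureReal, ← ENNReal.ofReal_mul (by positivity)]
    refine ENNReal.ofReal_le_ofReal ?_
    have e0 := h.density 0 (2 * δ) (2 * δ) (by positivity) le_rfl (by positivity) (by linarith)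
    have e1 : (2 * δ) ^ (β - 1) = 2 ^ β * δ ^ β / (2 * δ) := by
      rw [Real.rpow_sub_one (by positivity), Real.mul_rpow (by norm_num) hδ.le]
    have e2 : (2 : ℝ) ^ β ≤ 4 ^ β :=
      Real.rpow_le_rpow (by norm_num) (by norm_num) (by linarith [h.one_lt_beta])
    have e3 : T = q ^ 2 / δ := by rw [hqT]; field_simp
    calc 1500 / (T * (δ / q)) * ν.real (Set.Ico 0 (2 * δ)) ≤
        1500 / (T * (δ / q)) * (K * (2 * δ) ^ (β - 1) * (2 * δ - 0)) := by gcongr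
      _ = 1500 * K * 2 ^ β * (δ ^ β / q) := by rw [e1, e3]; field_simp; ring
      _ ≤ 1500 * K * 4 ^ β * (δ ^ β / q) := by gcongr
  · refine (h.lintegral_const_div_le (by positivity)).trans_eq ?_
    congr 1; ring

end TailBounds

namespace UnitModel

variable {A B C : Ω → ℝ} {η ξ X : ℤ → Ω → ℝ}

/-- The sample autocorrelation and the true coefficient of a unit rarely lie on different sides of
the level `1 - u`. The crucial gain is that the martingale term has variance of order `(1 - A) / T`,
so that near the level an error of order `√(δ / T)` is typical. -/
lemma measure_mismatch_le [IsProbabilityMeasure μ] (h : UnitModel μ A B C η ξ X) {β θ κ K u₀ : ℝ}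
    (hν : TailBounds (μ.map (fun ω => 1 - A ω)) β θ κ K u₀) {L : ℝ} (hL : 0 < L)
    (hη : ∀ t, ∫ ω, max (η t ω ^ 2 - L / 2) 0 ∂μ ≤ 1 / 4)
    (hξ : ∀ t, ∫ ω, max (ξ t ω ^ 2 - L / 2) 0 ∂μ ≤ 1 / 4)
    {T : ℕ} (hT : 2 ≤ T) {u δ : ℝ} (hu : u ≤ δ) (hδ : 0 < δ) (hδ' : 4 * δ ≤ u₀)
    (hTδ : 1 ≤ T * δ) :
    μ {ω | ¬ (1 - u < A ω ↔ 1 - u < sampleAutocorr (fun t => X t ω) T)} ≤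
      ENNReal.ofReal ((64 * L ^ 2 + 40000 * K * 4 ^ β) * (δ ^ β / √(T * δ) + 1 / T)) := by
  have hTp : (0 : ℝ) < T := by positivity
  have hK := hν.C_pos
  have hAm := h.measurable_A
  have hy : Measurable fun ω => 1 - A ω := by fun_prop
  have := Measure.isProbabilityMeasure_map (μ := μ) hy.aemeasurable
  set ν := μ.map (fun ω => 1 - A ω) with hνdef
  set q := √(T * δ) with hq
  have hq1 : 1 ≤ q := Real.one_le_sqrt.2 hTδ
  have hqT : q ^ 2 = T * δ := Real.sq_sqrt (by positivity)
  have hMm := h.measurable_mart T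
  have hHm := h.measurable_endErr T
  set M := mart B C η ξ X T with hM
  set H := endErr A B C η ξ X T with hH
  have hIoo : ∀ᵐ ω ∂μ, 0 < 1 - A ω := by
    filter_upwards [h.mem_Ioo] with ω hω using by linarith [hω.2]
  have htrans : ∀ f : ℝ → ℝ, Measurable f →
      ∫⁻ ω, ENNReal.ofReal (f (1 - A ω)) ∂μ = ∫⁻ y, ENNReal.ofReal (f y) ∂ν := fun f hf => by
    rw [hνdef, lintegral_map hf.ennreal_ofReal hy]
  set W : Set ℝ := {y | δ / q < |y - u|} with hW
  have hWm : MeasurableSet W := measurableSet_lt measurable_const (by fun_prop)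
  -- atypical events
  have m1 : μ {ω | T * (1 - A ω) < 1} ≤ ENNReal.ofReal (K * (1 / T)) := by
    refine (measure_le_lintegral_ofReal (f := fun ω => 1 / T / (1 - A ω)) (by fun_prop) ?_).trans ?_
    · filter_upwards [hIoo] with ω h0 (hω : T * (1 - A ω) < 1)
      rw [div_div, one_le_div (by positivity)]
      exact hω.le
    · rw [htrans (fun y => 1 / T / y) (by fun_prop)]
      refine (hν.lintegral_const_div_le (by positivity)).trans_eq ?_
      rw [mul_comm]
  have m2 : μ {ω | ∑ t ∈ Finset.Icc (2 : ℤ) T, innov B C η ξ t ω ^ 2 < (T : ℝ) / 8} ≤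
      ENNReal.ofReal (64 * L ^ 2 * (1 / T)) := by
    refine (h.measure_sum_innov_sq_lt_le hL hη hξ hT).trans_eq ?_
    congr 1; ring
  have m3 : μ {ω | T / 100 < |M ω|} ≤ ENNReal.ofReal (10000 * K * (1 / T)) := by
    refine (measure_le_lintegral_ofReal (f := fun ω => 10000 / T ^ 2 * M ω ^ 2)
      (by fun_prop) ?_).trans ?_
    · refine ae_of_all _ fun ω (hω : T / 100 < |M ω|) => ?_
      have h1 : (T / 100) ^ 2 ≤ M ω ^ 2 := by
        rw [← sq_abs (M ω)]; exact pow_le_pow_left₀ (by positivity) hω.le 2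
      calc (1 : ℝ) = 10000 / T ^ 2 * (T / 100) ^ 2 := by field_simp; norm_num
        _ ≤ _ := by gcongr
    · refine (h.lintegral_mul_mart_sq_le (w := fun _ => 10000 / (T : ℝ) ^ 2) (by fun_prop)
        (fun _ => by positivity) T).trans ?_
      rw [htrans (fun y => 10000 / (T : ℝ) ^ 2 * (T / y)) (by fun_prop)]
      have e : ∀ y : ℝ, 10000 / (T : ℝ) ^ 2 * (T / y) = 10000 / T / y := fun y => by field_simp
      simp_rw [e]
      refine (hν.lintegral_const_div_le (by positivity)).trans_eq ?_
      congr 1; ring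
  have m4 : μ {ω | (1 - A ω) / 1000 < H ω} ≤ ENNReal.ofReal (3000 * K * (1 / T)) := by
    refine (measure_le_lintegral_ofReal (f := fun ω => |1000 / (1 - A ω)| * H ω)
      (by fun_prop) ?_).trans ?_
    · filter_upwards [hIoo] with ω h0 (hω : (1 - A ω) / 1000 < H ω)
      rw [abs_of_pos (by positivity)]
      calc (1 : ℝ) = 1000 / (1 - A ω) * ((1 - A ω) / 1000) := by field_simp
        _ ≤ _ := by gcongr
    · refine (h.lintegral_mul_endErr_le (w := fun y => |1000 / y|) (by fun_prop)
        (fun _ => abs_nonneg _) hT).trans ?_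
      rw [htrans (fun y => 3 / T * |1000 / y|) (by fun_prop)]
      have e : ∀ᵐ y ∂ν, ENNReal.ofReal (3 / T * |1000 / y|) = ENNReal.ofReal (3000 / T / y) := by
        filter_upwards [hν.ae_mem] with y hy
        have hy0 := hy.1
        rw [abs_of_pos (by positivity)]
        congr 1
        field_simp
        norm_num
      rw [lintegral_congr_ae e]
      refine (hν.lintegral_const_div_le (by positivity)).trans_eq ?_
      congr 1; ring
  -- coefficients close to the level
  have m5 : μ {ω | |1 - A ω - u| ≤ δ / q} ≤ ENNReal.ofReal (3 * K * 4 ^ β * (δ ^ β / q)) := by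
    refine le_trans (le_of_eq ?_) (hν.measure_window_le hu hδ hδ' hq1)
    rw [hνdef, Measure.map_apply hy (measurableSet_le (by fun_prop) measurable_const)]
    rfl
  -- each of the two parts of the error, `25 (1 - A) |M| / T` and `250 H`, may use up half of the
  -- distance from the level
  have m6 : μ {ω | 1 - A ω ∈ W ∧ |1 - A ω - u| ≤ 50 * (1 - A ω) * |M ω| / T} ≤
      ENNReal.ofReal (20000 * K * 4 ^ β * (δ ^ β / q) + 10000 * K * (1 / T)) := by
    set w : ℝ → ℝ := W.indicator fun y => 2500 * y ^ 2 / (T ^ 2 * (y - u) ^ 2) with hw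
    have hwm : Measurable w := Measurable.indicator (by fun_prop) hWm
    have hw0 : ∀ y, 0 ≤ w y := fun y => Set.indicator_nonneg (fun y _ => by positivity) y
    refine (measure_le_lintegral_ofReal (f := fun ω => w (1 - A ω) * M ω ^ 2)
      (by fun_prop) ?_).trans ?_
    · filter_upwards [hIoo] with ω h0 hω
      obtain ⟨h1, h2⟩ := hω
      have h3 : 0 < |1 - A ω - u| := lt_trans (by positivity) h1
      rw [hw, Set.indicator_of_mem h1, ← sq_abs (1 - A ω - u), div_mul_eq_mul_div,
        one_le_div (by positivity)]
      rw [le_div_iff₀ hTp] at h2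
      calc T ^ 2 * |1 - A ω - u| ^ 2 = (|1 - A ω - u| * T) ^ 2 := by ring
        _ ≤ (50 * (1 - A ω) * |M ω|) ^ 2 := pow_le_pow_left₀ (by positivity) h2 2
        _ = 2500 * (1 - A ω) ^ 2 * M ω ^ 2 := by rw [mul_pow, mul_pow, sq_abs]; ring
    · refine (h.lintegral_mul_mart_sq_le hwm hw0 T).trans ?_
      rw [htrans (fun y => w y * (T / y)) (by fun_prop)]
      refine (lintegral_mono_ae ?_).trans (hν.lintegral_window_sq_le hu hδ hδ' hq1 hTp hqT)
      filter_upwards [hν.ae_mem] with y hy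
      have hy0 := hy.1
      refine ENNReal.ofReal_le_ofReal (le_of_eq ?_)
      by_cases hyW : y ∈ W
      · have h3 : (0 : ℝ) < (y - u) ^ 2 := by
          have := abs_pos.1 (lt_trans (by positivity : 0 < δ / q) hyW)
          positivity
        rw [hw, Set.indicator_of_mem hyW, Set.indicator_of_mem hyW]
        field_simp
      · rw [hw, Set.indicator_of_notMem hyW, Set.indicator_of_notMem hyW, zero_mul]
  have m7 : μ {ω | 1 - A ω ∈ W ∧ |1 - A ω - u| ≤ 500 * H ω} ≤
      ENNReal.ofReal (1500 * K * 4 ^ β * (δ ^ β / q) + 3000 * K * (1 / T)) := by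
    set w : ℝ → ℝ := W.indicator fun y => 500 / |y - u| with hw
    have hwm : Measurable w := Measurable.indicator (by fun_prop) hWm
    have hw0 : ∀ y, 0 ≤ w y := fun y => Set.indicator_nonneg (fun y _ => by positivity) y
    refine (measure_le_lintegral_ofReal (f := fun ω => w (1 - A ω) * H ω)
      (by fun_prop) ?_).trans ?_
    · filter_upwards [hIoo] with ω h0 hω
      obtain ⟨h1, h2⟩ := hω
      have h3 : 0 < |1 - A ω - u| := lt_trans (by positivity) h1
      rw [hw, Set.indicator_of_mem h1, div_mul_eq_mul_div, one_le_div h3]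
      exact h2
    · refine (h.lintegral_mul_endErr_le hwm hw0 hT).trans ?_
      rw [htrans (fun y => 3 / T * w y) (by fun_prop)]
      exact hν.lintegral_window_le hu hδ hδ' hq1 hTp hqT
  have hcover : μ {ω | ¬ (1 - u < A ω ↔ 1 - u < sampleAutocorr (fun t => X t ω) T)} ≤
      μ ({ω | T * (1 - A ω) < 1} ∪
      ({ω | ∑ t ∈ Finset.Icc (2 : ℤ) T, innov B C η ξ t ω ^ 2 < (T : ℝ) / 8} ∪
      ({ω | T / 100 < |M ω|} ∪ ({ω | (1 - A ω) / 1000 < H ω} ∪ ({ω | |1 - A ω - u| ≤ δ / q} ∪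
      ({ω | 1 - A ω ∈ W ∧ |1 - A ω - u| ≤ 50 * (1 - A ω) * |M ω| / T} ∪
        {ω | 1 - A ω ∈ W ∧ |1 - A ω - u| ≤ 500 * H ω})))))) := by
    refine measure_mono_ae ?_
    filter_upwards [h.ae_abs_sampleAutocorr_sub_le hT] with ω hω hmis
    by_contra hcon
    change ω ∉ (_ ∪ _ : Set Ω) at hcon
    simp only [Set.mem_union, Set.mem_ofPred_eq, not_or, not_lt, not_le, not_and] at hcon
    change ¬ (1 - u < A ω ↔ 1 - u < sampleAutocorr (fun t => X t ω) T) at hmis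
    obtain ⟨c1, c2, c3, c4, c5, c6, c7⟩ := hcon
    have h1 := hω c1 c2 c3 c4
    have h2 : 50 * (1 - A ω) * |M ω| / T < |1 - A ω - u| := c6 c5
    have h3 : 500 * H ω < |1 - A ω - u| := c7 c5
    have h4 : |1 - A ω - u| ≤ |sampleAutocorr (fun t => X t ω) T - A ω| := by
      rcases lt_or_ge (1 - u) (A ω) with ha | ha
      · have hb : sampleAutocorr (fun t => X t ω) T ≤ 1 - u := by
          by_contra hb
          exact hmis ⟨fun _ => not_le.1 hb, fun _ => ha⟩
        rw [abs_of_neg (by linarith), abs_of_neg (by linarith)]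
        linarith
      · have hb : 1 - u < sampleAutocorr (fun t => X t ω) T := by
          by_contra hb
          exact hmis ⟨fun hc => absurd hc (not_lt.2 ha), fun hc => absurd hc hb⟩
        rw [abs_of_nonneg (by linarith), abs_of_pos (by linarith)]
        linarith
    have h5 : 50 * (1 - A ω) * |M ω| / T = 50 * ((1 - A ω) * |M ω| / T) := by ring
    linarith
  refine hcover.trans ?_
  refine (measure_union_le_of_le m1 (measure_union_le_of_le m2 (measure_union_le_of_le m3
    (measure_union_le_of_le m4 (measure_union_le_of_le m5
      (measure_union_le_of_le m6 m7)))))).trans ?_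
  have h4 : (1 : ℝ) ≤ 4 ^ β := Real.one_le_rpow (by norm_num) (by linarith [hν.one_lt_beta])
  have s1 : (0 : ℝ) ≤ 1 / T := by positivity
  have s2 : 0 ≤ δ ^ β / q := by positivity
  have hK4 : K ≤ K * 4 ^ β := le_mul_of_one_le_right hK.le h4
  have p1 : K * (1 / T) ≤ K * 4 ^ β * (1 / T) := by gcongr
  have p2 : 0 ≤ L ^ 2 * (δ ^ β / q) := by positivity
  have p3 : 0 ≤ K * 4 ^ β * (δ ^ β / q) := by positivity
  have p4 : 0 ≤ K * (1 / T) := by positivity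
  have p5 : 0 ≤ L ^ 2 * (1 / T : ℝ) := by positivity
  rw [← ENNReal.ofReal_add (by positivity) (by positivity),
    ← ENNReal.ofReal_add (by positivity) (by positivity),
    ← ENNReal.ofReal_add (by positivity) (by positivity),
    ← ENNReal.ofReal_add (by positivity) (by positivity),
    ← ENNReal.ofReal_add (by positivity) (by positivity),
    ← ENNReal.ofReal_add (by positivity) (by positivity)]
  refine ENNReal.ofReal_le_ofReal ?_
  linarith

end UnitModel

end RCAR

/-! ### Moments of the log excess -/

namespace RCAR

/-- The positive part of `log (δ / y)`. -/
noncomputable def logExcess (δ y : ℝ) : ℝ := max (Real.log (δ / y)) 0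

lemma logExcess_nonneg (δ y : ℝ) : 0 ≤ logExcess δ y := le_max_right _ _

@[fun_prop]
lemma measurable_logExcess (δ : ℝ) : Measurable (logExcess δ) := by
  unfold logExcess
  fun_prop

lemma lt_logExcess_iff {δ y s : ℝ} (hδ : 0 < δ) (hy : 0 < y) (hs : 0 ≤ s) :
    s < logExcess δ y ↔ y < δ * Real.exp (-s) := by
  rw [logExcess, lt_max_iff, Real.lt_log_iff_exp_lt (by positivity), lt_div_iff₀ hy,
    Real.exp_neg, ← div_eq_mul_inv, lt_div_iff₀ (Real.exp_pos s), mul_comm y]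
  constructor
  · rintro (h | h)
    · exact h
    · exact absurd h (not_lt.2 hs)
  · exact Or.inl

lemma integrableOn_rpow_mul_exp_neg_mul {k b : ℝ} (hk : 0 < k) (hb : 0 < b) :
    IntegrableOn (fun s : ℝ => s ^ (k - 1) * Real.exp (-(b * s))) (Set.Ioi 0) := by
  have h := integrableOn_rpow_mul_exp_neg_mul_rpow (s := k - 1) (p := 1) (by linarith) one_pos hb
  simpa [neg_mul] using h

namespace TailBounds

variable {ν : Measure ℝ} [IsProbabilityMeasure ν] {β θ κ C u₀ : ℝ}

/-- All moments of the log excess are those of the exponential law with parameter `β`, up to the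
mass `κ δ ^ β` and an error of relative order `δ ^ θ`. -/
lemma integral_logExcess_rpow (h : TailBounds ν β θ κ C u₀) {k δ : ℝ} (hk : 0 < k) (hδ : 0 < δ)
    (hδu : δ ≤ u₀) :
    Integrable (fun y => logExcess δ y ^ k) ν ∧
    |∫ y, logExcess δ y ^ k ∂ν - κ * δ ^ β * (Real.Gamma (k + 1) / β ^ k)| ≤
      C * δ ^ (β + θ) * (Real.Gamma (k + 1) / (β + θ) ^ k) := by
  have hβ : 0 < β := by linarith [h.one_lt_beta]
  have hθ := h.theta_pos
  have hκ := h.kappa_pos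
  have hC := h.C_pos
  set F : ℝ → ℝ := fun s => s ^ (k - 1) * ν.real (Set.Iio (δ * Real.exp (-s))) with hF
  have hexp : ∀ b s : ℝ, (δ * Real.exp (-s)) ^ b = δ ^ b * Real.exp (-(b * s)) := fun b s => by
    rw [Real.mul_rpow hδ.le (Real.exp_pos _).le, ← Real.exp_mul]
    congr 2; ring
  have hbd : ∀ s ∈ Set.Ioi (0 : ℝ), |F s - κ * δ ^ β * (s ^ (k - 1) * Real.exp (-(β * s)))| ≤
      C * δ ^ (β + θ) * (s ^ (k - 1) * Real.exp (-((β + θ) * s))) := by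
    intro s hs
    have hs0 : 0 < s := hs
    have hle : δ * Real.exp (-s) ≤ u₀ :=
      (mul_le_of_le_one_right hδ.le (Real.exp_le_one_iff.2 (by linarith))).trans hδu
    have h1 := h.expansion (δ * Real.exp (-s)) (by positivity) hle
    rw [hexp, hexp] at h1
    have e1 : F s - κ * δ ^ β * (s ^ (k - 1) * Real.exp (-(β * s))) =
        s ^ (k - 1) * (ν.real (Set.Iio (δ * Real.exp (-s))) -
          κ * (δ ^ β * Real.exp (-(β * s)))) := by
      simp only [hF]; ring
    rw [e1, abs_mul, abs_of_nonneg (by positivity)]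
    calc _ ≤ s ^ (k - 1) * (C * (δ ^ (β + θ) * Real.exp (-((β + θ) * s)))) := by gcongr
      _ = _ := by ring
  have hmono : Antitone fun s : ℝ => ν.real (Set.Iio (δ * Real.exp (-s))) := fun s t hst =>
    measureReal_mono (Set.Iio_subset_Iio (by gcongr))
  have hFm : Measurable F := (by fun_prop : Measurable fun s : ℝ => s ^ (k - 1)).mul hmono.measurable
  have i1 := (integrableOn_rpow_mul_exp_neg_mul hk hβ).const_mul (κ * δ ^ β)
  have i2 := (integrableOn_rpow_mul_exp_neg_mul hk (by linarith : 0 < β + θ)).const_mul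
    (C * δ ^ (β + θ))
  have i3 : Integrable (fun s => F s - κ * δ ^ β * (s ^ (k - 1) * Real.exp (-(β * s))))
      (volume.restrict (Set.Ioi 0)) := by
    refine i2.mono' (hFm.aestronglyMeasurable.sub i1.aestronglyMeasurable) ?_
    filter_upwards [ae_restrict_mem measurableSet_Ioi] with s hs
    exact hbd s hs
  have iF : Integrable F (volume.restrict (Set.Ioi 0)) := by
    have := i3.add i1
    refine this.congr (ae_of_all _ fun s => ?_)
    simp
  have hF0 : ∀ s ∈ Set.Ioi (0 : ℝ), 0 ≤ F s := fun s hs => by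
    have : 0 < s := hs
    positivity
  have hlin : ∫⁻ y, ENNReal.ofReal (logExcess δ y ^ k) ∂ν =
      ENNReal.ofReal (k * ∫ s in Set.Ioi 0, F s) := by
    rw [lintegral_rpow_eq_lintegral_meas_lt_mul ν (ae_of_all _ (logExcess_nonneg δ))
      (by fun_prop) hk, ENNReal.ofReal_mul hk.le, ofReal_integral_eq_lintegral_ofReal iF
      ((ae_restrict_mem measurableSet_Ioi).mono hF0)]
    congr 1
    refine setLIntegral_congr_fun measurableSet_Ioi fun s hs => ?_
    have hs0 : 0 < s := hs
    have e1 : ν {y | s < logExcess δ y} = ν (Set.Iio (δ * Real.exp (-s))) := by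
      refine measure_congr ?_
      filter_upwards [h.ae_mem] with y hy
      exact propext (lt_logExcess_iff hδ hy.1 hs0.le)
    simp only [e1, hF]
    rw [mul_comm, ENNReal.ofReal_mul (by positivity), ofReal_measureReal]
  have hmeas : AEStronglyMeasurable (fun y => logExcess δ y ^ k) ν :=
    ((measurable_logExcess δ).pow_const k).aestronglyMeasurable
  have hint : Integrable (fun y => logExcess δ y ^ k) ν := by
    refine ⟨hmeas, ?_⟩
    rw [hasFiniteIntegral_iff_ofReal
      (ae_of_all _ fun y => Real.rpow_nonneg (logExcess_nonneg δ y) k), hlin]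
    exact ENNReal.ofReal_lt_top
  refine ⟨hint, ?_⟩
  have hval : ∫ y, logExcess δ y ^ k ∂ν = k * ∫ s in Set.Ioi 0, F s := by
    rw [integral_eq_lintegral_of_nonneg_ae
      (ae_of_all _ fun y => Real.rpow_nonneg (logExcess_nonneg δ y) k) hmeas, hlin,
      ENNReal.toReal_ofReal]
    exact mul_nonneg hk.le (setIntegral_nonneg measurableSet_Ioi hF0)
  have hgam : ∀ b : ℝ, 0 < b → k * ∫ s in Set.Ioi (0 : ℝ), s ^ (k - 1) * Real.exp (-(b * s)) =
      Real.Gamma (k + 1) / b ^ k := fun b hb => by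
    rw [Real.integral_rpow_mul_exp_neg_mul_Ioi hk hb, Real.Gamma_add_one hk.ne', one_div,
      Real.inv_rpow hb.le]
    ring
  have e1 : ∫ y, logExcess δ y ^ k ∂ν - κ * δ ^ β * (Real.Gamma (k + 1) / β ^ k) =
      k * ∫ s in Set.Ioi 0, (F s - κ * δ ^ β * (s ^ (k - 1) * Real.exp (-(β * s)))) := by
    rw [integral_sub iF i1, integral_const_mul, hval, ← hgam β hβ]
    ring
  rw [e1, abs_mul, abs_of_pos hk]
  calc k * |∫ s in Set.Ioi 0, (F s - κ * δ ^ β * (s ^ (k - 1) * Real.exp (-(β * s))))| ≤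
      k * ∫ s in Set.Ioi 0, C * δ ^ (β + θ) * (s ^ (k - 1) * Real.exp (-((β + θ) * s))) := by
        gcongr
        rw [← Real.norm_eq_abs]
        refine norm_integral_le_of_norm_le i2 ?_
        filter_upwards [ae_restrict_mem measurableSet_Ioi] with s hs
        exact hbd s hs
    _ = C * δ ^ (β + θ) * (k * ∫ s in Set.Ioi (0 : ℝ),
        s ^ (k - 1) * Real.exp (-((β + θ) * s))) := by rw [integral_const_mul]; ring
    _ = _ := by rw [hgam _ (by linarith)]

/-- Integer moments of the log excess. -/
lemma exists_integral_logExcess_pow (h : TailBounds ν β θ κ C u₀) (k : ℕ) (hk : 0 < k) :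
    ∃ D, 0 < D ∧ ∀ δ, 0 < δ → δ ≤ u₀ → Integrable (fun y => logExcess δ y ^ k) ν ∧
      |∫ y, logExcess δ y ^ k ∂ν - κ * δ ^ β * (k.factorial / β ^ k)| ≤ D * δ ^ (β + θ) := by
  have hβ : 0 < β := by linarith [h.one_lt_beta]
  have hθ := h.theta_pos
  have hC := h.C_pos
  have hG : 0 < Real.Gamma (k + 1) := Real.Gamma_pos_of_pos (by positivity)
  refine ⟨C * (Real.Gamma (k + 1) / (β + θ) ^ (k : ℝ)), by positivity, fun δ hδ hδu => ?_⟩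
  have h1 := h.integral_logExcess_rpow (k := k) (by exact_mod_cast hk) hδ hδu
  simp only [Real.rpow_natCast, Real.Gamma_nat_eq_factorial] at h1 ⊢
  refine ⟨h1.1, h1.2.trans_eq (by ring)⟩

end TailBounds

/-! ### A central limit theorem for triangular arrays -/

lemma norm_exp_I_sub_taylor_le (x : ℝ) :
    ‖Complex.exp (x * Complex.I) - (1 + x * Complex.I - x ^ 2 / 2)‖ ≤ 4 * |x| ^ 3 := by
  have hn : ‖(x : ℂ) * Complex.I‖ = |x| := by simp
  rcases le_or_gt |x| 1 with h | h
  · have h1 := Complex.exp_bound (x := x * Complex.I) (by rw [hn]; exact h) (n := 3) (by norm_num)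
    have h2 : ∑ m ∈ Finset.range 3, ((x : ℂ) * Complex.I) ^ m / m.factorial =
        1 + x * Complex.I - x ^ 2 / 2 := by
      simp [Finset.sum_range_succ, Nat.factorial, mul_pow]
      ring
    rw [h2, hn] at h1
    refine h1.trans ?_
    have : (0 : ℝ) ≤ |x| ^ 3 := by positivity
    norm_num [Nat.factorial]
    linarith
  · have h1 : ‖Complex.exp (x * Complex.I) - (1 + x * Complex.I - x ^ 2 / 2)‖ ≤
        1 + (1 + |x| + |x| ^ 2 / 2) := by
      refine (norm_sub_le _ _).trans (add_le_add (Complex.norm_exp_ofReal_mul_I x).le ?_)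
      refine (norm_sub_le _ _).trans (add_le_add ((norm_add_le _ _).trans ?_) ?_)
      · rw [hn, norm_one]
      · simp
    have h2 : |x| ≤ |x| ^ 3 := le_self_pow₀ h.le (by norm_num)
    have h3 : |x| ^ 2 ≤ |x| ^ 3 := pow_le_pow_right₀ h.le (by norm_num)
    linarith

variable {Ω : Type*} [MeasurableSpace Ω] {μ : Measure Ω}

/-- Central limit theorem for a triangular array whose rows are i.i.d., under a Lyapunov
condition of order three. -/
lemma tendstoInDistribution_sum_of_lyapunov [IsProbabilityMeasure μ] {ν : Measure ℝ}
    [IsProbabilityMeasure ν] {Y : ℕ → Ω → ℝ} (hYm : ∀ i, Measurable (Y i)) (hind : iIndepFun Y μ)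
    (hlaw : ∀ i, μ.map (Y i) = ν) {f : ℕ → ℝ → ℝ} (hf : ∀ n, Measurable (f n))
    (hint : ∀ᶠ n in atTop, Integrable (fun y => |f n y| ^ 3) ν) {v : ℝ} (hv : 0 ≤ v)
    (h1 : Tendsto (fun n : ℕ => n * ∫ y, f n y ∂ν) atTop (𝓝 0))
    (h2 : Tendsto (fun n : ℕ => n * ∫ y, f n y ^ 2 ∂ν) atTop (𝓝 v))
    (h3 : Tendsto (fun n : ℕ => n * ∫ y, |f n y| ^ 3 ∂ν) atTop (𝓝 0)) :
    TendstoInDistribution (fun (n : ℕ) ω => ∑ i ∈ Finset.range n, f n (Y i ω)) atTop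
      (id : ℝ → ℝ) (fun _ => μ) (gaussianReal 0 v.toNNReal) where
  forall_aemeasurable n :=
    (Finset.measurable_sum _ fun i _ => (hf n).comp (hYm i)).aemeasurable
  tendsto := by
    refine ProbabilityMeasure.tendsto_iff_tendsto_charFun.2 fun t => ?_
    have e1 : ∀ n : ℕ, charFun (μ.map fun ω => ∑ i ∈ Finset.range n, f n (Y i ω)) t =
        (1 + (charFun (ν.map (f n)) t - 1)) ^ n := by
      intro n
      have hind' : iIndepFun (fun i ω => f n (Y i ω)) μ := hind.comp (fun _ => f n) fun _ => hf n
      rw [iIndepFun.charFun_map_fun_finsetSum_eq_prod (X := fun i ω => f n (Y i ω))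
        (fun i _ => ((hf n).comp (hYm i)).aemeasurable) (hind'.restrict _), Finset.prod_apply]
      have e2 : ∀ i, μ.map (fun ω => f n (Y i ω)) = ν.map (f n) := fun i => by
        rw [← hlaw i, Measure.map_map (hf n) (hYm i)]
        rfl
      simp [e2]
    have e3 : charFun ((gaussianReal 0 v.toNNReal).map (id : ℝ → ℝ)) t =
        Complex.exp (-(v * t ^ 2 / 2)) := by
      rw [Measure.map_id, charFun_gaussianReal]
      simp [Real.coe_toNNReal v hv]
    simp only [ProbabilityMeasure.coe_mk]
    rw [e3]
    simp_rw [e1]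
    refine Complex.tendsto_one_add_pow_exp_of_tendsto ?_
    -- second order expansion of the characteristic function of one summand
    have hlim : Tendsto (fun n : ℕ => (t : ℂ) * Complex.I * ((n * ∫ y, f n y ∂ν : ℝ) : ℂ) -
        t ^ 2 / 2 * ((n * ∫ y, f n y ^ 2 ∂ν : ℝ) : ℂ)) atTop
        (𝓝 (-((v : ℂ) * (t : ℂ) ^ 2 / 2))) := by
      have a1 := ((Complex.continuous_ofReal.tendsto _).comp h1).const_mul ((t : ℂ) * Complex.I)
      have a2 := ((Complex.continuous_ofReal.tendsto _).comp h2).const_mul ((t : ℂ) ^ 2 / 2)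
      have a3 := a1.sub a2
      have e4 : (t : ℂ) * Complex.I * ((0 : ℝ) : ℂ) - (t : ℂ) ^ 2 / 2 * (v : ℂ) =
          -(v * t ^ 2 / 2) := by
        rw [Complex.ofReal_zero]; ring
      rw [e4] at a3
      exact a3
    refine (tendsto_iff_of_dist ?_).1 hlim
    have hzero : Tendsto (fun n : ℕ => 4 * |t| ^ 3 * (n * ∫ y, |f n y| ^ 3 ∂ν)) atTop (𝓝 0) := by
      simpa using h3.const_mul (4 * |t| ^ 3)
    refine squeeze_zero' (Eventually.of_forall fun _ => dist_nonneg) ?_ hzero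
    filter_upwards [hint] with n hn
    have hL3 : MemLp (f n) 3 ν := by
      rw [← integrable_norm_rpow_iff (hf n).aestronglyMeasurable (by norm_num) (by norm_num)]
      refine hn.congr (ae_of_all _ fun y => ?_)
      simp only [Real.norm_eq_abs]
      norm_cast
    have i1 : Integrable (f n) ν := hL3.integrable (by norm_num)
    have i2 : Integrable (fun y => f n y ^ 2) ν := (hL3.mono_exponent (by norm_num)).integrable_sq
    have hexp : charFun (ν.map (f n)) t = ∫ y, Complex.exp (((t * f n y : ℝ) : ℂ) * Complex.I) ∂ν := by
      rw [charFun_apply_real, integral_map (hf n).aemeasurable (by fun_prop)]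
      simp
    have iexp : Integrable (fun y => Complex.exp (((t * f n y : ℝ) : ℂ) * Complex.I)) ν := by
      refine Integrable.of_bound (by have := hf n; fun_prop) 1 (ae_of_all _ fun y => ?_)
      rw [Complex.norm_exp_ofReal_mul_I]
    have ipoly : Integrable (fun y => (1 : ℂ) + ((t * f n y : ℝ) : ℂ) * Complex.I -
        ((t * f n y : ℝ) : ℂ) ^ 2 / 2) ν := by
      refine ((integrable_const _).add ((i1.const_mul t).ofReal.mul_const Complex.I)).sub ?_
      refine Integrable.div_const ?_ 2
      have i4 : Integrable (fun y => ((t ^ 2 * f n y ^ 2 : ℝ) : ℂ)) ν :=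
        (i2.const_mul (t ^ 2)).ofReal
      refine i4.congr (ae_of_all _ fun y => ?_)
      push_cast
      ring
    have hpoly : ∫ y, ((1 : ℂ) + ((t * f n y : ℝ) : ℂ) * Complex.I -
        ((t * f n y : ℝ) : ℂ) ^ 2 / 2) ∂ν =
        1 + t * Complex.I * ((∫ y, f n y ∂ν : ℝ) : ℂ) -
          t ^ 2 / 2 * ((∫ y, f n y ^ 2 ∂ν : ℝ) : ℂ) := by
      have j1 : Integrable (fun y => (t : ℂ) * Complex.I * ((f n y : ℝ) : ℂ)) ν :=
        i1.ofReal.const_mul _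
      have j2 : Integrable (fun y => (t : ℂ) ^ 2 / 2 * ((f n y ^ 2 : ℝ) : ℂ)) ν :=
        i2.ofReal.const_mul _
      have j0 : Integrable (fun _ : ℝ => (1 : ℂ)) ν := integrable_const _
      have e5 : ∀ y, (1 : ℂ) + ((t * f n y : ℝ) : ℂ) * Complex.I -
          ((t * f n y : ℝ) : ℂ) ^ 2 / 2 = 1 + t * Complex.I * ((f n y : ℝ) : ℂ) -
          t ^ 2 / 2 * ((f n y ^ 2 : ℝ) : ℂ) := fun y => by push_cast; ring
      simp_rw [e5]
      have j01 : Integrable (fun y => (1 : ℂ) + t * Complex.I * ((f n y : ℝ) : ℂ)) ν := j0.add j1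
      rw [integral_sub j01 j2, integral_add j0 j1, integral_const_mul, integral_const_mul,
        integral_complex_ofReal, integral_complex_ofReal]
      simp
    have hdiff : ‖charFun (ν.map (f n)) t - (1 + t * Complex.I * ((∫ y, f n y ∂ν : ℝ) : ℂ) -
          t ^ 2 / 2 * ((∫ y, f n y ^ 2 ∂ν : ℝ) : ℂ))‖ ≤ 4 * |t| ^ 3 * ∫ y, |f n y| ^ 3 ∂ν := by
      rw [hexp, ← hpoly, ← integral_sub iexp ipoly, ← integral_const_mul]
      refine norm_integral_le_of_norm_le (hn.const_mul _) (ae_of_all _ fun y => ?_)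
      refine (norm_exp_I_sub_taylor_le (t * f n y)).trans_eq ?_
      rw [abs_mul]
      ring
    rw [dist_comm, dist_eq_norm]
    have e6 : (n : ℂ) * (charFun (ν.map (f n)) t - 1) - ((t : ℂ) * Complex.I *
        ((n * ∫ y, f n y ∂ν : ℝ) : ℂ) - t ^ 2 / 2 * ((n * ∫ y, f n y ^ 2 ∂ν : ℝ) : ℂ)) =
        n * (charFun (ν.map (f n)) t - (1 + t * Complex.I * ((∫ y, f n y ∂ν : ℝ) : ℂ) -
          t ^ 2 / 2 * ((∫ y, f n y ^ 2 ∂ν : ℝ) : ℂ))) := by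
      push_cast
      ring
    rw [e6, norm_mul, Complex.norm_natCast]
    calc _ ≤ (n : ℝ) * (4 * |t| ^ 3 * ∫ y, |f n y| ^ 3 ∂ν) := by gcongr
      _ = _ := by ring

end RCAR

/-! ### Limit theorems for exact coefficients -/

namespace RCAR

variable {Ω : Type*} [MeasurableSpace Ω] {μ : Measure Ω}

lemma tendstoInMeasure_of_variance [IsProbabilityMeasure μ] {Z : ℕ → Ω → ℝ} {c : ℝ}
    (hZ : ∀ᶠ n in atTop, MemLp (Z n) 2 μ) (hmean : Tendsto (fun n => ∫ ω, Z n ω ∂μ) atTop (𝓝 c))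
    (hvar : Tendsto (fun n => Var[Z n; μ]) atTop (𝓝 0)) :
    TendstoInMeasure μ Z atTop fun _ => c := by
  rw [tendstoInMeasure_iff_norm]
  intro ε hε
  have h1 : Tendsto (fun n => ENNReal.ofReal (Var[Z n; μ] / (ε / 2) ^ 2)) atTop (𝓝 0) := by
    have := ENNReal.tendsto_ofReal (hvar.div_const ((ε / 2) ^ 2))
    simpa using this
  refine tendsto_of_tendsto_of_tendsto_of_le_of_le' tendsto_const_nhds h1
    (Eventually.of_forall fun _ => zero_le) ?_
  filter_upwards [hZ, Metric.tendsto_nhds.1 hmean (ε / 2) (by positivity)] with n hn hd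
  refine (measure_mono fun ω hω => ?_).trans (meas_ge_le_variance_div_sq hn (by positivity))
  have hω : ε ≤ ‖Z n ω - c‖ := hω
  rw [Real.dist_eq] at hd
  rw [Real.norm_eq_abs] at hω
  have h2 := abs_sub_le (Z n ω) (∫ ω, Z n ω ∂μ) c
  change ε / 2 ≤ |Z n ω - ∫ ω, Z n ω ∂μ|
  linarith

lemma tendstoInMeasure_of_lintegral_le {Z : ℕ → Ω → ℝ} {W : ℕ → Ω → ℝ}
    (hZ : ∀ n, Measurable (Z n)) (hW : ∀ n, Measurable (W n)) {ρ : ℕ → ℝ}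
    (hρ : Tendsto ρ atTop (𝓝 0))
    (h : ∀ᶠ n in atTop, ∫⁻ ω, ENNReal.ofReal |Z n ω - W n ω| ∂μ ≤ ENNReal.ofReal (ρ n)) :
    TendstoInMeasure μ (Z - W) atTop 0 := by
  refine tendstoInMeasure_of_tendsto_eLpNorm_of_ne_top one_ne_zero ENNReal.one_ne_top
    (fun n => ((hZ n).sub (hW n)).aestronglyMeasurable) aestronglyMeasurable_const ?_
  have h1 : Tendsto (fun n => ENNReal.ofReal (ρ n)) atTop (𝓝 0) := by
    simpa using ENNReal.tendsto_ofReal hρ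
  refine tendsto_of_tendsto_of_tendsto_of_le_of_le' tendsto_const_nhds h1
    (Eventually.of_forall fun _ => zero_le) ?_
  filter_upwards [h] with n hn
  refine le_trans (le_of_eq ?_) hn
  rw [eLpNorm_one_eq_lintegral_enorm]
  refine lintegral_congr fun ω => ?_
  change ‖Z n ω - W n ω - 0‖ₑ = _
  rw [sub_zero, ← ofReal_norm, Real.norm_eq_abs]

lemma logExcess_of_le {δ y : ℝ} (hδ : 0 < δ) (hy : δ ≤ y) : logExcess δ y = 0 := by
  have hy0 := hδ.trans_le hy
  exact max_eq_right (Real.log_nonpos (by positivity) ((div_le_one hy0).2 hy))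

lemma logExcess_of_ge {δ y : ℝ} (hy : 0 < y) (hyδ : y ≤ δ) :
    logExcess δ y = Real.log (δ / y) :=
  max_eq_left (Real.log_nonneg ((one_le_div hy).2 hyδ))

/-- The summand whose empirical sum governs the fluctuations of the tail index estimator: the
score of the exponential model for the log excesses over the threshold. -/
noncomputable def score (β δ y : ℝ) : ℝ := (Set.Iio δ).indicator 1 y - β * logExcess δ y

@[fun_prop]
lemma measurable_score (β δ : ℝ) : Measurable (score β δ) := by
  unfold score
  exact ((measurable_one.indicator measurableSet_Iio)).sub ((measurable_logExcess δ).const_mul β)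

lemma score_sq {β δ : ℝ} (hδ : 0 < δ) (y : ℝ) : score β δ y ^ 2 =
    (Set.Iio δ).indicator 1 y - 2 * β * logExcess δ y + β ^ 2 * logExcess δ y ^ 2 := by
  rcases lt_or_ge y δ with h | h
  · have h' : y ∈ Set.Iio δ := h
    rw [score, Set.indicator_of_mem h', Pi.one_apply]
    ring
  · have h' : y ∉ Set.Iio δ := not_lt.2 h
    rw [score, Set.indicator_of_notMem h', logExcess_of_le hδ h]
    ring

lemma abs_score_pow_three_le {β : ℝ} (hβ : 0 ≤ β) (δ y : ℝ) : |score β δ y| ^ 3 ≤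
    4 * (Set.Iio δ).indicator 1 y + 4 * β ^ 3 * logExcess δ y ^ 3 := by
  have h0 := mul_nonneg hβ (logExcess_nonneg δ y)
  set l := β * logExcess δ y with hl
  have e : β ^ 3 * logExcess δ y ^ 3 = l ^ 3 := by rw [hl]; ring
  rw [mul_assoc, e, score, ← hl]
  have key : ∀ x : ℝ, 0 ≤ x → |x - l| ^ 3 ≤ 4 * x ^ 3 + 4 * l ^ 3 := fun x hx => by
    have h1 : |x - l| ≤ x + l := abs_le.2 ⟨by linarith, by linarith⟩
    have h2 : |x - l| ^ 3 ≤ (x + l) ^ 3 := by gcongr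
    nlinarith [mul_nonneg (add_nonneg hx h0) (sq_nonneg (x - l))]
  by_cases h : y ∈ Set.Iio δ
  · rw [Set.indicator_of_mem h, Pi.one_apply]
    simpa using key 1 zero_le_one
  · rw [Set.indicator_of_notMem h]
    simpa using key 0 le_rfl

namespace TailBounds

variable {ν : Measure ℝ} {β θ κ C u₀ : ℝ} {δ : ℕ → ℝ}

lemma tendsto_div_rpow (h : TailBounds ν β θ κ C u₀) (hδ_pos : ∀ n, 0 < δ n)
    (hδ : Tendsto δ atTop (𝓝 0)) {m : ℝ → ℝ} {q D : ℝ}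
    (hm : ∀ u, 0 < u → u ≤ u₀ → |m u - q * u ^ β| ≤ D * u ^ (β + θ)) :
    Tendsto (fun n => m (δ n) / δ n ^ β) atTop (𝓝 q) := by
  have hz : Tendsto (fun n => D * δ n ^ θ) atTop (𝓝 0) := by
    have h1 : Tendsto (fun u : ℝ => u ^ θ) (𝓝 0) (𝓝 (0 ^ θ)) :=
      (Real.continuousAt_rpow_const 0 θ (Or.inr h.theta_pos.le)).tendsto
    rw [Real.zero_rpow h.theta_pos.ne'] at h1
    simpa using (h1.comp hδ).const_mul D
  rw [tendsto_iff_dist_tendsto_zero]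
  refine squeeze_zero' (Eventually.of_forall fun _ => dist_nonneg) ?_ hz
  filter_upwards [hδ.eventually_le_const h.u₀_pos] with n hn
  have hp := hδ_pos n
  have hb : 0 < δ n ^ β := by positivity
  rw [Real.dist_eq]
  have e1 : m (δ n) / δ n ^ β - q = (m (δ n) - q * δ n ^ β) / δ n ^ β := by field_simp
  rw [e1, abs_div, abs_of_pos hb, div_le_iff₀ hb, mul_assoc, ← Real.rpow_add hp, add_comm θ]
  exact hm _ hp hn

lemma integral_indicator_Iio (s : ℝ) :
    ∫ y, (Set.Iio s).indicator (1 : ℝ → ℝ) y ∂ν = ν.real (Set.Iio s) :=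
  integral_indicator_one measurableSet_Iio

variable [IsProbabilityMeasure ν]

lemma integrable_indicator (s : ℝ) : Integrable ((Set.Iio s).indicator (1 : ℝ → ℝ)) ν :=
  (integrable_const (1 : ℝ)).indicator measurableSet_Iio

/-- Central limit theorem for the sums of the scores. The bias is negligible because
`N δ ^ (β + 2 θ) → 0`; the variance is `κ - 2 κ + 2 κ`. -/
lemma tendstoInDistribution_sum_score [IsProbabilityMeasure μ] (h : TailBounds ν β θ κ C u₀)
    {Y : ℕ → Ω → ℝ} (hYm : ∀ i, Measurable (Y i)) (hind : iIndepFun Y μ)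
    (hlaw : ∀ i, μ.map (Y i) = ν) (hδ_pos : ∀ n, 0 < δ n) (hδ : Tendsto δ atTop (𝓝 0))
    (hlarge : Tendsto (fun n : ℕ => (n : ℝ) * δ n ^ β) atTop atTop)
    (hsmall : Tendsto (fun n : ℕ => (n : ℝ) * δ n ^ (β + 2 * θ)) atTop (𝓝 0)) :
    TendstoInDistribution
      (fun (n : ℕ) ω => ∑ i ∈ Finset.range n, score β (δ n) (Y i ω) / √(n * δ n ^ β)) atTop
      (id : ℝ → ℝ) (fun _ => μ) (gaussianReal 0 κ.toNNReal) := by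
  have hβ : 0 < β := by linarith [h.one_lt_beta]
  have hκ := h.kappa_pos
  obtain ⟨D₁, hD₁, H1⟩ := h.exists_integral_logExcess_pow 1 one_pos
  obtain ⟨D₂, hD₂, H2⟩ := h.exists_integral_logExcess_pow 2 two_pos
  obtain ⟨D₃, hD₃, H3⟩ := h.exists_integral_logExcess_pow 3 three_pos
  simp only [pow_one, Nat.factorial_one, Nat.cast_one] at H1
  have I0 : ∀ s, Integrable ((Set.Iio s).indicator (1 : ℝ → ℝ)) ν := fun s =>
    integrable_indicator s
  have hu : ∀ᶠ n in atTop, δ n ≤ u₀ := hδ.eventually_le_const h.u₀_pos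
  have hpos : ∀ᶠ n : ℕ in atTop, 0 < (n : ℝ) * δ n ^ β := hlarge.eventually_gt_atTop 0
  have L0 := h.tendsto_div_rpow hδ_pos hδ (m := fun u => ν.real (Set.Iio u)) h.expansion
  have L1 := h.tendsto_div_rpow hδ_pos hδ (m := fun u => ∫ y, logExcess u y ∂ν)
    (q := κ * (1 / β)) (D := D₁) fun u hu huu => by
      have := (H1 u hu huu).2
      rwa [mul_right_comm] at this
  have L2 := h.tendsto_div_rpow hδ_pos hδ (m := fun u => ∫ y, logExcess u y ^ 2 ∂ν)
    (q := κ * ((Nat.factorial 2 : ℕ) / β ^ 2)) (D := D₂) fun u hu huu => by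
      have := (H2 u hu huu).2
      rwa [mul_right_comm] at this
  have L3 := h.tendsto_div_rpow hδ_pos hδ (m := fun u => ∫ y, logExcess u y ^ 3 ∂ν)
    (q := κ * ((Nat.factorial 3 : ℕ) / β ^ 3)) (D := D₃) fun u hu huu => by
      have := (H3 u hu huu).2
      rwa [mul_right_comm] at this
  refine tendstoInDistribution_sum_of_lyapunov (f := fun n y => score β (δ n) y / √(n * δ n ^ β))
    hYm hind hlaw (fun n => (measurable_score β _).div_const _) ?_ hκ.le ?_ ?_ ?_
  · filter_upwards [hu] with n hn
    refine ((I0 (δ n)).const_mul 4 |>.add (((H3 _ (hδ_pos n) hn).1).const_mul (4 * β ^ 3))).div_const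
      (√(n * δ n ^ β) ^ 3) |>.mono'
      ((((measurable_score β (δ n)).div_const _).norm.pow_const 3).aestronglyMeasurable)
      (ae_of_all _ fun y => ?_)
    simp only [Real.norm_eq_abs, abs_pow, abs_abs, abs_div, div_pow, Pi.add_apply,
      abs_of_nonneg (Real.sqrt_nonneg _)]
    gcongr
    exact abs_score_pow_three_le hβ.le _ _
  · -- the bias
    have hz : Tendsto (fun n : ℕ => (C + β * D₁) * √(n * δ n ^ (β + 2 * θ))) atTop (𝓝 0) := by
      have := ((Real.continuous_sqrt.tendsto 0).comp hsmall).const_mul (C + β * D₁)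
      simpa using this
    refine squeeze_zero_norm' ?_ hz
    filter_upwards [hu, hpos] with n hn hp
    have hd := hδ_pos n
    have e1 : ∫ y, score β (δ n) y / √(n * δ n ^ β) ∂ν = ((ν.real (Set.Iio (δ n)) - κ * δ n ^ β) -
        β * (∫ y, logExcess (δ n) y ∂ν - κ * δ n ^ β * (1 / β))) / √(n * δ n ^ β) := by
      rw [integral_div]
      congr 1
      simp only [score]
      rw [integral_sub (I0 _) ((H1 _ hd hn).1.const_mul β), integral_const_mul,
        integral_indicator_Iio]
      field_simp
      ring
    have hb : |(ν.real (Set.Iio (δ n)) - κ * δ n ^ β) -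
        β * (∫ y, logExcess (δ n) y ∂ν - κ * δ n ^ β * (1 / β))| ≤
        (C + β * D₁) * δ n ^ (β + θ) := by
      refine (abs_sub _ _).trans ?_
      rw [abs_mul, abs_of_pos hβ]
      have a1 := h.expansion _ hd hn
      have a2 : |∫ y, logExcess (δ n) y ∂ν - κ * δ n ^ β * (1 / β)| ≤ D₁ * δ n ^ (β + θ) := by
        simpa using (H1 _ hd hn).2
      have a3 := mul_le_mul_of_nonneg_left a2 hβ.le
      linarith
    have hs : 0 < √(n * δ n ^ β) := Real.sqrt_pos.2 hp
    have e2 : √((n : ℝ) * δ n ^ (β + 2 * θ)) * √(n * δ n ^ β) = n * δ n ^ (β + θ) := by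
      rw [← Real.sqrt_mul (by positivity)]
      have : (n : ℝ) * δ n ^ (β + 2 * θ) * (n * δ n ^ β) = (n * δ n ^ (β + θ)) ^ 2 := by
        have e3 : (δ n ^ (β + θ)) ^ 2 = δ n ^ (β + 2 * θ) * δ n ^ β := by
          rw [← Real.rpow_natCast, ← Real.rpow_mul hd.le, ← Real.rpow_add hd]
          congr 1
          push_cast
          ring
        rw [mul_pow, e3]
        ring
      rw [this, Real.sqrt_sq (by positivity)]
    rw [e1, Real.norm_eq_abs, abs_mul, Nat.abs_cast, abs_div, abs_of_pos hs, ← mul_div_assoc,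
      div_le_iff₀ hs, mul_assoc (C + β * D₁), e2]
    calc _ ≤ (n : ℝ) * ((C + β * D₁) * δ n ^ (β + θ)) := by gcongr
      _ = _ := by ring
  · -- the variance
    have hz := (L0.sub (L1.const_mul (2 * β))).add (L2.const_mul (β ^ 2))
    have e0 : κ - 2 * β * (κ * (1 / β)) + β ^ 2 * (κ * ((Nat.factorial 2 : ℕ) / β ^ 2)) = κ := by
      norm_num [Nat.factorial]
      field_simp
      ring
    rw [e0] at hz
    refine hz.congr' ?_
    filter_upwards [hu, hpos] with n hn hp
    have hd := hδ_pos n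
    have hn0 : (n : ℝ) ≠ 0 := by rintro h0; simp [h0] at hp
    have hb : δ n ^ β ≠ 0 := by positivity
    simp only [div_pow, Real.sq_sqrt hp.le, integral_div, score_sq hd]
    have i1 : Integrable (fun y => 2 * β * logExcess (δ n) y) ν := (H1 _ hd hn).1.const_mul _
    have i2 : Integrable (fun y => β ^ 2 * logExcess (δ n) y ^ 2) ν := (H2 _ hd hn).1.const_mul _
    have i3 : Integrable (fun y => (Set.Iio (δ n)).indicator (1 : ℝ → ℝ) y -
      2 * β * logExcess (δ n) y) ν := (I0 _).sub i1
    rw [integral_add i3 i2, integral_sub (I0 _) i1, integral_const_mul,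
      integral_const_mul, integral_indicator_Iio]
    field_simp
  · -- the Lyapunov ratio
    have hz : Tendsto (fun n : ℕ => (4 * (ν.real (Set.Iio (δ n)) / δ n ^ β) +
        4 * β ^ 3 * ((∫ y, logExcess (δ n) y ^ 3 ∂ν) / δ n ^ β)) * (√(n * δ n ^ β))⁻¹) atTop
        (𝓝 0) := by
      have hinv : Tendsto (fun n : ℕ => (√(n * δ n ^ β))⁻¹) atTop (𝓝 0) :=
        (Real.tendsto_sqrt_atTop.comp hlarge).inv_tendsto_atTop
      have := ((L0.const_mul 4).add (L3.const_mul (4 * β ^ 3))).mul hinv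
      rwa [mul_zero] at this
    refine squeeze_zero' (Eventually.of_forall fun n => by positivity) ?_ hz
    filter_upwards [hu, hpos] with n hn hp
    have hd := hδ_pos n
    have hs : 0 < √(n * δ n ^ β) := Real.sqrt_pos.2 hp
    have hn0 : (n : ℝ) ≠ 0 := by rintro h0; simp [h0] at hp
    have hb : δ n ^ β ≠ 0 := by positivity
    have i3 : Integrable (fun y => 4 * β ^ 3 * logExcess (δ n) y ^ 3) ν :=
      (H3 _ hd hn).1.const_mul _
    have i4 : Integrable (fun y => 4 * (Set.Iio (δ n)).indicator (1 : ℝ → ℝ) y) ν :=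
      (I0 _).const_mul 4
    have hle : ∫ y, |score β (δ n) y| ^ 3 ∂ν ≤
        4 * ν.real (Set.Iio (δ n)) + 4 * β ^ 3 * ∫ y, logExcess (δ n) y ^ 3 ∂ν := by
      rw [← integral_indicator_Iio, ← integral_const_mul, ← integral_const_mul,
        ← integral_add i4 i3]
      exact integral_mono_of_nonneg (ae_of_all _ fun y => by positivity) (i4.add i3)
        (ae_of_all _ fun y => abs_score_pow_three_le hβ.le _ _)
    simp only [abs_div, div_pow, integral_div, abs_of_pos hs]
    have e3 : √(n * δ n ^ β) ^ 3 = n * δ n ^ β * √(n * δ n ^ β) := by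
      rw [pow_succ, Real.sq_sqrt hp.le]
    rw [e3]
    calc _ ≤ (n : ℝ) * ((4 * ν.real (Set.Iio (δ n)) + 4 * β ^ 3 *
          ∫ y, logExcess (δ n) y ^ 3 ∂ν) / (n * δ n ^ β * √(n * δ n ^ β))) := by gcongr
      _ = _ := by field_simp

/-- Weak law of large numbers for the log excesses. -/
lemma tendstoInMeasure_sum_logExcess [IsProbabilityMeasure μ] (h : TailBounds ν β θ κ C u₀)
    {Y : ℕ → Ω → ℝ} (hYm : ∀ i, Measurable (Y i)) (hind : iIndepFun Y μ)
    (hlaw : ∀ i, μ.map (Y i) = ν) (hδ_pos : ∀ n, 0 < δ n) (hδ : Tendsto δ atTop (𝓝 0))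
    (hlarge : Tendsto (fun n : ℕ => (n : ℝ) * δ n ^ β) atTop atTop) :
    TendstoInMeasure μ
      (fun (n : ℕ) ω => (∑ i ∈ Finset.range n, logExcess (δ n) (Y i ω)) / (n * δ n ^ β)) atTop
      fun _ => κ / β := by
  obtain ⟨D₁, hD₁, H1⟩ := h.exists_integral_logExcess_pow 1 one_pos
  obtain ⟨D₂, hD₂, H2⟩ := h.exists_integral_logExcess_pow 2 two_pos
  simp only [pow_one, Nat.factorial_one, Nat.cast_one] at H1
  have hu : ∀ᶠ n in atTop, δ n ≤ u₀ := hδ.eventually_le_const h.u₀_pos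
  have hpos : ∀ᶠ n : ℕ in atTop, 0 < (n : ℝ) * δ n ^ β := hlarge.eventually_gt_atTop 0
  have L1 := h.tendsto_div_rpow hδ_pos hδ (m := fun u => ∫ y, logExcess u y ∂ν)
    (q := κ * (1 / β)) (D := D₁) fun u hu huu => by
      have := (H1 u hu huu).2
      rwa [mul_right_comm] at this
  have L2 := h.tendsto_div_rpow hδ_pos hδ (m := fun u => ∫ y, logExcess u y ^ 2 ∂ν)
    (q := κ * ((Nat.factorial 2 : ℕ) / β ^ 2)) (D := D₂) fun u hu huu => by
      have := (H2 u hu huu).2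
      rwa [mul_right_comm] at this
  have hMem : ∀ n, δ n ≤ u₀ → ∀ i, MemLp (fun ω => logExcess (δ n) (Y i ω)) 2 μ := by
    intro n hn i
    have h1 : MemLp (logExcess (δ n)) 2 (μ.map (Y i)) := by
      rw [hlaw i]
      exact (memLp_two_iff_integrable_sq (measurable_logExcess _).aestronglyMeasurable).2
        (H2 _ (hδ_pos n) hn).1
    exact h1.comp_measurePreserving ⟨hYm i, rfl⟩
  have hmap : ∀ (g : ℝ → ℝ), Measurable g → ∀ i, ∫ ω, g (Y i ω) ∂μ = ∫ y, g y ∂ν := by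
    intro g hg i
    rw [← hlaw i, integral_map (hYm i).aemeasurable hg.aestronglyMeasurable]
  refine tendstoInMeasure_of_variance ?_ ?_ ?_
  · filter_upwards [hu] with n hn
    have := (memLp_finsetSum (Finset.range n) fun i _ => hMem n hn i).mul_const (n * δ n ^ β)⁻¹
    exact this
  · rw [mul_one_div] at L1
    refine L1.congr' ?_
    filter_upwards [hu, hpos] with n hn hp
    have hn0 : (n : ℝ) ≠ 0 := by rintro h0; simp [h0] at hp
    rw [integral_div, integral_finsetSum _ fun i _ => (hMem n hn i).integrable one_le_two]
    simp only [hmap _ (measurable_logExcess _), Finset.sum_const, Finset.card_range, nsmul_eq_mul]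
    field_simp
  · have hz : Tendsto (fun n : ℕ => ((∫ y, logExcess (δ n) y ^ 2 ∂ν) / δ n ^ β) *
        (n * δ n ^ β)⁻¹) atTop (𝓝 0) := by
      have := L2.mul hlarge.inv_tendsto_atTop
      rwa [mul_zero] at this
    refine squeeze_zero' (Eventually.of_forall fun n => variance_nonneg _ _) ?_ hz
    filter_upwards [hu, hpos] with n hn hp
    have hn0 : (n : ℝ) ≠ 0 := by rintro h0; simp [h0] at hp
    have hb : δ n ^ β ≠ 0 := by have := hδ_pos n; positivity
    have e1 : (fun ω => (∑ i ∈ Finset.range n, logExcess (δ n) (Y i ω)) / (n * δ n ^ β)) =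
        fun ω => (n * δ n ^ β)⁻¹ * (∑ i ∈ Finset.range n, fun ω => logExcess (δ n) (Y i ω)) ω := by
      ext ω
      rw [Finset.sum_apply, div_eq_inv_mul]
    have hind' : iIndepFun (fun i ω => logExcess (δ n) (Y i ω)) μ :=
      hind.comp (fun _ => logExcess (δ n)) fun _ => measurable_logExcess _
    rw [e1, variance_const_mul, IndepFun.variance_sum (fun i _ => hMem n hn i)
      fun i _ j _ hij => hind'.indepFun hij]
    have hle : ∑ i ∈ Finset.range n, Var[fun ω => logExcess (δ n) (Y i ω); μ] ≤
        n * ∫ y, logExcess (δ n) y ^ 2 ∂ν := by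
      refine (Finset.sum_le_card_nsmul _ _ (∫ y, logExcess (δ n) y ^ 2 ∂ν) fun i _ => ?_).trans_eq
        (by simp)
      refine (variance_le_expectation_sq (hMem n hn i).1).trans_eq ?_
      exact hmap (fun y => logExcess (δ n) y ^ 2) (by fun_prop) i
    calc _ ≤ ((n * δ n ^ β)⁻¹) ^ 2 * (n * ∫ y, logExcess (δ n) y ^ 2 ∂ν) := by gcongr
      _ = _ := by field_simp

end TailBounds

end RCAR

/-! ### Truncation and estimation error of the log excess -/

namespace RCAR

/-- The summand of the denominator of `tailEstimator`: the log excess over the threshold of a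
truncated observation. -/
noncomputable def truncLog (δ r x : ℝ) : ℝ :=
  (Set.Ioi (1 - δ)).indicator (fun u => Real.log (δ / (1 - u))) (truncated δ r x)

lemma one_sub_truncated (δ r x : ℝ) : 1 - truncated δ r x = max (1 - x) (δ ^ r) := by
  rw [truncated, sub_inf, sub_sub_cancel]

lemma rpow_lt_self_of_one_lt {δ r : ℝ} (hδ : 0 < δ) (hδ1 : δ < 1) (hr : 1 < r) :
    δ ^ r < δ := by
  simpa using Real.rpow_lt_rpow_of_exponent_gt hδ hδ1 hr

lemma truncated_mem_Ioi_iff {δ r : ℝ} (hδ : 0 < δ) (hδ1 : δ < 1) (hr : 1 < r)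
    (x : ℝ) :
    truncated δ r x ∈ Set.Ioi (1 - δ) ↔ 1 - x ∈ Set.Iio δ := by
  have h := rpow_lt_self_of_one_lt hδ hδ1 hr
  rw [Set.mem_Ioi, Set.mem_Iio, sub_lt_comm, one_sub_truncated, max_lt_iff]
  exact and_iff_left h

lemma indicator_truncated {δ r : ℝ} (hδ : 0 < δ) (hδ1 : δ < 1) (hr : 1 < r)
    (x : ℝ) :
    (Set.Ioi (1 - δ)).indicator (fun _ => (1 : ℝ)) (truncated δ r x) =
      (Set.Iio δ).indicator 1 (1 - x) := by
  simp only [Set.indicator_apply, truncated_mem_Ioi_iff hδ hδ1 hr, Pi.one_apply]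

lemma truncLog_eq_log {δ r : ℝ} (hδ : 0 < δ) (hδ1 : δ < 1) (hr : 1 < r)
    (x : ℝ) :
    truncLog δ r x = Real.log (δ / min δ (max (1 - x) (δ ^ r))) := by
  have h := rpow_lt_self_of_one_lt hδ hδ1 hr
  rw [truncLog, Set.indicator_apply]
  simp only [truncated_mem_Ioi_iff hδ hδ1 hr, one_sub_truncated, Set.mem_Iio]
  split_ifs with h1
  · rw [min_eq_right (max_le h1.le h.le)]
  · rw [min_eq_left ((not_lt.1 h1).trans (le_max_left _ _)), div_self hδ.ne', Real.log_one]

/-- Truncation at level `1 - δ ^ r` removes the log excess over the higher threshold. -/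
lemma truncLog_eq_logExcess_sub {δ r : ℝ} (hδ : 0 < δ) (hδ1 : δ < 1) (hr : 1 < r)
    {x : ℝ} (hx : x < 1) :
    truncLog δ r x = logExcess δ (1 - x) - logExcess (δ ^ r) (1 - x) := by
  have h := rpow_lt_self_of_one_lt hδ hδ1 hr
  have hr0 : 0 < δ ^ r := by positivity
  have hy : 0 < 1 - x := by linarith
  rw [truncLog_eq_log hδ hδ1 hr]
  rcases le_total (1 - x) (δ ^ r) with h1 | h1
  · rw [max_eq_right h1, min_eq_right h.le, logExcess_of_ge hy (h1.trans h.le),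
      logExcess_of_ge hy h1, Real.log_div hδ.ne' hr0.ne', Real.log_div hδ.ne' hy.ne',
      Real.log_div hr0.ne' hy.ne']
    ring
  · rw [max_eq_left h1, logExcess_of_le hr0 h1, sub_zero]
    rcases le_total (1 - x) δ with h2 | h2
    · rw [min_eq_right h2, logExcess_of_ge hy h2]
    · rw [min_eq_left h2, logExcess_of_le hδ h2, div_self hδ.ne', Real.log_one]

@[fun_prop]
lemma measurable_truncLog (δ r : ℝ) : Measurable (truncLog δ r) := by
  unfold truncLog truncated
  refine Measurable.comp (g := (Set.Ioi (1 - δ)).indicator fun u => Real.log (δ / (1 - u))) ?_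
    (by fun_prop)
  exact Measurable.indicator (by fun_prop) measurableSet_Ioi

lemma lintegral_one_div_Ioc {s t : ℝ} (hs : 0 < s) (hst : s ≤ t) :
    ∫⁻ u in Set.Ioc s t, ENNReal.ofReal (1 / u) = ENNReal.ofReal (Real.log (t / s)) := by
  have hint : IntervalIntegrable (fun u : ℝ => 1 / u) volume s t :=
    (continuousOn_const.div continuousOn_id fun u hu => by
      rw [Set.uIcc_of_le hst] at hu
      exact (hs.trans_le hu.1).ne').intervalIntegrable
  rw [← integral_one_div_of_pos hs (hs.trans_le hst), intervalIntegral.integral_of_le hst,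
    ofReal_integral_eq_lintegral_ofReal hint.1]
  filter_upwards [ae_restrict_mem measurableSet_Ioc] with u hu
  have : 0 < u := hs.trans hu.1
  positivity

/-- The truncated log excess is an average over levels `1 - u` of exceedance indicators with
weight `1 / u`, so its error is controlled by the levels that separate the two arguments. -/
lemma ofReal_abs_truncLog_sub_le {δ r : ℝ} (hδ : 0 < δ) (hδ1 : δ < 1) (hr : 1 < r) (x x' : ℝ) :
    ENNReal.ofReal |truncLog δ r x - truncLog δ r x'| ≤
      ∫⁻ u in Set.Ioc (δ ^ r) δ, {u | ¬ (1 - u < x ↔ 1 - u < x')}.indicator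
        (fun u => ENNReal.ofReal (1 / u)) u := by
  have h := rpow_lt_self_of_one_lt hδ hδ1 hr
  have hr0 : 0 < δ ^ r := by positivity
  rw [truncLog_eq_log hδ hδ1 hr, truncLog_eq_log hδ hδ1 hr]
  wlog hle : min δ (max (1 - x') (δ ^ r)) ≤ min δ (max (1 - x) (δ ^ r)) generalizing x x' with H
  · have h1 := H x' x (not_le.1 hle).le
    have e : {u | ¬ (1 - u < x' ↔ 1 - u < x)} = {u | ¬ (1 - u < x ↔ 1 - u < x')} :=
      Set.ext fun u => not_congr Iff.comm
    rwa [abs_sub_comm, e] at h1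
  set m := min δ (max (1 - x) (δ ^ r)) with hm
  set m' := min δ (max (1 - x') (δ ^ r)) with hm'
  have hmp : 0 < m' := lt_min hδ (lt_max_of_lt_right hr0)
  have hrm : δ ^ r ≤ m' := le_min h.le (le_max_right _ _)
  have e1 : |Real.log (δ / m) - Real.log (δ / m')| = Real.log (m / m') := by
    rw [Real.log_div hδ.ne' (hmp.trans_le hle).ne', Real.log_div hδ.ne' hmp.ne',
      Real.log_div (hmp.trans_le hle).ne' hmp.ne', abs_sub_comm,
      abs_of_nonneg (by linarith [Real.log_le_log hmp hle])]
    ring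
  rw [e1, ← lintegral_one_div_Ioc hmp hle, ← lintegral_indicator measurableSet_Ioc,
    ← lintegral_indicator measurableSet_Ioc]
  refine lintegral_mono fun u => ?_
  by_cases hu : u ∈ Set.Ioc m' m
  · have h1 : u ≤ δ := hu.2.trans (min_le_left _ _)
    have h2 : u ∈ Set.Ioc (δ ^ r) δ := ⟨hrm.trans_lt hu.1, h1⟩
    have h3 : u ≤ 1 - x := (le_max_iff.1 (hu.2.trans (min_le_right _ _))).resolve_right
      (not_le.2 h2.1)
    have h4 : 1 - x' < u :=
      (max_lt_iff.1 ((min_lt_iff.1 hu.1).resolve_left (not_lt.2 h1))).1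
    have h5 : u ∈ {u | ¬ (1 - u < x ↔ 1 - u < x')} := by
      simp only [Set.mem_ofPred_eq]
      intro h6
      have := h6.2 (by linarith)
      linarith
    rw [Set.indicator_of_mem hu, Set.indicator_of_mem h2, Set.indicator_of_mem h5]
  · rw [Set.indicator_of_notMem hu]
    exact zero_le

variable {Ω : Type*} [MeasurableSpace Ω] {μ : Measure Ω}

lemma measurableSet_mismatch {A A' : Ω → ℝ} (hA : Measurable A) (hA' : Measurable A') :
    MeasurableSet {q : Ω × ℝ | ¬ (1 - q.2 < A' q.1 ↔ 1 - q.2 < A q.1)} := by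
  have h1 : MeasurableSet {q : Ω × ℝ | 1 - q.2 < A q.1} :=
    measurableSet_lt (by fun_prop) (by fun_prop)
  have h2 : MeasurableSet {q : Ω × ℝ | 1 - q.2 < A' q.1} :=
    measurableSet_lt (by fun_prop) (by fun_prop)
  exact (h2.iff h1).compl

lemma lintegral_abs_truncLog_sub_le [IsProbabilityMeasure μ] {δ r c : ℝ} (hδ : 0 < δ)
    (hδ1 : δ < 1) (hr : 1 < r) (hc : 0 ≤ c) {A A' : Ω → ℝ} (hA : Measurable A)
    (hA' : Measurable A')
    (h : ∀ u ≤ δ, μ {ω | ¬ (1 - u < A ω ↔ 1 - u < A' ω)} ≤ ENNReal.ofReal c) :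
    ∫⁻ ω, ENNReal.ofReal |truncLog δ r (A' ω) - truncLog δ r (A ω)| ∂μ ≤
      ENNReal.ofReal (c * ((r - 1) * -Real.log δ)) := by
  have hlt := rpow_lt_self_of_one_lt hδ hδ1 hr
  have hr0 : 0 < δ ^ r := by positivity
  refine (lintegral_mono fun ω => ofReal_abs_truncLog_sub_le hδ hδ1 hr (A' ω) (A ω)).trans ?_
  rw [lintegral_lintegral_swap]
  swap
  · refine Measurable.aemeasurable ?_
    have := (Measurable.indicator (f := fun q : Ω × ℝ => ENNReal.ofReal (1 / q.2)) (by fun_prop)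
      (measurableSet_mismatch hA hA'))
    exact this
  have hlog : Real.log (δ / δ ^ r) = (r - 1) * -Real.log δ := by
    rw [Real.log_div hδ.ne' hr0.ne', Real.log_rpow hδ]; ring
  calc _ ≤ ∫⁻ u in Set.Ioc (δ ^ r) δ, ENNReal.ofReal c * ENNReal.ofReal (1 / u) := by
        refine setLIntegral_mono_ae' measurableSet_Ioc (ae_of_all _ fun u hu => ?_)
        have hset : MeasurableSet {ω | ¬ (1 - u < A' ω ↔ 1 - u < A ω)} :=
          (measurableSet_mismatch hA hA').preimage (measurable_id.prodMk measurable_const)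
        have e1 : ∀ ω, {u | ¬ (1 - u < A' ω ↔ 1 - u < A ω)}.indicator
            (fun u => ENNReal.ofReal (1 / u)) u = {ω | ¬ (1 - u < A' ω ↔ 1 - u < A ω)}.indicator
            (fun _ => ENNReal.ofReal (1 / u)) ω := fun ω => by
          simp only [Set.indicator_apply, Set.mem_ofPred_eq]
        simp_rw [e1]
        rw [lintegral_indicator_const hset, mul_comm]
        gcongr
        simpa only [Iff.comm] using h u hu.2
    _ = _ := by
        rw [lintegral_const_mul _ (by fun_prop), lintegral_one_div_Ioc hr0 hlt.le, hlog,
          ENNReal.ofReal_mul hc]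

lemma lintegral_abs_indicator_sub_le {δ : ℝ} {c : ℝ≥0∞} {A A' : Ω → ℝ} (hA : Measurable A)
    (hA' : Measurable A') (h : μ {ω | ¬ (1 - δ < A ω ↔ 1 - δ < A' ω)} ≤ c) :
    ∫⁻ ω, ENNReal.ofReal |(Set.Iio δ).indicator (1 : ℝ → ℝ) (1 - A' ω) -
      (Set.Iio δ).indicator 1 (1 - A ω)| ∂μ ≤ c := by
  have hset : MeasurableSet {ω | ¬ (1 - δ < A' ω ↔ 1 - δ < A ω)} :=
    (measurableSet_mismatch hA hA').preimage (measurable_id.prodMk measurable_const)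
  calc _ ≤ ∫⁻ ω, {ω | ¬ (1 - δ < A' ω ↔ 1 - δ < A ω)}.indicator 1 ω ∂μ := by
        refine lintegral_mono fun ω => ?_
        have e : ∀ x, (1 - x ∈ Set.Iio δ ↔ 1 - δ < x) := fun x => by
          rw [Set.mem_Iio, sub_lt_comm]
        simp only [Set.indicator_apply, e, Set.mem_ofPred_eq, Pi.one_apply]
        split_ifs <;> simp_all
    _ ≤ c := by
        rw [lintegral_indicator_one hset]
        simpa only [Iff.comm] using h

/-- Effect of replacing a coefficient by its estimate, and of the truncation, on the log excess. -/
lemma TailBounds.lintegral_abs_truncLog_sub_logExcess_le [IsProbabilityMeasure μ]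
    {A A' : Ω → ℝ} (hA : Measurable A) (hA' : Measurable A') {β θ κ C u₀ : ℝ}
    (hν : TailBounds (μ.map (fun ω => 1 - A ω)) β θ κ C u₀) {D : ℝ}
    (hD : ∀ u, 0 < u → u ≤ u₀ → Integrable (logExcess u) (μ.map (fun ω => 1 - A ω)) ∧
      ∫ y, logExcess u y ∂(μ.map (fun ω => 1 - A ω)) ≤ D * u ^ β)
    {δ r c : ℝ} (hδ : 0 < δ) (hδu : δ ≤ u₀) (hr : 1 < r) (hc : 0 ≤ c) (hD0 : 0 ≤ D)
    (h : ∀ u ≤ δ, μ {ω | ¬ (1 - u < A ω ↔ 1 - u < A' ω)} ≤ ENNReal.ofReal c) :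
    ∫⁻ ω, ENNReal.ofReal |truncLog δ r (A' ω) - logExcess δ (1 - A ω)| ∂μ ≤
      ENNReal.ofReal (c * ((r - 1) * -Real.log δ) + D * δ ^ (r * β)) := by
  have hδ1 : δ < 1 := hδu.trans_lt hν.u₀_lt_one
  have hlt := rpow_lt_self_of_one_lt hδ hδ1 hr
  have hr0 : 0 < δ ^ r := by positivity
  have hm : Measurable fun ω => 1 - A ω := by fun_prop
  have hA1 : ∀ᵐ ω ∂μ, A ω < 1 := by
    filter_upwards [ae_of_ae_map hm.aemeasurable hν.ae_mem] with ω hω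
    linarith [hω.1]
  have h2 : ∫⁻ ω, ENNReal.ofReal (logExcess (δ ^ r) (1 - A ω)) ∂μ ≤
      ENNReal.ofReal (D * δ ^ (r * β)) := by
    obtain ⟨hi, hle⟩ := hD _ hr0 (hlt.le.trans hδu)
    rw [← lintegral_map (f := fun y => ENNReal.ofReal (logExcess (δ ^ r) y)) (by fun_prop) hm,
      ← ofReal_integral_eq_lintegral_ofReal hi (ae_of_all _ (logExcess_nonneg _))]
    refine ENNReal.ofReal_le_ofReal (hle.trans_eq ?_)
    rw [Real.rpow_mul hδ.le]
  have hl : 0 ≤ -Real.log δ := by linarith [Real.log_nonpos hδ.le hδ1.le]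
  have hr1 : 0 ≤ r - 1 := by linarith
  rw [ENNReal.ofReal_add (by positivity) (by positivity)]
  refine le_trans ?_ (add_le_add (lintegral_abs_truncLog_sub_le hδ hδ1 hr hc hA hA' h) h2)
  rw [← lintegral_add_left (by fun_prop)]
  refine lintegral_mono_ae ?_
  filter_upwards [hA1] with ω hω
  rw [← ENNReal.ofReal_add (abs_nonneg _) (logExcess_nonneg _ _)]
  refine ENNReal.ofReal_le_ofReal ?_
  have e := truncLog_eq_logExcess_sub hδ hδ1 hr hω
  have e1 : truncLog δ r (A' ω) - logExcess δ (1 - A ω) =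
      (truncLog δ r (A' ω) - truncLog δ r (A ω)) - logExcess (δ ^ r) (1 - A ω) := by
    rw [e]; ring
  rw [e1]
  refine (abs_sub _ _).trans_eq ?_
  rw [abs_of_nonneg (logExcess_nonneg (δ ^ r) _)]

end RCAR

/-! ### Growth conditions -/

namespace RCAR

lemma inv_sqrt_le_gammaRate {p β T δ : ℝ} (hp : 1 < p) (hβ : 1 < β) (hT : 1 ≤ T) (hδ : 0 < δ)
    (hδ1 : δ ≤ 1) : 1 / √(T * δ) ≤ gammaRate p β T δ := by
  have hT0 : 0 < T := by linarith
  rw [gammaRate]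
  refine one_div_le_one_div_of_le (by positivity) ?_
  rw [Real.sqrt_eq_rpow, Real.mul_rpow (by positivity) (by positivity),
    Real.mul_rpow hT0.le hδ.le, ← Real.rpow_mul hT0.le, ← Real.rpow_mul hδ.le]
  have h1 : min (p - 1) (p / 2) * (1 / (p + 1)) ≤ 1 / 2 := by
    have : min (p - 1) (p / 2) ≤ p / 2 := min_le_right _ _
    rw [mul_one_div, div_le_iff₀ (by linarith)]
    linarith
  have h2 : 1 / 2 ≤ (p + β) * (1 / (p + 1)) := by
    rw [mul_one_div, le_div_iff₀ (by linarith)]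
    linarith
  exact mul_le_mul (Real.rpow_le_rpow_of_exponent_le hT h1)
    (Real.rpow_le_rpow_of_exponent_ge hδ hδ1 h2) (by positivity) (by positivity)

/-- For `p ≤ 2` the bias `1 / (T δ ^ β)` is dominated by `gammaRate`, as soon as the latter is at
most one. -/
lemma inv_mul_rpow_le_gammaRate {p β T δ : ℝ} (hp : 1 < p) (hp2 : p ≤ 2) (hβ : 1 < β)
    (hT : 1 ≤ T) (hδ : 0 < δ) (hδ1 : δ ≤ 1) (hγ : gammaRate p β T δ ≤ 1) :
    1 / (T * δ ^ β) ≤ gammaRate p β T δ := by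
  have hT0 : 0 < T := by linarith
  have hm : min (p - 1) (p / 2) = p - 1 := min_eq_left (by linarith)
  rw [gammaRate, hm] at hγ ⊢
  set B := T ^ (p - 1) * δ ^ (p + β) with hB
  have hB0 : 0 < B := by positivity
  have hτ : 0 ≤ Real.log T := Real.log_nonneg hT
  have hl : Real.log δ ≤ 0 := Real.log_nonpos hδ.le hδ1
  have hlogB : Real.log B = (p - 1) * Real.log T + (p + β) * Real.log δ := by
    rw [hB, Real.log_mul (by positivity) (by positivity), Real.log_rpow hT0, Real.log_rpow hδ]
  have hB1 : 0 ≤ Real.log B := by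
    have h1 : 1 ≤ B ^ (1 / (p + 1)) := by
      rwa [div_le_one (by positivity)] at hγ
    have h2 := Real.log_nonneg h1
    rw [Real.log_rpow hB0] at h2
    exact nonneg_of_mul_nonneg_right h2 (by positivity)
  refine one_div_le_one_div_of_le (by positivity) ?_
  rw [← Real.log_le_log_iff (by positivity) (by positivity), Real.log_rpow hB0,
    hlogB, Real.log_mul (by positivity) (by positivity), Real.log_rpow hδ, one_div,
    inv_mul_le_iff₀ (by linarith)]
  rw [hlogB] at hB1
  -- in terms of `τ = log T` and `λ = - log δ` the claim reads `p (β - 1) λ ≤ 2 τ`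
  have h3 : (p - 1) * Real.log T ≤ Real.log T := mul_le_of_le_one_left hτ (by linarith)
  have h4 : 0 ≤ (2 - p) * β * -Real.log δ :=
    mul_nonneg (mul_nonneg (by linarith) (by linarith)) (by linarith)
  have h5 : 0 ≤ p * -Real.log δ := mul_nonneg (by linarith) (by linarith)
  nlinarith

section Rates

variable {β ν p r : ℝ} {δ : ℕ → ℝ} {T : ℕ → ℕ}

lemma eventually_one_le_mul (hp : 1 < p) (hβ : 1 < β) (hδ_pos : ∀ N, 0 < δ N)
    (hδ : Tendsto δ atTop (𝓝 0)) (hT : Tendsto T atTop atTop)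
    (hγ : Tendsto (fun N : ℕ => gammaRate p β (T N) (δ N)) atTop (𝓝 0)) :
    ∀ᶠ N in atTop, 1 ≤ T N * δ N := by
  filter_upwards [hδ.eventually_le_const one_pos, hT.eventually_ge_atTop 1,
    hγ.eventually_le_const one_pos] with N h1 h2 h3
  have hd := hδ_pos N
  have hT1 : (1 : ℝ) ≤ T N := by exact_mod_cast h2
  have h4 := (inv_sqrt_le_gammaRate hp hβ hT1 hd h1).trans h3
  rw [div_le_one (by positivity)] at h4
  exact Real.one_le_sqrt.1 h4

/-- The estimation error of the coefficients is negligible at the rate `√(N δ ^ β)`, even after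
multiplication with `log δ`. -/
lemma tendsto_rate_mul_log (hp : 1 < p) (hβ : 1 < β) (hδ_pos : ∀ N, 0 < δ N)
    (hδ : Tendsto δ atTop (𝓝 0)) (hT : Tendsto T atTop atTop)
    (hγ : Tendsto (fun N : ℕ => gammaRate p β (T N) (δ N)) atTop (𝓝 0))
    (hcond1 : p ≤ 2 → Tendsto (fun N : ℕ => √((N : ℝ) * δ N ^ β) *
      gammaRate p β (T N) (δ N) * Real.log (δ N)) atTop (𝓝 0))
    (hcond2 : 2 < p → Tendsto (fun N : ℕ => √((N : ℝ) * δ N ^ β) *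
      max (1 / ((T N : ℝ) * δ N ^ β)) (gammaRate p β (T N) (δ N)) *
        Real.log (δ N)) atTop (𝓝 0)) :
    Tendsto (fun N : ℕ => √((N : ℝ) * δ N ^ β) *
      (1 / √(T N * δ N) + 1 / ((T N : ℝ) * δ N ^ β)) * -Real.log (δ N)) atTop (𝓝 0) := by
  have key : ∀ b : ℕ → ℝ, (∀ᶠ N in atTop, 1 / √(T N * δ N) ≤ b N ∧
      1 / ((T N : ℝ) * δ N ^ β) ≤ b N) →
      Tendsto (fun N : ℕ => √((N : ℝ) * δ N ^ β) * b N * Real.log (δ N)) atTop (𝓝 0) →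
      Tendsto (fun N : ℕ => √((N : ℝ) * δ N ^ β) *
        (1 / √(T N * δ N) + 1 / ((T N : ℝ) * δ N ^ β)) * -Real.log (δ N)) atTop (𝓝 0) := by
    intro b hb hlim
    have hz := hlim.const_mul (-2)
    rw [mul_zero] at hz
    refine squeeze_zero' ?_ ?_ hz
    · filter_upwards [hδ.eventually_le_const one_pos] with N h1
      have hd := hδ_pos N
      have := Real.log_nonpos hd.le h1
      exact mul_nonneg (by positivity) (by linarith)
    · filter_upwards [hδ.eventually_le_const one_pos, hb] with N h1 h2
      have hd := hδ_pos N
      have hl := Real.log_nonpos hd.le h1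
      have e : -2 * (√((N : ℝ) * δ N ^ β) * b N * Real.log (δ N)) =
          √((N : ℝ) * δ N ^ β) * (b N + b N) * -Real.log (δ N) := by ring
      rw [e]
      refine mul_le_mul_of_nonneg_right ?_ (by linarith)
      exact mul_le_mul_of_nonneg_left (add_le_add h2.1 h2.2) (Real.sqrt_nonneg _)
  have hev : ∀ᶠ N in atTop, δ N ≤ 1 ∧ (1 : ℝ) ≤ T N ∧ gammaRate p β (T N) (δ N) ≤ 1 := by
    filter_upwards [hδ.eventually_le_const one_pos, hT.eventually_ge_atTop 1,
      hγ.eventually_le_const one_pos] with N h1 h2 h3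
    exact ⟨h1, by exact_mod_cast h2, h3⟩
  rcases le_or_gt p 2 with hp2 | hp2
  · refine key _ ?_ (hcond1 hp2)
    filter_upwards [hev] with N ⟨h1, h2, h3⟩
    exact ⟨inv_sqrt_le_gammaRate hp hβ h2 (hδ_pos N) h1,
      inv_mul_rpow_le_gammaRate hp hp2 hβ h2 (hδ_pos N) h1 h3⟩
  · refine key _ ?_ (hcond2 hp2)
    filter_upwards [hev] with N ⟨h1, h2, h3⟩
    exact ⟨(inv_sqrt_le_gammaRate hp hβ h2 (hδ_pos N) h1).trans (le_max_right _ _),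
      le_max_left _ _⟩

lemma tendsto_mul_rpow_of_le {x y : ℝ} (hxy : x ≤ y) (hδ_pos : ∀ N, 0 < δ N)
    (hδ : Tendsto δ atTop (𝓝 0)) (h : Tendsto (fun N : ℕ => (N : ℝ) * δ N ^ x) atTop (𝓝 0)) :
    Tendsto (fun N : ℕ => (N : ℝ) * δ N ^ y) atTop (𝓝 0) := by
  refine squeeze_zero' (Eventually.of_forall fun N => ?_) ?_ h
  · have := hδ_pos N
    positivity
  · filter_upwards [hδ.eventually_le_const one_pos] with N h1
    exact mul_le_mul_of_nonneg_left (Real.rpow_le_rpow_of_exponent_ge (hδ_pos N) h1 hxy)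
      (Nat.cast_nonneg N)

/-- The bias caused by the truncation at level `1 - δ ^ r` is negligible. -/
lemma tendsto_truncation_bias (hδ_pos : ∀ N, 0 < δ N)
    (h : Tendsto (fun N : ℕ => (N : ℝ) * δ N ^ (β + 2 * ((r - 1) * β))) atTop (𝓝 0)) :
    Tendsto (fun N : ℕ => N * δ N ^ (r * β) / √(N * δ N ^ β)) atTop (𝓝 0) := by
  have h1 := (Real.continuous_sqrt.tendsto 0).comp h
  rw [Real.sqrt_zero] at h1
  refine h1.congr fun N => ?_
  have hd := hδ_pos N
  rcases Nat.eq_zero_or_pos N with rfl | hN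
  · simp
  have hN0 : (0 : ℝ) < N := by exact_mod_cast hN
  have hs : 0 < √((N : ℝ) * δ N ^ β) := by positivity
  rw [Function.comp_apply, eq_div_iff hs.ne', ← Real.sqrt_mul (by positivity)]
  have e3 : (δ N ^ (r * β)) ^ 2 = δ N ^ (β + 2 * ((r - 1) * β)) * δ N ^ β := by
    rw [← Real.rpow_natCast, ← Real.rpow_mul hd.le, ← Real.rpow_add hd]
    congr 1
    push_cast
    ring
  have e4 : (N : ℝ) * δ N ^ (β + 2 * ((r - 1) * β)) * (N * δ N ^ β) =
      (N * δ N ^ (r * β)) ^ 2 := by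
    rw [mul_pow, e3]
    ring
  rw [e4, Real.sqrt_sq (by positivity)]

end Rates

/-! ### Sums of errors and ratios -/

section Limit

variable {Ω : Type*} [MeasurableSpace Ω] {μ : Measure Ω}

lemma lintegral_abs_sum_div_sub_le {n : ℕ} {U V : ℕ → Ω → ℝ} (hU : ∀ i, Measurable (U i))
    (hV : ∀ i, Measurable (V i)) {e s : ℝ} (hs : 0 < s)
    (h : ∀ i, ∫⁻ ω, ENNReal.ofReal |U i ω - V i ω| ∂μ ≤ ENNReal.ofReal e) :
    ∫⁻ ω, ENNReal.ofReal |(∑ i ∈ Finset.range n, U i ω) / s -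
      (∑ i ∈ Finset.range n, V i ω) / s| ∂μ ≤ ENNReal.ofReal (n * e / s) := by
  calc _ ≤ ∫⁻ ω, ENNReal.ofReal (1 / s) *
        ∑ i ∈ Finset.range n, ENNReal.ofReal |U i ω - V i ω| ∂μ := by
        refine lintegral_mono fun ω => ?_
        rw [← ENNReal.ofReal_sum_of_nonneg fun i _ => abs_nonneg _,
          ← ENNReal.ofReal_mul (by positivity), ← sub_div, ← Finset.sum_sub_distrib, abs_div,
          abs_of_pos hs, div_eq_mul_one_div, mul_comm]
        refine ENNReal.ofReal_le_ofReal ?_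
        gcongr
        exact Finset.abs_sum_le_sum_abs _ _
    _ = ENNReal.ofReal (1 / s) * ∑ i ∈ Finset.range n,
        ∫⁻ ω, ENNReal.ofReal |U i ω - V i ω| ∂μ := by
        rw [lintegral_const_mul _ (Finset.measurable_sum _ fun i _ => by
          have := hU i; have := hV i; fun_prop), lintegral_finsetSum _ fun i _ => by
          have := hU i; have := hV i; fun_prop]
    _ ≤ ENNReal.ofReal (1 / s) * ∑ _ ∈ Finset.range n, ENNReal.ofReal e := by
        gcongr with i _
        exact h i
    _ = _ := by
        rw [Finset.sum_const, Finset.card_range, nsmul_eq_mul, ← ENNReal.ofReal_natCast,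
          ← ENNReal.ofReal_mul (Nat.cast_nonneg n), ← ENNReal.ofReal_mul (by positivity)]
        congr 1
        ring

/-- Slutsky's theorem for ratios whose denominators converge in probability to a positive constant:
they have to agree with the quotient only where the denominator is positive. -/
lemma tendstoInDistribution_ratio [IsProbabilityMeasure μ] {A B R : ℕ → Ω → ℝ} {v : ℝ≥0} {c : ℝ}
    (hc : 0 < c) (hA : TendstoInDistribution A atTop (id : ℝ → ℝ) (fun _ => μ) (gaussianReal 0 v))
    (hB : TendstoInMeasure μ B atTop fun _ => c) (hBm : ∀ n, Measurable (B n))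
    (hRm : ∀ n, Measurable (R n))
    (hR : ∀ᶠ n in atTop, ∀ ω, 0 < B n ω → R n ω = A n ω / B n ω) {w : ℝ≥0}
    (hw : (w : ℝ) = v / c ^ 2) :
    TendstoInDistribution R atTop (id : ℝ → ℝ) (fun _ => μ) (gaussianReal 0 w) := by
  have hg : Continuous fun q : ℝ × ℝ => q.1 / max q.2 (c / 2) :=
    continuous_fst.div (continuous_snd.max continuous_const) fun q =>
      (lt_max_of_lt_right (by positivity)).ne'
  have h1 := hA.continuous_comp_prodMk_of_tendstoInMeasure_const hg hB
    fun i => (hBm i).aemeasurable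
  have hlim : (gaussianReal 0 v).map (fun x : ℝ => x / max c (c / 2)) = gaussianReal 0 w := by
    rw [max_eq_left (by linarith), gaussianReal_map_div_const]
    congr 1
    · simp
    · refine NNReal.eq ?_
      rw [hw]
      simp
  have h2 : TendstoInDistribution (fun n ω => A n ω / max (B n ω) (c / 2)) atTop (id : ℝ → ℝ)
      (fun _ => μ) (gaussianReal 0 w) := by
    refine ⟨h1.forall_aemeasurable, aemeasurable_id, ?_⟩
    have h3 := h1.tendsto
    convert h3 using 2
    refine congrArg 𝓝 (Subtype.ext ?_)
    change (gaussianReal 0 w).map id = (gaussianReal 0 v).map _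
    rw [Measure.map_id, ← hlim]
    rfl
  refine tendstoInDistribution_of_tendstoInMeasure_sub R id h2 ?_ fun n => (hRm n).aemeasurable
  rw [tendstoInMeasure_iff_norm] at hB ⊢
  intro ε hε
  refine tendsto_of_tendsto_of_tendsto_of_le_of_le' tendsto_const_nhds (hB (c / 2) (by positivity))
    (Eventually.of_forall fun _ => zero_le) ?_
  filter_upwards [hR] with n hn
  refine measure_mono fun ω hω => ?_
  have hω : ε ≤ ‖R n ω - A n ω / max (B n ω) (c / 2) - 0‖ := hω
  change c / 2 ≤ ‖B n ω - c‖
  by_contra! hlt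
  have h4 := (abs_lt.1 (Real.norm_eq_abs (B n ω - c) ▸ hlt)).1
  have h5 : c / 2 < B n ω := by linarith
  rw [hn ω (by linarith), max_eq_left h5.le, sub_self, sub_zero, norm_zero] at hω
  linarith

end Limit

end RCAR

/-! ### Asymptotic normality of the estimator -/

namespace RCAR

variable {Ω : Type*} [MeasurableSpace Ω] {μ : Measure Ω}

lemma tailEstimator_eq {δ r : ℝ} (hδ : 0 < δ) (hδ1 : δ < 1) (hr : 1 < r) (N : ℕ) (x : ℕ → ℝ) :
    tailEstimator δ r N x = (∑ i ∈ Finset.range N, (Set.Iio δ).indicator (1 : ℝ → ℝ) (1 - x i)) /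
      ∑ i ∈ Finset.range N, truncLog δ r (x i) := by
  simp only [tailEstimator, indicator_truncated hδ hδ1 hr]
  rfl

lemma measurable_tailEstimator (δ r : ℝ) (N : ℕ) {x : ℕ → Ω → ℝ} (hx : ∀ i, Measurable (x i)) :
    Measurable fun ω => tailEstimator δ r N fun i => x i ω := by
  unfold tailEstimator truncated
  refine Measurable.div (Finset.measurable_sum _ fun i _ => ?_)
    (Finset.measurable_sum _ fun i _ => ?_)
  · exact (measurable_const.indicator measurableSet_Ioi).comp ((hx i).min measurable_const)
  · exact (measurable_truncLog δ r).comp (hx i)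

/-- The empirical score of the estimated coefficients. -/
noncomputable def truncScore (β δ r x : ℝ) : ℝ :=
  (Set.Iio δ).indicator 1 (1 - x) - β * truncLog δ r x

@[fun_prop]
lemma measurable_truncScore (β δ r : ℝ) : Measurable (truncScore β δ r) :=
  ((measurable_one.indicator measurableSet_Iio).comp (measurable_const.sub measurable_id)).sub
    ((measurable_truncLog δ r).const_mul β)

lemma tendstoInMeasure_of_sub {Z W : ℕ → Ω → ℝ} {c : ℝ} (h : TendstoInMeasure μ (Z - W) atTop 0)
    (hW : TendstoInMeasure μ W atTop fun _ => c) : TendstoInMeasure μ Z atTop fun _ => c := by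
  rw [tendstoInMeasure_iff_norm] at h hW ⊢
  intro ε hε
  have hz := (h (ε / 2) (by positivity)).add (hW (ε / 2) (by positivity))
  rw [add_zero] at hz
  refine tendsto_of_tendsto_of_tendsto_of_le_of_le tendsto_const_nhds hz (fun _ => zero_le)
    fun n => (measure_mono fun ω hω => ?_).trans (measure_union_le _ _)
  have hω : ε ≤ ‖Z n ω - c‖ := hω
  by_contra hn
  simp only [Set.mem_union, Set.mem_ofPred_eq, not_or, not_le, Pi.sub_apply, Pi.zero_apply,
    sub_zero] at hn
  have := norm_sub_le_norm_sub_add_norm_sub (Z n ω) (W n ω) c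
  linarith

/-- Asymptotic normality of the tail index estimator computed from noisy observations `x N i` of
independent variables `a i`: it is enough that `x N i` and `a i` rarely lie on different sides of a
level `1 - u`, uniformly over `u ≤ δ N`. -/
theorem tendstoInDistribution_tailEstimator [IsProbabilityMeasure μ] {a : ℕ → Ω → ℝ}
    (ha : ∀ i, Measurable (a i)) (hind : iIndepFun a μ)
    (hlaw : ∀ i, μ.map (fun ω => 1 - a i ω) = μ.map (fun ω => 1 - a 0 ω)) {β θ κ C u₀ : ℝ}
    (h : TailBounds (μ.map (fun ω => 1 - a 0 ω)) β θ κ C u₀) {x : ℕ → ℕ → Ω → ℝ}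
    (hx : ∀ N i, Measurable (x N i)) {δ : ℕ → ℝ} {r : ℝ} (hr : 1 < r) (hδ_pos : ∀ N, 0 < δ N)
    (hδ : Tendsto δ atTop (𝓝 0))
    (hlarge : Tendsto (fun N : ℕ => (N : ℝ) * δ N ^ β) atTop atTop)
    (hsmall : Tendsto (fun N : ℕ => (N : ℝ) * δ N ^ (β + 2 * θ)) atTop (𝓝 0))
    (htrunc : Tendsto (fun N : ℕ => N * δ N ^ (r * β) / √(N * δ N ^ β)) atTop (𝓝 0))
    {c : ℕ → ℝ} (hc : ∀ N, 0 ≤ c N)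
    (hmis : ∀ᶠ N in atTop, ∀ i, ∀ u ≤ δ N,
      μ {ω | ¬ (1 - u < a i ω ↔ 1 - u < x N i ω)} ≤ ENNReal.ofReal (c N))
    (hrate : Tendsto (fun N : ℕ => N * c N / √(N * δ N ^ β) * -Real.log (δ N)) atTop (𝓝 0)) :
    TendstoInDistribution
      (fun (N : ℕ) (ω : Ω) => √((N : ℝ) * δ N ^ β) *
        (tailEstimator (δ N) r N (fun i => x N i ω) - β))
      atTop (id : ℝ → ℝ) (fun _ => μ) (gaussianReal 0 (Real.toNNReal (β ^ 2 / κ))) := by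
  have hβ : 0 < β := by linarith [h.one_lt_beta]
  have hκ := h.kappa_pos
  have hθ := h.theta_pos
  have hm : ∀ i, Measurable fun ω => 1 - a i ω := fun i => by have := ha i; fun_prop
  have hprob := Measure.isProbabilityMeasure_map (μ := μ) (hm 0).aemeasurable
  have hind' : iIndepFun (fun i ω => 1 - a i ω) μ :=
    hind.comp (fun _ y => 1 - y) fun _ => by fun_prop
  have hu : ∀ᶠ N in atTop, δ N ≤ u₀ := hδ.eventually_le_const h.u₀_pos
  have hpos : ∀ᶠ N : ℕ in atTop, 0 < (N : ℝ) * δ N ^ β := hlarge.eventually_gt_atTop 0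
  -- the mean log excess
  obtain ⟨D₁, hD₁, H1⟩ := h.exists_integral_logExcess_pow 1 one_pos
  simp only [pow_one, Nat.factorial_one, Nat.cast_one] at H1
  set D := κ / β + D₁ with hDdef
  have hD0 : 0 ≤ D := by positivity
  have hD : ∀ u, 0 < u → u ≤ u₀ → Integrable (logExcess u) (μ.map (fun ω => 1 - a 0 ω)) ∧
      ∫ y, logExcess u y ∂(μ.map (fun ω => 1 - a 0 ω)) ≤ D * u ^ β := by
    intro u hu huu
    obtain ⟨h1, h2⟩ := H1 u hu huu
    refine ⟨h1, ?_⟩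
    have h3 : u ^ (β + θ) ≤ u ^ β :=
      Real.rpow_le_rpow_of_exponent_ge hu (huu.trans h.u₀_lt_one.le) (by linarith)
    have h4 := mul_le_mul_of_nonneg_left h3 hD₁.le
    have h5 := (abs_le.1 h2).2
    have e : D * u ^ β = κ * u ^ β * (1 / β) + D₁ * u ^ β := by rw [hDdef]; ring
    linarith
  set e : ℕ → ℝ := fun N => c N * ((r - 1) * -Real.log (δ N)) + D * δ N ^ (r * β) with he
  have hL : ∀ᶠ N in atTop, ∀ i, ∫⁻ ω, ENNReal.ofReal
      |truncLog (δ N) r (x N i ω) - logExcess (δ N) (1 - a i ω)| ∂μ ≤ ENNReal.ofReal (e N) := by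
    filter_upwards [hu, hmis] with N hN hN' i
    exact TailBounds.lintegral_abs_truncLog_sub_logExcess_le (ha i) (hx N i) (hlaw i ▸ h)
      (hlaw i ▸ hD) (hδ_pos N) hN hr (hc N) hD0 (hN' i)
  have he0 : ∀ᶠ N in atTop, 0 ≤ e N := by
    filter_upwards [hδ.eventually_le_const one_pos] with N h1
    have hd := hδ_pos N
    have hl := Real.log_nonpos hd.le h1
    have hr1 : 0 ≤ (r - 1) * -Real.log (δ N) := mul_nonneg (by linarith) (by linarith)
    have := hc N
    positivity
  have hS : ∀ᶠ N in atTop, ∀ i, ∫⁻ ω, ENNReal.ofReal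
      |truncScore β (δ N) r (x N i ω) - score β (δ N) (1 - a i ω)| ∂μ ≤
        ENNReal.ofReal (c N + β * e N) := by
    filter_upwards [hmis, hL, he0] with N hN hN' hN0 i
    have h1 := lintegral_abs_indicator_sub_le (ha i) (hx N i) (hN i (δ N) le_rfl)
    rw [ENNReal.ofReal_add (hc N) (by positivity), ENNReal.ofReal_mul hβ.le]
    refine le_trans ?_ (add_le_add h1 (mul_le_mul_right (hN' i) (ENNReal.ofReal β)))
    have m1 := hx N i
    have m2 := ha i
    rw [← lintegral_const_mul _ (by fun_prop), ← lintegral_add_right _ (by fun_prop)]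
    refine lintegral_mono fun ω => ?_
    rw [← ENNReal.ofReal_mul hβ.le, ← ENNReal.ofReal_add (abs_nonneg _) (by positivity)]
    refine ENNReal.ofReal_le_ofReal ?_
    rw [truncScore, score]
    have e1 : ∀ p q s t : ℝ, (p - β * q) - (s - β * t) = (p - s) - β * (q - t) := by
      intro p q s t; ring
    rw [e1]
    refine (abs_sub _ _).trans_eq ?_
    rw [abs_mul, abs_of_pos hβ]
  -- rates
  have hlog1 : ∀ᶠ N in atTop, 1 ≤ -Real.log (δ N) := by
    filter_upwards [hδ.eventually_le_const (Real.exp_pos (-1))] with N h1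
    have := Real.log_le_log (hδ_pos N) h1
    rw [Real.log_exp] at this
    linarith
  have hrate0 : Tendsto (fun N : ℕ => N * c N / √(N * δ N ^ β)) atTop (𝓝 0) := by
    refine squeeze_zero' (Eventually.of_forall fun N => ?_) ?_ hrate
    · have := hc N
      positivity
    · filter_upwards [hlog1] with N hN
      have := hc N
      exact le_mul_of_one_le_right (by positivity) hN
  have hrateL : Tendsto (fun N : ℕ => N * e N / √(N * δ N ^ β)) atTop (𝓝 0) := by
    have h1 := (hrate.const_mul (r - 1)).add (htrunc.const_mul D)
    rw [mul_zero, mul_zero, add_zero] at h1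
    refine h1.congr fun N => ?_
    simp only [he]
    ring
  have hrateS : Tendsto (fun N : ℕ => N * (c N + β * e N) / √(N * δ N ^ β)) atTop (𝓝 0) := by
    have h1 := hrate0.add (hrateL.const_mul β)
    rw [mul_zero, add_zero] at h1
    refine h1.congr fun N => ?_
    ring
  have hrateL' : Tendsto (fun N : ℕ => N * e N / (N * δ N ^ β)) atTop (𝓝 0) := by
    have hinv : Tendsto (fun n : ℕ => (√(n * δ n ^ β))⁻¹) atTop (𝓝 0) :=
      (Real.tendsto_sqrt_atTop.comp hlarge).inv_tendsto_atTop
    have h1 := hrateL.mul hinv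
    rw [mul_zero] at h1
    refine h1.congr' ?_
    filter_upwards [hpos] with N hN
    rw [← div_eq_mul_inv, div_div, Real.mul_self_sqrt hN.le]
  -- the numerator and the denominator of the normalized estimator
  set A : ℕ → Ω → ℝ := fun N ω =>
    (∑ i ∈ Finset.range N, truncScore β (δ N) r (x N i ω)) / √(N * δ N ^ β) with hA
  set B : ℕ → Ω → ℝ := fun N ω =>
    (∑ i ∈ Finset.range N, truncLog (δ N) r (x N i ω)) / (N * δ N ^ β) with hB
  have hAm : ∀ N, Measurable (A N) := fun N =>
    (Finset.measurable_sum _ fun i _ => by have := hx N i; fun_prop).div_const _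
  have hBm : ∀ N, Measurable (B N) := fun N =>
    (Finset.measurable_sum _ fun i _ => by have := hx N i; fun_prop).div_const _
  have hAlim : TendstoInDistribution A atTop (id : ℝ → ℝ) (fun _ => μ)
      (gaussianReal 0 κ.toNNReal) := by
    have h1 := h.tendstoInDistribution_sum_score hm hind' hlaw hδ_pos hδ hlarge hsmall
    refine tendstoInDistribution_of_tendstoInMeasure_sub A id h1 ?_
      fun N => (hAm N).aemeasurable
    refine tendstoInMeasure_of_lintegral_le hAm (fun N => ?_) hrateS ?_
    · exact Finset.measurable_sum _ fun i _ => by have := ha i; fun_prop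
    · filter_upwards [hpos, hS] with N hN hN'
      simp only [← Finset.sum_div]
      exact lintegral_abs_sum_div_sub_le (fun i => by have := hx N i; fun_prop)
        (fun i => by have := ha i; fun_prop) (Real.sqrt_pos.2 hN) hN'
  have hBlim : TendstoInMeasure μ B atTop fun _ => κ / β := by
    have h1 := h.tendstoInMeasure_sum_logExcess hm hind' hlaw hδ_pos hδ hlarge
    have h2 : TendstoInMeasure μ (B - fun (N : ℕ) ω =>
        (∑ i ∈ Finset.range N, logExcess (δ N) (1 - a i ω)) / (N * δ N ^ β)) atTop 0 := by
      refine tendstoInMeasure_of_lintegral_le hBm (fun N => ?_) hrateL' ?_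
      · exact (Finset.measurable_sum _ fun i _ => by have := ha i; fun_prop).div_const _
      · filter_upwards [hpos, hL] with N hN hN'
        exact lintegral_abs_sum_div_sub_le (fun i => by have := hx N i; fun_prop)
          (fun i => by have := ha i; fun_prop) hN hN'
    exact tendstoInMeasure_of_sub h2 h1
  refine tendstoInDistribution_ratio (c := κ / β) (by positivity) hAlim hBlim hBm
    (fun N => ((measurable_tailEstimator (δ N) r N (hx N)).sub_const β).const_mul _) ?_ ?_
  · filter_upwards [hpos, hδ.eventually_lt_const one_pos] with N hN hN1 ω hBpos
    have hs : √((N : ℝ) * δ N ^ β) ≠ 0 := (Real.sqrt_pos.2 hN).ne'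
    have hsq : √((N : ℝ) * δ N ^ β) ^ 2 = N * δ N ^ β := Real.sq_sqrt hN.le
    have hden : (∑ i ∈ Finset.range N, truncLog (δ N) r (x N i ω)) ≠ 0 := by
      intro h0
      refine hBpos.ne' ?_
      change (∑ i ∈ Finset.range N, truncLog (δ N) r (x N i ω)) / (N * δ N ^ β) = 0
      rw [h0, zero_div]
    rw [tailEstimator_eq (hδ_pos N) hN1 hr]
    have alg : ∀ s E l : ℝ, s ≠ 0 → l ≠ 0 →
        s * (E / l - β) = (E - β * l) / s / (l / s ^ 2) := fun s E l hs hl => by field_simp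
    refine (alg _ _ _ hs hden).trans ?_
    rw [hsq, Finset.mul_sum, ← Finset.sum_sub_distrib]
    rfl
  · rw [Real.coe_toNNReal _ (by positivity), Real.coe_toNNReal _ hκ.le]
    field_simp

lemma measurable_sampleAutocorr {X : ℤ → Ω → ℝ} (hX : ∀ t, Measurable (X t)) (T : ℕ) :
    Measurable fun ω => sampleAutocorr (fun t => X t ω) T := by
  unfold sampleAutocorr sampleMean
  fun_prop

namespace IIDShock

variable {ι ι' : Type*} {Z : ι → Ω → ℝ} {p : ℝ}

lemma precomp (h : IIDShock μ Z p) {g : ι' → ι} (hg : Function.Injective g) :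
    IIDShock μ (fun j => Z (g j)) p where
  measurable _ := h.measurable _
  indep := h.indep.precomp hg
  identDistrib _ _ := h.identDistrib _ _
  mean_zero _ := h.mean_zero _
  variance_one _ := h.variance_one _
  moment _ := h.moment _

lemma integrable_sq (h : IIDShock μ Z p) (j : ι) : Integrable (fun ω => Z j ω ^ 2) μ := by
  by_contra hn
  have := h.variance_one j
  rw [integral_undef hn] at this
  exact zero_ne_one this

lemma isNoise {Z : ℤ → Ω → ℝ} (h : IIDShock μ Z p) : IsNoise μ Z where
  measurable := h.measurable
  indep := h.indep
  memLp t := (memLp_two_iff_integrable_sq (h.measurable t).aestronglyMeasurable).2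
    (h.integrable_sq t)
  mean_zero := h.mean_zero
  variance_one := h.variance_one

/-- Uniform integrability of the squared shocks. -/
lemma exists_integral_max_sub_le [IsProbabilityMeasure μ] [Nonempty ι] (h : IIDShock μ Z p) :
    ∃ K₀ : ℝ, ∀ K ≥ K₀, ∀ j, ∫ ω, max (Z j ω ^ 2 - K) 0 ∂μ ≤ 1 / 4 := by
  obtain ⟨j₀⟩ := ‹Nonempty ι›
  obtain ⟨K₀, hK₀⟩ := RCAR.exists_integral_max_sub_le (h.integrable_sq j₀)
  refine ⟨K₀, fun K hK j => (le_of_eq ?_).trans (hK₀ K hK)⟩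
  exact ((h.identDistrib j j₀).comp (u := fun z => max (z ^ 2 - K) 0) (by fun_prop)).integral_eq

end IIDShock

lemma unitModel [IsProbabilityMeasure μ] {a b c : ℕ → Ω → ℝ} {η : ℤ → Ω → ℝ}
    {ξ X : ℕ → ℤ → Ω → ℝ} {β ν κ p : ℝ} (hG : CondG μ a β ν κ) (hA : CondA μ a b c η ξ p)
    (hX : ∀ i, IsStationaryRCAR μ (a i) (innovation b c η ξ i) (X i)) (i : ℕ) :
    UnitModel μ (a i) (b i) (c i) η (ξ i) (X i) where
  measurable_A := hG.measurable i
  measurable_B := hA.measurable_b i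
  measurable_C := hA.measurable_c i
  noise_η := hA.common.isNoise
  noise_ξ := (hA.idiosyncratic.precomp (Prod.mk_right_injective i)).isNoise
  indep_shocks := (IndepFun_iff_Indep _ _ _).2
    ((hA.mutual_indep i).indep (i := 0) (j := 1) (by decide))
  indep_coeff := by
    have mη : Measurable fun ω (t : ℤ) => η t ω := measurable_pi_iff.2 hA.common.measurable
    have mξ : Measurable fun ω (t : ℤ) => ξ i t ω :=
      measurable_pi_iff.2 fun t => hA.idiosyncratic.measurable (i, t)
    have mw : Measurable fun ω => (b i ω, c i ω) := (hA.measurable_b i).prodMk (hA.measurable_c i)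
    have h1 := indep_iSup_of_disjoint (S := {2, 3}) (T := {0, 1}) (fun j => ?_)
      (hA.mutual_indep i) (by
        rw [Set.disjoint_left]
        rintro j (rfl | rfl) <;> simp [Fin.ext_iff])
    · rw [IndepFun_iff_Indep]
      refine indep_of_indep_of_le_left (indep_of_indep_of_le_right h1 ?_) ?_
      · rw [iSup_pair]
        exact (MeasurableSpace.comap_prodMk (fun ω (t : ℤ) => η t ω) fun ω (t : ℤ) => ξ i t ω).le
      · rw [iSup_pair]
        exact (MeasurableSpace.comap_prodMk (a i) fun ω => (b i ω, c i ω)).le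
    · fin_cases j
      exacts [mη.comap_le, mξ.comap_le, (hG.measurable i).comap_le, mw.comap_le]
  mem_Ioo := hG.mem_Ioo i
  weights_pos := by
    have h0 : ∀ᵐ ω ∂μ, b i ω + c i ω ≠ 0 := by
      rw [ae_iff]
      simpa using hA.weights_ne_zero i
    filter_upwards [hA.weights_nonneg i, h0] with ω h1 h2
    by_contra h3
    have hb := sq_nonneg (b i ω)
    have hc := sq_nonneg (c i ω)
    have hb0 : b i ω = 0 := pow_eq_zero_iff two_ne_zero |>.1 (by linarith)
    have hc0 : c i ω = 0 := pow_eq_zero_iff two_ne_zero |>.1 (by linarith)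
    exact h2 (by rw [hb0, hc0, add_zero])
  stationary := (hX i).1
  recursion := (hX i).2

end RCAR

theorem corollary1 {Ω : Type*} [MeasurableSpace Ω] (μ : Measure Ω) [IsProbabilityMeasure μ]
    (a b c : ℕ → Ω → ℝ) (η : ℤ → Ω → ℝ) (ξ X : ℕ → ℤ → Ω → ℝ)
    (β ν κ p r : ℝ) (hr : 1 < r)
    (hG : RCAR.CondG μ a β ν κ)
    (hA : RCAR.CondA μ a b c η ξ p)
    (hX : ∀ i, RCAR.IsStationaryRCAR μ (a i) (RCAR.innovation b c η ξ i) (X i))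
    (δ : ℕ → ℝ) (T : ℕ → ℕ)
    (hδ_pos : ∀ N, 0 < δ N)
    (hδ : Tendsto δ atTop (𝓝 0))
    (hδ_large : Tendsto (fun N : ℕ => (N : ℝ) * δ N ^ β) atTop atTop)
    (hδ_small : Tendsto (fun N : ℕ => (N : ℝ) * δ N ^ (β + 2 * min ν ((r - 1) * β)))
      atTop (𝓝 0))
    (hT : Tendsto T atTop atTop)
    (hγ : Tendsto (fun N : ℕ => RCAR.gammaRate p β (T N) (δ N)) atTop (𝓝 0))
    (hcond1 : p ≤ 2 → Tendsto (fun N : ℕ => √((N : ℝ) * δ N ^ β) *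
      RCAR.gammaRate p β (T N) (δ N) * Real.log (δ N)) atTop (𝓝 0))
    (hcond2 : 2 < p → Tendsto (fun N : ℕ => √((N : ℝ) * δ N ^ β) *
      max (1 / ((T N : ℝ) * δ N ^ β)) (RCAR.gammaRate p β (T N) (δ N)) *
        Real.log (δ N)) atTop (𝓝 0)) :
    TendstoInDistribution
      (fun (N : ℕ) (ω : Ω) => √((N : ℝ) * δ N ^ β) *
        (RCAR.tailEstimator (δ N) r N
          (fun i => RCAR.sampleAutocorr (fun t => X i t ω) (T N)) - β))
      atTop (id : ℝ → ℝ) (fun _ => μ) (gaussianReal 0 (Real.toNNReal (β ^ 2 / κ))) := by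
  have hβ := hG.one_lt_beta
  obtain ⟨C, u₀, hTB⟩ := hG.exists_tailBounds
  have hC := hTB.C_pos
  obtain ⟨K₁, hK₁⟩ := hA.common.exists_integral_max_sub_le
  obtain ⟨K₂, hK₂⟩ := hA.idiosyncratic.exists_integral_max_sub_le
  -- a truncation level for the squared shocks that serves all units at once
  set L := 2 * max 1 (max K₁ K₂) with hL
  have hL0 : 0 < L := by positivity
  have hL2 : L / 2 = max 1 (max K₁ K₂) := by rw [hL]; ring
  have hmin1 := min_le_left ν ((r - 1) * β)
  have hmin2 := min_le_right ν ((r - 1) * β)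
  refine RCAR.tendstoInDistribution_tailEstimator hG.measurable hG.indep hG.map_one_sub_eq hTB
    (x := fun N i ω => RCAR.sampleAutocorr (fun t => X i t ω) (T N))
    (fun N i => RCAR.measurable_sampleAutocorr (hX i).1.1 (T N)) hr hδ_pos hδ hδ_large
    (RCAR.tendsto_mul_rpow_of_le (by linarith) hδ_pos hδ hδ_small)
    (RCAR.tendsto_truncation_bias hδ_pos
      (RCAR.tendsto_mul_rpow_of_le (by linarith) hδ_pos hδ hδ_small))
    (c := fun N => (64 * L ^ 2 + 40000 * C * 4 ^ β) *
      (δ N ^ β / √(T N * δ N) + 1 / T N)) (fun N => ?_) ?_ ?_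
  · have := hδ_pos N
    positivity
  · filter_upwards [RCAR.eventually_one_le_mul hA.one_lt_p hβ hδ_pos hδ hT hγ,
      hT.eventually_ge_atTop 2, hδ.eventually_le_const (div_pos hTB.u₀_pos four_pos)]
      with N h1 h2 h3 i u hu
    refine (RCAR.unitModel hG hA hX i).measure_mismatch_le (hG.map_one_sub_eq i ▸ hTB) hL0
      (hK₁ _ ?_) (fun t => hK₂ _ ?_ (i, t)) h2 hu (hδ_pos N) (by linarith) h1
    · rw [hL2]
      exact (le_max_left _ _).trans (le_max_right _ _)
    · rw [hL2]
      exact (le_max_right _ _).trans (le_max_right _ _)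
  · have h1 := (RCAR.tendsto_rate_mul_log hA.one_lt_p hβ hδ_pos hδ hT hγ hcond1 hcond2).const_mul
      (64 * L ^ 2 + 40000 * C * 4 ^ β)
    rw [mul_zero] at h1
    refine h1.congr' ?_
    filter_upwards [hδ_large.eventually_gt_atTop 0, hT.eventually_ge_atTop 1] with N hN hT1
    have hd := hδ_pos N
    have hT0 : (0 : ℝ) < T N := by exact_mod_cast hT1
    have hs : √((N : ℝ) * δ N ^ β) ≠ 0 := (Real.sqrt_pos.2 hN).ne'
    have hsq : √((N : ℝ) * δ N ^ β) * √((N : ℝ) * δ N ^ β) = N * δ N ^ β :=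
      Real.mul_self_sqrt hN.le
    have e : δ N ^ β / √(T N * δ N) + 1 / T N =
        δ N ^ β * (1 / √(T N * δ N) + 1 / ((T N : ℝ) * δ N ^ β)) := by
      have : δ N ^ β ≠ 0 := by positivity
      field_simp
    have alg : ∀ M s w l n d : ℝ, s ≠ 0 → s * s = n * d →
        M * (s * w * l) = n * (M * (d * w)) / s * l := fun M s w l n d h0 h2 => by
      field_simp
      linear_combination (M * w * l) * h2
    rw [e]
    exact alg _ _ _ _ _ _ hs hsq
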